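/- Let $\mathrm{Vect}_{\rm P}(\mathbb R)$ be the Lie algebra of polynomial vector fields $X=f\frac{d}{dx}$, $Y=g\frac{d}{dx}$ on $\mathbb R$. For $\lambda\in\mathbb R$ let $\mathcal F_\lambda$ be the space of smooth densities $\phi\,dx^\lambda$, with action $L_X^\lambda(\phi\,dx^\lambda)=(f\phi'+\lambda f'\phi)\,dx^\lambda$, and let $\mathcal D_{\lambda,\mu}$ be the module of linear differential operators $A:\mathcal F_\lambda\to\mathcal F_\mu$ with smooth coefficients, with action $L_X(A)=L_X^\mu A-AL_X^\lambda$. Let $\mathrm H^2(\mathrm{Vect}_{\rm P}(\mathbb R);\mathcal D_{\lambda,\mu})$ be the differential cohomology: differential 2-cocycles, i.e. cocycles of the form $c(X,Y)\phi=\sum a_{ijl}f^{(i)}g^{(j)}\phi^{(l)}$ (finite sum, $a_{ijl}$ smooth), modulo coboundaries of differential 1-cochains $B(X)\phi=\sum b_{il}f^{(i)}\phi^{(l)}$. Write $$W_{i,j}=\begin{vmatrix} f^{(i)}&g^{(i)}\\ f^{(j)}&g^{(j)}\end{vmatrix},\qquad \omega=W_{1,2},\qquad \partial=\tfrac{d}{dx}.$$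 **(A) Dimensions.** $\mathrm H^2(\mathrm{Vect}_{\rm P}(\mathbb R);\mathcal D_{\lambda,\mu})$ is isomorphic * to $\mathbb R$ if $(\lambda,\mu)=(0,1)$; or $\mu-\lambda\in\{2,3,4\}$; or $\mu-\lambda\in\{7,8,9,10,11\}$; or $\mu-\lambda=k\in\{12,13,14\}$ and $\lambda\in\left\{\frac{1-k}2,\ \frac{1-k}2\pm\frac{\sqrt{12k-23}}2\right\}$; * to $\mathbb R^2$ if $(\lambda,\mu)=(0,5)$, $(-4,1)$ or $\left(-\frac52\pm\frac{\sqrt{19}}2,\frac72\pm\frac{\sqrt{19}}2\right)$ (same sign in both entries); * to $0$ for all other $(\lambda,\mu)$. **(B) $\mu-\lambda\le 6$.** The following are differential 2-cocycles whose classes span $\mathrm H^2(\mathrm{Vect}_{\rm P}(\mathbb R);\mathcal D_{\lambda,\mu})$. 1. $(\lambda,\mu)=(0,1)$: $\Omega_1=\omega$. 2. $\mu-\lambda=2$: $\Omega_2=c_{1,2}\,\omega\,\partial+c_{1,3}W_{1,3}$, with $(c_{1,2},c_{1,3})=(1,0)$ if $\lambda=-\frac12$ and $(0,1)$ otherwise.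 3. $\mu-\lambda=3$: $\Omega_3=c_{1,2}\,\omega\,\partial^2+c_{1,3}W_{1,3}\,\partial+\frac\lambda2(c_{1,2}-c_{1,3})W_{1,4}$, with $(c_{1,2},c_{1,3})=(1,0)$ if $\lambda=-1$ and $(0,1)$ otherwise. 4. $\mu-\lambda=4$: $\Omega_4=c_{1,2}\,\omega\,\partial^3+c_{1,3}W_{1,3}\,\partial^2+\frac12\big((1+3\lambda)c_{1,2}-(1+2\lambda)c_{1,3}\big)W_{1,4}\,\partial+\frac{\lambda}{10}\big((1-3\lambda)c_{1,2}+(1+2\lambda)c_{1,3}\big)W_{1,5}$, with $(c_{1,2},c_{1,3})=(1,0)$ if $\lambda=-\frac32$ and $(0,1)$ otherwise. 5. $(\lambda,\mu)=(0,5)$ or $(-4,1)$: for all real $\alpha,\beta$ (spanning by $(\alpha,\beta)=(1,0)$ and $(0,1)$), $$\Omega_5=3\alpha(1+\lambda)(1+2\lambda)\,\omega\,\partial^4+2\alpha(1+3\lambda+6\lambda^2)W_{1,3}\,\partial^3+3\alpha(1+\lambda)(1+4\lambda)W_{1,4}\,\partial^2-\tfrac15\alpha\lambda(1+9\lambda)W_{1,6}+\beta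 W_{3,4}.$$ 6. $\lambda=-\frac52\pm\frac{\sqrt{19}}2$, $\mu=\lambda+6$: for all real $\alpha,\beta$ (spanning by $(\alpha,\beta)=(1,0)$ and $(0,1)$), $$\begin{aligned}\Omega_6={}&\alpha(4+3\lambda(5+2\lambda))\,\omega\,\partial^5+5\alpha(2+\lambda(4+3\lambda))W_{1,3}\,\partial^4+5\alpha(\lambda(3+4\lambda)-2)W_{1,4}\,\partial^3\\&+5\alpha(2+\lambda(4+3\lambda))W_{1,5}\,\partial^2+\beta W_{3,4}\,\partial+\alpha(4+15\lambda+6\lambda^2)W_{1,6}\,\partial-\tfrac{\lambda}5\beta W_{3,5}.\end{aligned}$$ **(C) $\mu-\lambda=k\ge7$.** Let $\mathfrak{sl}(2)=\mathrm{Span}(\partial,x\partial,x^2\partial)$. For every integer $k\ge 7$ and every $\lambda$, the classes of the differential 2-cocycles $c$ vanishing on $\mathfrak{sl}(2)$ (i.e. $c(X,Y)=0$ for $X\in\mathfrak{sl}(2)$ and all $Y$) span $\mathrm H^2(\mathrm{Vect}_{\rm P}(\mathbb R);\mathcal D_{\lambda,\lambda+k})$, and each such cocycle has the form $\sum_{3\le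 i<j,\ i+j\le k+2}c_{i,j}W_{i,j}\,\partial^{k+2-i-j}$ with real constants $c_{i,j}$. If $k\in\{7,\dots,11\}$, or if $k\in\{12,13,14\}$ and $\lambda\in\left\{\frac{1-k}2,\frac{1-k}2\pm\frac{\sqrt{12k-23}}2\right\}$, then for all $a,b\in\mathbb R$ there is exactly one differential 2-cocycle vanishing on $\mathfrak{sl}(2)$ of this form with $c_{3,4}=a$ and $c_{4,5}=b$; the class of the one with $(c_{3,4},c_{4,5})=(0,1)$ spans the cohomology if $k^2+4(\lambda-1)\lambda+k(4\lambda-5)\ne0$, and the class of the one with $(c_{3,4},c_{4,5})=(1,0)$ spans it if $k^2+4(\lambda-1)\lambda+k(4\lambda-5)=0$. -/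

import Mathlib

open scoped ContDiff
open LieModule.Cohomology

noncomputable section

namespace VectCoh

/-- The algebra of smooth real functions on the line. -/
def smoothSubalgebra : Subalgebra ℝ (ℝ → ℝ) where
  carrier := {φ | ContDiff ℝ ∞ φ}
  mul_mem' {a b} ha hb := by
    change ContDiff ℝ ∞ a at ha
    change ContDiff ℝ ∞ b at hb
    exact ha.mul hb
  add_mem' {a b} ha hb := by
    change ContDiff ℝ ∞ a at ha
    change ContDiff ℝ ∞ b at hb
    exact ha.add hb
  algebraMap_mem' c := by
    change ContDiff ℝ ∞ fun _ : ℝ => c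
    exact contDiff_const

/-- Smooth real functions on the line. -/
def Smooth : Type := smoothSubalgebra

instance : CommRing Smooth := inferInstanceAs (CommRing smoothSubalgebra)

instance : Algebra ℝ Smooth := inferInstanceAs (Algebra ℝ smoothSubalgebra)

/-- The derivative `φ ↦ φ'` on smooth functions. -/
def D : Smooth →ₗ[ℝ] Smooth where
  toFun φ := ⟨deriv φ.1, (contDiff_infty_iff_deriv.1 φ.2).2⟩
  map_add' φ ψ := by
    apply Subtype.ext
    funext x
    exact deriv_add ((contDiff_infty_iff_deriv.1 φ.2).1 x) ((contDiff_infty_iff_deriv.1 ψ.2).1 x)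
  map_smul' c φ := by
    apply Subtype.ext
    funext x
    exact deriv_const_mul c ((contDiff_infty_iff_deriv.1 φ.2).1 x)

theorem D_mul (φ ψ : Smooth) : D (φ * ψ) = D φ * ψ + φ * D ψ := by
  apply Subtype.ext
  funext x
  exact deriv_mul ((contDiff_infty_iff_deriv.1 φ.2).1 x) ((contDiff_infty_iff_deriv.1 ψ.2).1 x)

/-- A real polynomial regarded as a smooth function. -/
def ofPoly : Polynomial ℝ →ₗ[ℝ] Smooth where
  toFun p := ⟨fun x => p.eval x, by
    change ContDiff ℝ ∞ fun x => p.eval x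
    simpa using p.contDiff_aeval (𝕜 := ℝ) ∞⟩
  map_add' p q := by
    apply Subtype.ext
    funext x
    exact Polynomial.eval_add
  map_smul' c p := by
    apply Subtype.ext
    funext x
    change Polynomial.eval x (c • p) = c • Polynomial.eval x p
    simp

theorem ofPoly_mul (p q : Polynomial ℝ) : ofPoly (p * q) = ofPoly p * ofPoly q := by
  apply Subtype.ext
  funext x
  exact Polynomial.eval_mul

theorem D_ofPoly (p : Polynomial ℝ) : D (ofPoly p) = ofPoly (Polynomial.derivative p) := by
  apply Subtype.ext
  funext x
  exact p.deriv

/-- The Lie algebra of polynomial vector fields `f d/dx` on the real line, as the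
derivations of `ℝ[x]`. -/
abbrev VectP : Type := Derivation ℝ (Polynomial ℝ) (Polynomial ℝ)

/-- The coefficient `f` of `X = f d/dx`, as a smooth function. -/
def coef : VectP →ₗ[ℝ] Smooth where
  toFun X := ofPoly (X Polynomial.X)
  map_add' X Y := by simp
  map_smul' c X := by simp

theorem coef_lie (X Y : VectP) : coef ⁅X, Y⁆ = coef X * D (coef Y) - D (coef X) * coef Y := by
  have h (X : VectP) (p : Polynomial ℝ) : X p = Polynomial.derivative p * X Polynomial.X := by
    have := congrArg (fun Z : VectP => Z p)
      (Polynomial.mkDerivation_X ℝ (X Polynomial.X) ▸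
        (Polynomial.derivation_ext (D₁ := X)
          (D₂ := Polynomial.mkDerivation ℝ (X Polynomial.X)) (by simp)))
    simpa [Polynomial.mkDerivation_apply] using this
  change ofPoly (⁅X, Y⁆ Polynomial.X) = ofPoly _ * D (ofPoly _) - D (ofPoly _) * ofPoly _
  rw [Derivation.commutator_apply, h X (Y Polynomial.X), h Y (X Polynomial.X), map_sub,
    D_ofPoly, D_ofPoly, ofPoly_mul, ofPoly_mul]
  ring

/-- The space `F_lam` of smooth densities `φ dx^lam` of weight `lam`; the element `φ dx^lam` is
represented by the function `φ`. -/
def Density (_lam : ℝ) : Type := Smooth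

instance (lam : ℝ) : AddCommGroup (Density lam) := inferInstanceAs (AddCommGroup Smooth)

instance (lam : ℝ) : Module ℝ (Density lam) := inferInstanceAs (Module ℝ Smooth)

/-- The density `φ dx^lam`. -/
def Density.of (lam : ℝ) : Smooth ≃ₗ[ℝ] Density lam := LinearEquiv.refl ℝ Smooth

/-- The coefficient `f φ' + lam f' φ` of the Lie derivative of `φ dx^lam` along `X = f d/dx`. -/
def lieDer (lam : ℝ) (X : VectP) (φ : Smooth) : Smooth :=
  coef X * D φ + lam • (D (coef X) * φ)

theorem add_lieDer (lam : ℝ) (X Y : VectP) (φ : Smooth) :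
    lieDer lam (X + Y) φ = lieDer lam X φ + lieDer lam Y φ := by
  simp only [lieDer, map_add]
  simp only [Algebra.smul_def]
  ring

theorem lieDer_add (lam : ℝ) (X : VectP) (φ ψ : Smooth) :
    lieDer lam X (φ + ψ) = lieDer lam X φ + lieDer lam X ψ := by
  simp only [lieDer, map_add]
  simp only [Algebra.smul_def]
  ring

theorem smul_lieDer (lam c : ℝ) (X : VectP) (φ : Smooth) :
    lieDer lam (c • X) φ = c • lieDer lam X φ := by
  simp only [lieDer, map_smul]
  simp only [Algebra.smul_def]
  ring

theorem lieDer_smul (lam c : ℝ) (X : VectP) (φ : Smooth) :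
    lieDer lam X (c • φ) = c • lieDer lam X φ := by
  simp only [lieDer, map_smul]
  simp only [Algebra.smul_def]
  ring

theorem lieDer_lie (lam : ℝ) (X Y : VectP) (φ : Smooth) :
    lieDer lam X (lieDer lam Y φ) = lieDer lam ⁅X, Y⁆ φ + lieDer lam Y (lieDer lam X φ) := by
  simp only [lieDer, coef_lie, map_add, map_sub, map_smul, D_mul]
  simp only [Algebra.smul_def]
  ring

/-- The action `L_X (φ dx^lam) = (f φ' + lam f' φ) dx^lam` on densities. -/
instance (lam : ℝ) : LieRingModule VectP (Density lam) where
  bracket X φ := Density.of lam (lieDer lam X ((Density.of lam).symm φ))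
  add_lie X Y φ := add_lieDer lam X Y φ
  lie_add X φ ψ := lieDer_add lam X φ ψ
  leibniz_lie X Y φ := lieDer_lie lam X Y φ

instance (lam : ℝ) : LieModule ℝ VectP (Density lam) where
  smul_lie c X φ := smul_lieDer lam c X φ
  lie_smul c X φ := lieDer_smul lam c X φ

theorem lie_of (lam : ℝ) (X : VectP) (φ : Smooth) :
    ⁅X, Density.of lam φ⁆ = Density.of lam (lieDer lam X φ) := rfl

/-- The linear differential operators `φ ↦ ∑ a_l φ^(l)` (finite sums, smooth `a_l`). -/
def diffOps : Submodule ℝ (Smooth →ₗ[ℝ] Smooth) where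
  carrier := {A | ∃ a : ℕ →₀ Smooth, ∀ φ, A φ = a.sum fun l b => b * (D ^ l) φ}
  zero_mem' := ⟨0, fun φ => by simp⟩
  add_mem' := by
    rintro A B ⟨a, ha⟩ ⟨b, hb⟩
    refine ⟨a + b, fun φ => ?_⟩
    rw [Finsupp.sum_add_index' (by simp) (by intros; ring), LinearMap.add_apply, ha, hb]
  smul_mem' := by
    rintro c A ⟨a, ha⟩
    refine ⟨c • a, fun φ => ?_⟩
    rw [Finsupp.sum_smul_index' (by simp), LinearMap.smul_apply, ha, Finsupp.smul_sum]
    simp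

theorem monomial_mem_diffOps (b : Smooth) (l : ℕ) : LinearMap.mulLeft ℝ b ∘ₗ D ^ l ∈ diffOps :=
  ⟨Finsupp.single l b, fun φ => by simp⟩

theorem diffOps_eq_span : diffOps =
    Submodule.span ℝ (Set.range fun t : Smooth × ℕ => LinearMap.mulLeft ℝ t.1 ∘ₗ D ^ t.2) := by
  apply le_antisymm
  · rintro A ⟨a, ha⟩
    have : A = a.sum fun l b => LinearMap.mulLeft ℝ b ∘ₗ D ^ l := by
      ext1 φ
      rw [ha]
      simp [Finsupp.sum, LinearMap.sum_apply]
    rw [this]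
    exact Submodule.sum_mem _ fun l _ => Submodule.subset_span ⟨(a l, l), rfl⟩
  · rw [Submodule.span_le]
    rintro _ ⟨t, rfl⟩
    exact monomial_mem_diffOps t.1 t.2

theorem mul_comp_mem (b : Smooth) {A : Smooth →ₗ[ℝ] Smooth} (hA : A ∈ diffOps) :
    LinearMap.mulLeft ℝ b ∘ₗ A ∈ diffOps := by
  rw [diffOps_eq_span] at hA
  induction hA using Submodule.span_induction with
  | mem A h =>
    obtain ⟨t, rfl⟩ := h
    convert monomial_mem_diffOps (b * t.1) t.2 using 1
    ext1 φ
    simp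
  | zero => simp
  | add A B _ _ hA hB => rw [LinearMap.comp_add]; exact add_mem hA hB
  | smul c A _ hA => rw [LinearMap.comp_smul]; exact diffOps.smul_mem c hA

theorem D_comp_mem {A : Smooth →ₗ[ℝ] Smooth} (hA : A ∈ diffOps) : D ∘ₗ A ∈ diffOps := by
  rw [diffOps_eq_span] at hA
  induction hA using Submodule.span_induction with
  | mem A h =>
    obtain ⟨t, rfl⟩ := h
    convert add_mem (monomial_mem_diffOps (D t.1) t.2) (monomial_mem_diffOps t.1 (t.2 + 1)) using 1
    ext1 φ
    simp [D_mul, pow_succ']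
  | zero => simp
  | add A B _ _ hA hB => rw [LinearMap.comp_add]; exact add_mem hA hB
  | smul c A _ hA => rw [LinearMap.comp_smul]; exact diffOps.smul_mem c hA

theorem comp_mem {A B : Smooth →ₗ[ℝ] Smooth} (hA : A ∈ diffOps) (hB : B ∈ diffOps) :
    A ∘ₗ B ∈ diffOps := by
  rw [diffOps_eq_span] at hA
  induction hA using Submodule.span_induction with
  | mem A h =>
    obtain ⟨⟨b, l⟩, rfl⟩ := h
    rw [LinearMap.comp_assoc]
    apply mul_comp_mem
    induction l with
    | zero => exact hB
    | succ l ih =>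
      rw [pow_succ', Module.End.mul_eq_comp, LinearMap.comp_assoc]
      exact D_comp_mem ih
  | zero => simp
  | add A A' _ _ hA hA' => rw [LinearMap.add_comp]; exact add_mem hA hA'
  | smul c A _ hA => rw [LinearMap.smul_comp]; exact diffOps.smul_mem c hA

/-- The Lie derivative on densities of weight `lam`, as a linear map on coefficients. -/
def lieDerHom (lam : ℝ) (X : VectP) : Smooth →ₗ[ℝ] Smooth where
  toFun := lieDer lam X
  map_add' := lieDer_add lam X
  map_smul' c φ := lieDer_smul lam c X φ

theorem lieDerHom_mem (lam : ℝ) (X : VectP) : lieDerHom lam X ∈ diffOps := by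
  convert add_mem (monomial_mem_diffOps (coef X) 1)
    (diffOps.smul_mem lam (monomial_mem_diffOps (D (coef X)) 0)) using 1
  ext1 φ
  simp [lieDerHom, lieDer]

/-- An operator on coefficients, regarded as an operator `F_lam → F_mu`. -/
def toDens (lam mu : ℝ) :
    (Smooth →ₗ[ℝ] Smooth) ≃ₗ[ℝ] (Density lam →ₗ[ℝ] Density mu) :=
  (Density.of lam).arrowCongr (Density.of mu)

theorem lie_toDens (lam mu : ℝ) (X : VectP) (A : Smooth →ₗ[ℝ] Smooth) :
    ⁅X, toDens lam mu A⁆ =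
      toDens lam mu (lieDerHom mu X ∘ₗ A - A ∘ₗ lieDerHom lam X) := rfl

/-- The linear differential operators `F_lam → F_mu`, as a Lie submodule of all linear maps
`F_lam → F_mu` with the action `L_X(A) = L_X^mu ∘ A - A ∘ L_X^lam`. -/
def diffOpSubmodule (lam mu : ℝ) : LieSubmodule ℝ VectP (Density lam →ₗ[ℝ] Density mu) where
  __ := diffOps.map (toDens lam mu).toLinearMap
  lie_mem := by
    rintro X _ ⟨A, hA, rfl⟩
    exact ⟨lieDerHom mu X ∘ₗ A - A ∘ₗ lieDerHom lam X,
      sub_mem (comp_mem (lieDerHom_mem mu X) hA) (comp_mem hA (lieDerHom_mem lam X)),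
      (lie_toDens lam mu X A).symm⟩

/-- The `Vect_P(ℝ)`-module `D_{lam,mu}` of linear differential operators `F_lam → F_mu`. -/
def DiffOp (lam mu : ℝ) : Type := diffOpSubmodule lam mu

instance (lam mu : ℝ) : AddCommGroup (DiffOp lam mu) :=
  inferInstanceAs (AddCommGroup (diffOpSubmodule lam mu))

instance (lam mu : ℝ) : Module ℝ (DiffOp lam mu) :=
  inferInstanceAs (Module ℝ (diffOpSubmodule lam mu))

instance (lam mu : ℝ) : LieRingModule VectP (DiffOp lam mu) :=
  inferInstanceAs (LieRingModule VectP (diffOpSubmodule lam mu))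

instance (lam mu : ℝ) : LieModule ℝ VectP (DiffOp lam mu) :=
  inferInstanceAs (LieModule ℝ VectP (diffOpSubmodule lam mu))

/-- The operator `φ ↦ A φ` on coefficients given by `A ∈ D_{lam,mu}`. -/
def DiffOp.eval {lam mu : ℝ} : DiffOp lam mu →ₗ[ℝ] (Smooth →ₗ[ℝ] Smooth) where
  toFun A := (toDens lam mu).symm A.1
  map_add' _ _ := rfl
  map_smul' _ _ := rfl

theorem DiffOp.eval_apply {lam mu : ℝ} (A : DiffOp lam mu) (φ : Smooth) :
    DiffOp.eval A φ = (Density.of mu).symm (A.1 (Density.of lam φ)) := rfl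

theorem DiffOp.eval_lie {lam mu : ℝ} (X : VectP) (A : DiffOp lam mu) (φ : Smooth) :
    DiffOp.eval ⁅X, A⁆ φ =
      lieDer mu X (DiffOp.eval A φ) - DiffOp.eval A (lieDer lam X φ) := rfl

/-- The operator `b ∂^l ∈ D_{lam,mu}`, as a linear function of `b`. -/
def mulOp {lam mu : ℝ} (l : ℕ) : Smooth →ₗ[ℝ] DiffOp lam mu where
  toFun b := ⟨toDens lam mu (LinearMap.mulLeft ℝ b ∘ₗ D ^ l),
    ⟨_, monomial_mem_diffOps b l, rfl⟩⟩
  map_add' b c := by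
    apply Subtype.ext
    change toDens lam mu _ = toDens lam mu _ + toDens lam mu _
    rw [← map_add]
    congr 1
    ext1 φ
    exact add_mul b c _
  map_smul' c b := by
    apply Subtype.ext
    change toDens lam mu _ = c • toDens lam mu _
    rw [← map_smul]
    congr 1
    ext1 φ
    exact smul_mul_assoc c b _

/-- The derivative `f^(i)` of the coefficient `f` of `X = f d/dx`. -/
def dcoef (i : ℕ) : VectP →ₗ[ℝ] Smooth := (D ^ i) ∘ₗ coef

/-- The 1-cochains: linear maps `Vect_P(ℝ) → D_{lam,mu}`. -/
abbrev Cochain1 (lam mu : ℝ) : Type := oneCochain ℝ VectP (DiffOp lam mu)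

/-- The 2-cochains: alternating bilinear maps `Vect_P(ℝ) × Vect_P(ℝ) → D_{lam,mu}`. -/
def Cochain2 (lam mu : ℝ) : Type := twoCochain ℝ VectP (DiffOp lam mu)

instance (lam mu : ℝ) : AddCommGroup (Cochain2 lam mu) :=
  inferInstanceAs (AddCommGroup (twoCochain ℝ VectP (DiffOp lam mu)))

instance (lam mu : ℝ) : Module ℝ (Cochain2 lam mu) :=
  inferInstanceAs (Module ℝ (twoCochain ℝ VectP (DiffOp lam mu)))

/-- The value `c(X, Y)` of a 2-cochain. -/
def Cochain2.val {lam mu : ℝ} : Cochain2 lam mu →ₗ[ℝ] (VectP →ₗ[ℝ] VectP →ₗ[ℝ] DiffOp lam mu) :=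
  (twoCochain ℝ VectP (DiffOp lam mu)).subtype

/-- The Chevalley-Eilenberg differential on 1-cochains. -/
def d1 (lam mu : ℝ) : Cochain1 lam mu →ₗ[ℝ] Cochain2 lam mu := d₁₂ ℝ VectP (DiffOp lam mu)

/-- The Chevalley-Eilenberg differential on 2-cochains. -/
def d2 (lam mu : ℝ) :
    Cochain2 lam mu →ₗ[ℝ] (VectP →ₗ[ℝ] VectP →ₗ[ℝ] VectP →ₗ[ℝ] DiffOp lam mu) :=
  d₂₃ ℝ VectP (DiffOp lam mu)

theorem d1_apply {lam mu : ℝ} (B : Cochain1 lam mu) (X Y : VectP) :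
    (d1 lam mu B).val X Y = ⁅X, B Y⁆ - ⁅Y, B X⁆ - B ⁅X, Y⁆ := rfl

theorem d2_apply {lam mu : ℝ} (c : Cochain2 lam mu) (X Y Z : VectP) :
    d2 lam mu c X Y Z = ⁅X, c.val Y Z⁆ - ⁅Y, c.val X Z⁆ + ⁅Z, c.val X Y⁆
      - c.val ⁅X, Y⁆ Z + c.val ⁅X, Z⁆ Y - c.val ⁅Y, Z⁆ X := rfl

/-- The differential 1-cochains `B(X)(φ) = ∑ b_{i,l} f^(i) φ^(l)` (finite sums, smooth `b_{i,l}`). -/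
def diffOneCochain (lam mu : ℝ) : Submodule ℝ (Cochain1 lam mu) where
  carrier := {B | ∃ b : ℕ × ℕ →₀ Smooth, ∀ X φ,
    DiffOp.eval (B X) φ = b.sum fun t u => u * dcoef t.1 X * (D ^ t.2) φ}
  zero_mem' := ⟨0, fun X φ => by simp⟩
  add_mem' := by
    rintro A B ⟨a, ha⟩ ⟨b, hb⟩
    refine ⟨a + b, fun X φ => ?_⟩
    rw [Finsupp.sum_add_index' (by simp) (by intros; ring), ← ha, ← hb]
    rfl
  smul_mem' := by
    rintro c A ⟨a, ha⟩
    refine ⟨c • a, fun X φ => ?_⟩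
    rw [Finsupp.sum_smul_index' (by simp)]
    simp only [smul_mul_assoc]
    rw [← Finsupp.smul_sum, ← ha]
    rfl

/-- The differential 2-cochains `c(X, Y)(φ) = ∑ a_{i,j,l} f^(i) g^(j) φ^(l)` (finite sums, smooth
`a_{i,j,l}`), where `X = f d/dx`, `Y = g d/dx`. -/
def diffTwoCochain (lam mu : ℝ) : Submodule ℝ (Cochain2 lam mu) where
  carrier := {c | ∃ a : ℕ × ℕ × ℕ →₀ Smooth, ∀ X Y φ,
    DiffOp.eval (c.val X Y) φ = a.sum fun t u => u * dcoef t.1 X * dcoef t.2.1 Y * (D ^ t.2.2) φ}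
  zero_mem' := ⟨0, fun X Y φ => by simp⟩
  add_mem' := by
    rintro A B ⟨a, ha⟩ ⟨b, hb⟩
    refine ⟨a + b, fun X Y φ => ?_⟩
    rw [Finsupp.sum_add_index' (by simp) (by intros; ring), ← ha, ← hb]
    rfl
  smul_mem' := by
    rintro c A ⟨a, ha⟩
    refine ⟨c • a, fun X Y φ => ?_⟩
    rw [Finsupp.sum_smul_index' (by simp)]
    simp only [smul_mul_assoc]
    rw [← Finsupp.smul_sum, ← ha]
    rfl

/-- The differential 2-cocycles of `Vect_P(ℝ)` with values in `D_{lam,mu}`. -/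
def Z2 (lam mu : ℝ) : Submodule ℝ (Cochain2 lam mu) :=
  LinearMap.ker (d2 lam mu) ⊓ diffTwoCochain lam mu

/-- The coboundaries of differential 1-cochains. -/
def B2 (lam mu : ℝ) : Submodule ℝ (Cochain2 lam mu) :=
  (diffOneCochain lam mu).map (d1 lam mu)

/-- The differential cohomology `H²(Vect_P(ℝ); D_{lam,mu})`. -/
abbrev H2 (lam mu : ℝ) : Type := Z2 lam mu ⧸ (B2 lam mu).submoduleOf (Z2 lam mu)

/-- The cohomology class of a differential 2-cocycle. -/
def cls {lam mu : ℝ} : Z2 lam mu →ₗ[ℝ] H2 lam mu :=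
  ((B2 lam mu).submoduleOf (Z2 lam mu)).mkQ

/-- The elements of `S` are differential 2-cocycles and their classes span the cohomology. -/
def Spans {lam mu : ℝ} (S : Set (Cochain2 lam mu)) : Prop :=
  ∃ h : ∀ c ∈ S, c ∈ Z2 lam mu,
    Submodule.span ℝ (Set.range fun c : S => cls ⟨c.1, h c.1 c.2⟩) = ⊤

/-- The determinant `f^(i) g^(j) - g^(i) f^(j)`, where `X = f d/dx`, `Y = g d/dx`. -/
def det (i j : ℕ) : VectP →ₗ[ℝ] VectP →ₗ[ℝ] Smooth :=
  LinearMap.mk₂ ℝ (fun X Y => dcoef i X * dcoef j Y - dcoef i Y * dcoef j X)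
    (fun X X' Y => by simp only [map_add]; ring)
    (fun c X Y => by simp only [map_smul, smul_mul_assoc, mul_smul_comm, smul_sub])
    (fun X Y Y' => by simp only [map_add]; ring)
    (fun c X Y => by simp only [map_smul, smul_mul_assoc, mul_smul_comm, smul_sub])

/-- The 2-cochain `(X, Y) ↦ |f^(i) g^(i); f^(j) g^(j)| ∂^l` with values in `D_{lam,mu}`. -/
def detOp {lam mu : ℝ} (i j l : ℕ) : Cochain2 lam mu :=
  ⟨(det i j).compr₂ (mulOp l), fun X => by
    change mulOp l (dcoef i X * dcoef j X - dcoef i X * dcoef j X) = 0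
    rw [sub_self, map_zero]⟩

theorem eval_detOp {lam mu : ℝ} (i j l : ℕ) (X Y : VectP) (φ : Smooth) :
    DiffOp.eval ((detOp i j l : Cochain2 lam mu).val X Y) φ =
      (dcoef i X * dcoef j Y - dcoef i Y * dcoef j X) * (D ^ l) φ := rfl

/-- `ω(X, Y) ∂^l`, where `ω(X, Y) = f' g'' - g' f''` is the Gelfand-Fuchs cocycle. -/
def omegaOp {lam mu : ℝ} (l : ℕ) : Cochain2 lam mu := detOp 1 2 l

/-- `Ω₁` -/
def Omega1 : Cochain2 0 1 := omegaOp 0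

/-- `Ω₂`, as a function of its constants. -/
def Omega2 (lam c12 c13 : ℝ) : Cochain2 lam (lam + 2) :=
  c12 • omegaOp 1 + c13 • detOp 1 3 0

/-- `Ω₃`, as a function of its constants. -/
def Omega3 (lam c12 c13 : ℝ) : Cochain2 lam (lam + 3) :=
  c12 • omegaOp 2 + c13 • detOp 1 3 1 + (lam / 2 * (c12 - c13)) • detOp 1 4 0

/-- `Ω₄`, as a function of its constants. -/
def Omega4 (lam c12 c13 : ℝ) : Cochain2 lam (lam + 4) :=
  c12 • omegaOp 3 + (1 / 2 * ((1 + 3 * lam) * c12 - (1 + 2 * lam) * c13)) • detOp 1 4 1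
    + c13 • detOp 1 3 2
    + (lam / 10 * ((1 - 3 * lam) * c12 + (1 + 2 * lam) * c13)) • detOp 1 5 0

/-- `Ω₅`, as a function of its constants. -/
def Omega5 (lam α β : ℝ) : Cochain2 lam (lam + 5) :=
  (3 * α * (1 + lam) * (1 + 2 * lam)) • omegaOp 4
    + (2 * α * (1 + 3 * lam + 6 * lam ^ 2)) • detOp 1 3 3
    + (3 * α * (1 + lam) * (1 + 4 * lam)) • detOp 1 4 2
    + (-(1 / 5 * α * lam * (1 + 9 * lam))) • detOp 1 6 0
    + β • detOp 3 4 0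

/-- `Ω₆`, as a function of its constants. -/
def Omega6 (lam α β : ℝ) : Cochain2 lam (lam + 6) :=
  (α * (4 + 3 * lam * (5 + 2 * lam))) • omegaOp 5
    + (5 * α * (2 + lam * (4 + 3 * lam))) • detOp 1 3 4
    + (5 * α * (lam * (3 + 4 * lam) - 2)) • detOp 1 4 3
    + (5 * α * (2 + lam * (4 + 3 * lam))) • detOp 1 5 2
    + β • detOp 3 4 1
    + (α * (4 + 15 * lam + 6 * lam ^ 2)) • detOp 1 6 1
    + (-(lam / 5 * β)) • detOp 3 5 0

/-- The subalgebra `sl(2)` spanned by `d/dx`, `x d/dx`, `x² d/dx`. -/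
def sl2 : Submodule ℝ VectP :=
  Submodule.span ℝ {Polynomial.mkDerivation ℝ 1, Polynomial.mkDerivation ℝ Polynomial.X,
    Polynomial.mkDerivation ℝ (Polynomial.X ^ 2)}

/-- The differential 2-cocycles vanishing on `sl(2)`. -/
def relZ2 (lam mu : ℝ) : Set (Cochain2 lam mu) :=
  {c | c ∈ Z2 lam mu ∧ ∀ X ∈ sl2, ∀ Y, c.val X Y = 0}

/-- The 2-cochain `∑ c_{i,j} |f^(i) g^(i); f^(j) g^(j)| ∂^(k+2-i-j)`, summed over `3 ≤ i < j` with
`i + j ≤ k + 2`. -/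
def homCochain {lam mu : ℝ} (k : ℕ) (c : ℕ → ℕ → ℝ) : Cochain2 lam mu :=
  ∑ t ∈ (Finset.range (k + 3) ×ˢ Finset.range (k + 3)).filter
    (fun t => 3 ≤ t.1 ∧ t.1 < t.2 ∧ t.1 + t.2 ≤ k + 2), c t.1 t.2 • detOp t.1 t.2 (k + 2 - t.1 - t.2)

/-- `Ω` is a differential 2-cocycle with values in `D_{lam,lam+k}`, vanishing on `sl(2)`, of the
form `∑ c_{i,j} |f^(i) g^(i); f^(j) g^(j)| ∂^(k+2-i-j)` with `c_{3,4} = a` and `c_{4,5} = b`. -/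
def IsRelCocycle (k : ℕ) (lam a b : ℝ) (Ω : Cochain2 lam (lam + k)) : Prop :=
  Ω ∈ relZ2 lam (lam + k) ∧ ∃ c : ℕ → ℕ → ℝ, Ω = homCochain k c ∧ c 3 4 = a ∧ c 4 5 = b

/-- `lam` is one of `(1-k)/2`, `(1-k)/2 ± √(12k-23)/2`. -/
def Exceptional (k : ℕ) (lam : ℝ) : Prop :=
  lam = (1 - k) / 2 ∨ lam = (1 - k) / 2 + √(12 * k - 23) / 2 ∨
    lam = (1 - k) / 2 - √(12 * k - 23) / 2

/-- The pairs `(lam, mu)` with one-dimensional cohomology. -/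
def DimOne (lam mu : ℝ) : Prop :=
  (lam = 0 ∧ mu = 1) ∨
  (∃ k : ℕ, 2 ≤ k ∧ k ≤ 4 ∧ mu - lam = k) ∨
  (∃ k : ℕ, 7 ≤ k ∧ k ≤ 11 ∧ mu - lam = k) ∨
  (∃ k : ℕ, 12 ≤ k ∧ k ≤ 14 ∧ mu - lam = k ∧ Exceptional k lam)

/-- The pairs `(lam, mu)` with two-dimensional cohomology. -/
def DimTwo (lam mu : ℝ) : Prop :=
  (lam = 0 ∧ mu = 5) ∨ (lam = -4 ∧ mu = 1) ∨
  (lam = -5 / 2 + √19 / 2 ∧ mu = 7 / 2 + √19 / 2) ∨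
  (lam = -5 / 2 - √19 / 2 ∧ mu = 7 / 2 - √19 / 2)

end VectCoh

end

/-! A differential cochain is determined by its values on Taylor monomials: `cf x i j l c` is the
value at x of c on (t-x)^i d/dt, (t-x)^j d/dt and (t-x)^l, that is, i! j! l! times the coefficient
of f^(i) g^(j) φ^(l) at x. Normalising a cocycle successively along d/dt, t d/dt and t² d/dt turns
the problem into linear algebra. Integrating coefficients makes the cocycle vanish on d/dt, so its
coefficients become constant. Dividing by the eigenvalue mu - lam + 2 - i - j - l of t d/dt removes
everything of non-zero weight. Hence only mu - lam = k with k ≥ 1 an integer matters, and the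
cocycle is an array N i j = `nm i j` with i + j ≤ k + 2. A recursion then removes N 2 j for j ≥ 3,
which leaves `normalZ2`.

A normalised cocycle is determined by N 1 2, N 1 3, N 3 4 and N 4 5 (`eq_zero_of_mem_normalZ2`). Put
y = 2 lam + k - 1, q = `qPoly k y`, r = `rPoly k y`. The normalised coboundaries have (N 1 2, N 1 3)
= s (y, k - 2 + 3 lam) and (N 3 4, N 4 5) = t (q / 6, r / 120), with s and t arbitrary
(`nm_of_mem_B2`, `exists_mem_normalZ2_B2`). Cohomology is therefore measured by two determinants,
`gDet` for the first pair and `defect` for the second, as far as i + j ≤ k + 2 lets these entries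
exist.

The cocycle equations restrict them. Contraction with t d/dt gives a closed 1-cochain, and its
closedness on the pairs (3, 4) and (4, 5) reads q * `gDet` = 0 for k ≥ 5 and r * `gDet` = 0 for k ≥
7. For k = 1 only N 1 2 exists, and it is exact unless lam = 0. For k = 2, 3, 4 only `gDet` counts.
For k = 5, 6 there is no cohomology if q ≠ 0; if q = 0, then `gDet` is unconstrained and N 3 4 is no
longer exact, which gives dimension two. For k ≥ 7, q and r cannot both vanish, so `gDet` = 0 and
only `defect` is left.

For indices at least 3 there is a universal polynomial solution `solN` with N 3 4 and N 4 5 free. It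
satisfies all equations of degree i + j ≤ 13. Degree 14, present for k ≥ 12, requires y (y² - 12 k +
23) * `defect` = 0, whence the exceptional values of lam. Degree 17, present for k ≥ 15, forces
`defect` = 0 even there (`defect_eq_zero`). Spanning statements follow by evaluating these linear
forms on explicit cocycles. -/

noncomputable section
-- Monomial fields, and differential operators evaluated on Taylor monomials
namespace VectCoh

/-- Evaluation of smooth functions at a point. -/
def evalAt (x : ℝ) : Smooth →ₐ[ℝ] ℝ where
  toFun φ := φ.1 x
  map_one' := rfl
  map_mul' _ _ := rfl
  map_zero' := rfl
  map_add' _ _ := rfl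
  commutes' _ := rfl

theorem Smooth.ext_evalAt {φ ψ : Smooth} (h : ∀ x, evalAt x φ = evalAt x ψ) : φ = ψ :=
  Subtype.ext (funext h)

/-- The monomial `(t - x)^l` as a smooth function. -/
def mono (x : ℝ) (l : ℕ) : Smooth := ofPoly ((Polynomial.X - Polynomial.C x) ^ l)

/-- The vector field `(t - x)^i d/dt`. -/
def field (x : ℝ) (i : ℕ) : VectP :=
  Polynomial.mkDerivation ℝ ((Polynomial.X - Polynomial.C x) ^ i)

theorem coef_field (x : ℝ) (i : ℕ) : coef (field x i) = mono x i := by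
  change ofPoly (Polynomial.mkDerivation ℝ _ Polynomial.X) = _
  rw [Polynomial.mkDerivation_X]; rfl

theorem mono_mul (x : ℝ) (i j : ℕ) : mono x i * mono x j = mono x (i + j) := by
  rw [mono, mono, ← ofPoly_mul, ← pow_add]; rfl

theorem ofPoly_one : ofPoly 1 = 1 := by
  apply Subtype.ext
  funext x
  exact Polynomial.eval_one

theorem mono_zero (x : ℝ) : mono x 0 = 1 := by
  rw [mono, pow_zero, ofPoly_one]

theorem evalAt_mono (x : ℝ) (l : ℕ) : evalAt x (mono x l) = if l = 0 then 1 else 0 := by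
  change Polynomial.eval x ((Polynomial.X - Polynomial.C x) ^ l) = _
  simp [zero_pow_eq]

theorem D_mono (x : ℝ) (l : ℕ) : D (mono x l) = (l : ℝ) • mono x (l - 1) := by
  rw [mono, D_ofPoly, mono, ← map_smul]
  congr 1
  rw [Polynomial.derivative_X_sub_C_pow, Polynomial.smul_eq_C_mul]

theorem D_pow_mono (x : ℝ) (n l : ℕ) :
    (D ^ n) (mono x l) = (l.descFactorial n : ℝ) • mono x (l - n) := by
  induction n with
  | zero => simp
  | succ n ih =>
    rw [pow_succ', Module.End.mul_apply, ih, map_smul, D_mono, smul_smul, Nat.descFactorial_succ,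
      Nat.sub_sub, Nat.cast_mul, mul_comm]

theorem evalAt_D_pow_mono (x : ℝ) (n l : ℕ) :
    evalAt x ((D ^ n) (mono x l)) = if n = l then (l.factorial : ℝ) else 0 := by
  rw [D_pow_mono, map_smul, evalAt_mono]
  rcases lt_trichotomy n l with h | rfl | h
  · simp [h.ne, Nat.sub_eq_zero_iff_le, h]
  · simp [Nat.descFactorial_self]
  · simp [h.ne', Nat.descFactorial_of_lt h]

theorem evalAt_dcoef_field (x : ℝ) (n i : ℕ) :
    evalAt x (dcoef n (field x i)) = if n = i then (i.factorial : ℝ) else 0 := by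
  rw [dcoef, LinearMap.comp_apply, coef_field, evalAt_D_pow_mono]

theorem coef_injective : Function.Injective coef := by
  intro X Y h
  refine Polynomial.derivation_ext ?_
  have h' : ofPoly (X Polynomial.X) = ofPoly (Y Polynomial.X) := h
  refine Polynomial.funext fun x => ?_
  exact congrFun (congrArg Subtype.val h') x

theorem lie_field (x : ℝ) (i j : ℕ) :
    ⁅field x i, field x j⁆ = ((j : ℝ) - i) • field x (i + j - 1) := by
  apply coef_injective
  rw [coef_lie, map_smul, coef_field, coef_field, coef_field, D_mono, D_mono, mul_smul_comm,
    smul_mul_assoc, mono_mul, mono_mul, sub_smul]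
  congr 1
  · rcases j with _ | j
    · simp
    · simp
  · rcases i with _ | i
    · simp
    · simp [add_right_comm]

theorem lieDer_mono (lam x : ℝ) (i l : ℕ) :
    lieDer lam (field x i) (mono x l) = ((l : ℝ) + i * lam) • mono x (i + l - 1) := by
  rw [lieDer, coef_field, D_mono, D_mono, mul_smul_comm, smul_mul_assoc, mono_mul, mono_mul,
    smul_smul, add_smul, mul_comm lam]
  congr 1
  · rcases l with _ | l
    · simp
    · simp
  · rcases i with _ | i
    · simp
    · simp [add_right_comm]

theorem evalAt_lieDer (lam x : ℝ) (i : ℕ) (φ : Smooth) :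
    evalAt x (lieDer lam (field x i) φ) =
      if i = 0 then evalAt x (D φ) else if i = 1 then lam * evalAt x φ else 0 := by
  rw [lieDer, coef_field, D_mono, map_add, map_mul, map_smul, map_mul, map_smul, evalAt_mono,
    evalAt_mono]
  rcases i with _ | _ | i <;> simp

theorem field_span (x : ℝ) (X : VectP) : X ∈ Submodule.span ℝ (Set.range (field x)) := by
  have h (p : Polynomial ℝ) :
      Polynomial.mkDerivation ℝ p ∈ Submodule.span ℝ (Set.range (field x)) := by
    rw [← Polynomial.sum_taylor_eq p x, Polynomial.sum, map_sum]
    refine Submodule.sum_mem _ fun i _ => ?_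
    rw [← Polynomial.smul_eq_C_mul, map_smul]
    exact Submodule.smul_mem _ _ (Submodule.subset_span ⟨i, rfl⟩)
  convert h (X Polynomial.X)
  exact Polynomial.derivation_ext (by simp)

theorem hom_ext_field {V : Type*} [AddCommGroup V] [Module ℝ V] {f g : VectP →ₗ[ℝ] V} (x : ℝ)
    (h : ∀ i, f (field x i) = g (field x i)) : f = g := by
  ext1 X
  induction field_span x X using Submodule.span_induction with
  | mem Y hY => obtain ⟨i, rfl⟩ := hY; exact h i
  | zero => simp
  | add Y Z _ _ hY hZ => rw [map_add, map_add, hY, hZ]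
  | smul c Y _ hY => rw [map_smul, map_smul, hY]

/-- The value at `x` of `A (t - x)^l`. -/
def coeffAt {lam mu : ℝ} (x : ℝ) (l : ℕ) : DiffOp lam mu →ₗ[ℝ] ℝ where
  toFun A := evalAt x (DiffOp.eval A (mono x l))
  map_add' A B := by simp
  map_smul' c A := by simp

theorem DiffOp.eval_injective {lam mu : ℝ} :
    Function.Injective (DiffOp.eval : DiffOp lam mu → Smooth →ₗ[ℝ] Smooth) := fun _ _ h =>
  Subtype.ext ((toDens lam mu).symm.injective h)

theorem eval_mulOp {lam mu : ℝ} (l : ℕ) (b φ : Smooth) :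
    DiffOp.eval (mulOp l b : DiffOp lam mu) φ = b * (D ^ l) φ := rfl

theorem coeffAt_mulOp {lam mu : ℝ} (x : ℝ) (l n : ℕ) (b : Smooth) :
    coeffAt x l (mulOp n b : DiffOp lam mu) = if n = l then evalAt x b * l.factorial else 0 := by
  change evalAt x (b * (D ^ n) (mono x l)) = _
  rw [map_mul, evalAt_D_pow_mono, mul_ite, mul_zero]

theorem DiffOp.exists_sum {lam mu : ℝ} (A : DiffOp lam mu) :
    ∃ a : ℕ →₀ Smooth, A = ∑ l ∈ a.support, mulOp l (a l) := by
  obtain ⟨B, ⟨a, ha⟩, hB⟩ := A.2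
  refine ⟨a, DiffOp.eval_injective ?_⟩
  have hA : DiffOp.eval A = B := by
    change (toDens lam mu).symm A.1 = B
    rw [← hB]
    exact (toDens lam mu).symm_apply_apply B
  ext1 φ
  rw [hA, ha, map_sum, LinearMap.sum_apply]
  rfl

/-- On a sum of operators a_l ∂^l the functional `coeffAt x l` returns l! a_l(x), so every
coefficient of the difference vanishes at every point. -/
theorem DiffOp.ext_coeffAt {lam mu : ℝ} {A B : DiffOp lam mu}
    (h : ∀ x l, coeffAt x l A = coeffAt x l B) : A = B := by
  rw [← sub_eq_zero]
  obtain ⟨a, ha⟩ := DiffOp.exists_sum (A - B)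
  rw [ha]
  refine Finset.sum_eq_zero fun l hl => ?_
  have : a l = 0 := by
    refine Smooth.ext_evalAt fun x => ?_
    have h1 : coeffAt x l (A - B) = 0 := by rw [map_sub, h, sub_self]
    rw [ha, map_sum] at h1
    simp only [coeffAt_mulOp, Finset.sum_ite_eq', hl, if_true] at h1
    have h2 : (l.factorial : ℝ) ≠ 0 := by positivity
    simpa [h2] using h1
  rw [this, map_zero]

theorem coeffAt_lie {lam mu : ℝ} (x : ℝ) (i l : ℕ) (A : DiffOp lam mu) :
    coeffAt x l ⁅field x i, A⁆ =
      (if i = 0 then evalAt x (D (DiffOp.eval A (mono x l)))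
        else if i = 1 then mu * coeffAt x l A else 0) -
        ((l : ℝ) + i * lam) * coeffAt x (i + l - 1) A := by
  change evalAt x (DiffOp.eval ⁅field x i, A⁆ (mono x l)) = _
  rw [DiffOp.eval_lie, map_sub, evalAt_lieDer, lieDer_mono, map_smul, map_smul]
  rfl

theorem coeffAt_lie_one {lam mu : ℝ} (x : ℝ) (l : ℕ) (A : DiffOp lam mu) :
    coeffAt x l ⁅field x 1, A⁆ = (mu - l - lam) * coeffAt x l A := by
  rw [coeffAt_lie]
  simp
  ring

/-- For i ≥ 2 both the coefficient of the field and its derivative vanish at x, so the outer Lie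
derivative drops out and only the inner one remains. -/
theorem coeffAt_lie_of_two_le {lam mu : ℝ} (x : ℝ) {i : ℕ} (hi : 2 ≤ i) (l : ℕ)
    (A : DiffOp lam mu) :
    coeffAt x l ⁅field x i, A⁆ = -((l : ℝ) + i * lam) * coeffAt x (i + l - 1) A := by
  rw [coeffAt_lie, if_neg (by omega), if_neg (by omega)]
  ring

theorem field_zero (x : ℝ) : field x 0 = field 0 0 := by simp [field]

theorem lieDer_field_zero (lam x : ℝ) (φ : Smooth) : lieDer lam (field x 0) φ = D φ := by
  rw [lieDer, coef_field, D_mono, mono_zero]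
  simp

theorem D_D_pow (n : ℕ) (φ : Smooth) : D ((D ^ n) φ) = (D ^ (n + 1)) φ := by
  rw [pow_succ', Module.End.mul_apply]

theorem D_pow_D (n : ℕ) (φ : Smooth) : (D ^ n) (D φ) = (D ^ (n + 1)) φ := by
  rw [pow_succ, Module.End.mul_apply]

theorem lie_field_zero_mulOp {lam mu : ℝ} (x : ℝ) (l : ℕ) (b : Smooth) :
    ⁅field x 0, (mulOp l b : DiffOp lam mu)⁆ = mulOp l (D b) := by
  apply DiffOp.eval_injective
  ext1 φ
  rw [DiffOp.eval_lie, lieDer_field_zero, lieDer_field_zero, eval_mulOp, eval_mulOp, eval_mulOp,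
    D_mul, D_D_pow, D_pow_D]
  ring

theorem dcoef_zero (X : VectP) : dcoef 0 X = coef X := by simp [dcoef]

theorem D_dcoef (i : ℕ) (X : VectP) : D (dcoef i X) = dcoef (i + 1) X := by
  simp only [dcoef, LinearMap.comp_apply, D_D_pow]

theorem dcoef_field_zero (x : ℝ) (i : ℕ) : dcoef i (field x 0) = if i = 0 then 1 else 0 := by
  rw [dcoef, LinearMap.comp_apply, coef_field, D_pow_mono]
  rcases i with _ | i
  · simp [mono_zero]
  · simp

theorem dcoef_lie_field_zero (x : ℝ) (i : ℕ) (X : VectP) :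
    dcoef i ⁅field x 0, X⁆ = dcoef (i + 1) X := by
  simp only [dcoef, LinearMap.comp_apply]
  rw [coef_lie, coef_field, D_mono, mono_zero]
  simp [D_pow_D]

theorem exists_antideriv (φ : Smooth) : ∃ ψ : Smooth, D ψ = φ := by
  have hc : Continuous φ.1 := (show ContDiff ℝ ∞ φ.1 from φ.2).continuous
  have hd (x : ℝ) : HasDerivAt (fun u => ∫ t in (0 : ℝ)..u, φ.1 t) (φ.1 x) x :=
    intervalIntegral.integral_hasDerivAt_right (hc.intervalIntegrable _ _)
      hc.stronglyMeasurable.stronglyMeasurableAtFilter hc.continuousAt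
  have hderiv : deriv (fun u => ∫ t in (0 : ℝ)..u, φ.1 t) = φ.1 := funext fun x => (hd x).deriv
  refine ⟨⟨fun u => ∫ t in (0 : ℝ)..u, φ.1 t, ?_⟩, ?_⟩
  · change ContDiff ℝ ∞ _
    rw [contDiff_infty_iff_deriv, hderiv]
    exact ⟨fun x => (hd x).differentiableAt, φ.2⟩
  · exact Subtype.ext hderiv

theorem evalAt_eq_of_D_eq_zero {φ : Smooth} (h : D φ = 0) (x y : ℝ) :
    evalAt x φ = evalAt y φ :=
  is_const_of_deriv_eq_zero (contDiff_infty_iff_deriv.1 φ.2).1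
    (fun t => congrFun (congrArg Subtype.val h) t) x y

end VectCoh
end

/-! ### 2-cochains in Taylor coordinates; coboundaries of differential cochains are differential -/

noncomputable section
namespace VectCoh

variable {lam mu : ℝ}

theorem Cochain2.val_self (c : Cochain2 lam mu) (X : VectP) : c.val X X = 0 := c.2 X

theorem Cochain2.val_swap (c : Cochain2 lam mu) (X Y : VectP) : c.val Y X = -c.val X Y := by
  have h := c.val_self (X + Y)
  simp only [map_add, LinearMap.add_apply, c.val_self, zero_add, add_zero] at h
  exact eq_neg_of_add_eq_zero_left h

theorem Cochain2.val_injective :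
    Function.Injective (Cochain2.val : Cochain2 lam mu → VectP →ₗ[ℝ] VectP →ₗ[ℝ] DiffOp lam mu) :=
  Subtype.val_injective

/-- The value at `x` of `c(X, Y) φ` for `X = (t - x)^i d/dt`, `Y = (t - x)^j d/dt` and
`φ = (t - x)^l`. -/
def cf (x : ℝ) (i j l : ℕ) : Cochain2 lam mu →ₗ[ℝ] ℝ where
  toFun c := coeffAt x l (c.val (field x i) (field x j))
  map_add' c c' := by simp
  map_smul' r c := by simp

theorem cf_apply (x : ℝ) (i j l : ℕ) (c : Cochain2 lam mu) :
    cf x i j l c = coeffAt x l (c.val (field x i) (field x j)) := rfl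

theorem cf_swap (x : ℝ) (i j l : ℕ) (c : Cochain2 lam mu) : cf x j i l c = -cf x i j l c := by
  rw [cf_apply, Cochain2.val_swap, map_neg, cf_apply]

theorem cf_self (x : ℝ) (i l : ℕ) (c : Cochain2 lam mu) : cf x i i l c = 0 := by
  rw [cf_apply, Cochain2.val_self, map_zero]

theorem Cochain2.ext_cf {c c' : Cochain2 lam mu} (h : ∀ x i j l, cf x i j l c = cf x i j l c') :
    c = c' := by
  have h1 (x : ℝ) (l : ℕ) : c.val.compr₂ (coeffAt x l) = c'.val.compr₂ (coeffAt x l) :=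
    hom_ext_field x fun i => hom_ext_field x fun j => h x i j l
  refine Cochain2.val_injective (LinearMap.ext₂ fun X Y => DiffOp.ext_coeffAt fun x l => ?_)
  exact LinearMap.congr_fun₂ (h1 x l) X Y

theorem coeffAt_val_lie_field (x : ℝ) (i j m l : ℕ) (c : Cochain2 lam mu) :
    coeffAt x l (c.val ⁅field x i, field x j⁆ (field x m)) =
      ((j : ℝ) - i) * cf x (i + j - 1) m l c := by
  rw [lie_field, map_smul, LinearMap.smul_apply, map_smul]
  rfl

theorem coeffAt_d2 (x : ℝ) (l : ℕ) {i j m : ℕ} (hi : 2 ≤ i) (hj : 2 ≤ j) (hm : 2 ≤ m)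
    (c : Cochain2 lam mu) :
    coeffAt x l (d2 lam mu c (field x i) (field x j) (field x m)) =
      -((l : ℝ) + i * lam) * cf x j m (i + l - 1) c + ((l : ℝ) + j * lam) * cf x i m (j + l - 1) c
        - ((l : ℝ) + m * lam) * cf x i j (m + l - 1) c - ((j : ℝ) - i) * cf x (i + j - 1) m l c
        + ((m : ℝ) - i) * cf x (i + m - 1) j l c - ((m : ℝ) - j) * cf x (j + m - 1) i l c := by
  rw [d2_apply]
  simp only [map_sub, map_add, coeffAt_val_lie_field, coeffAt_lie_of_two_le x hi,
    coeffAt_lie_of_two_le x hj, coeffAt_lie_of_two_le x hm, ← cf_apply]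
  ring

/-- The field (t-x) d/dt acts diagonally on monomials, so the terms in `cf x j m l c` collect into a
single eigenvalue. Components with a non-zero eigenvalue can then be divided out. -/
theorem coeffAt_d2_one (x : ℝ) (l : ℕ) {j m : ℕ} (hj : 2 ≤ j) (hm : 2 ≤ m)
    (c : Cochain2 lam mu) :
    coeffAt x l (d2 lam mu c (field x 1) (field x j) (field x m)) =
      (mu - lam + 2 - j - m - l) * cf x j m l c + ((l : ℝ) + j * lam) * cf x 1 m (j + l - 1) c
        - ((l : ℝ) + m * lam) * cf x 1 j (m + l - 1) c
        + ((m : ℝ) - j) * cf x 1 (j + m - 1) l c := by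
  rw [d2_apply]
  simp only [map_sub, map_add, coeffAt_val_lie_field, coeffAt_lie_one,
    coeffAt_lie_of_two_le x hj, coeffAt_lie_of_two_le x hm, ← cf_apply]
  rw [cf_swap x 1 (j + m - 1), show 1 + j - 1 = j by omega, show 1 + m - 1 = m by omega,
    cf_swap x j m]
  push_cast
  ring

/-- The value at `x` of `B(X) φ` for `X = (t - x)^j d/dt` and `φ = (t - x)^l`. -/
def cf1 (x : ℝ) (j l : ℕ) : Cochain1 lam mu →ₗ[ℝ] ℝ where
  toFun B := coeffAt x l (B (field x j))
  map_add' c c' := by simp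
  map_smul' r c := by simp

theorem cf1_apply (x : ℝ) (j l : ℕ) (B : Cochain1 lam mu) :
    cf1 x j l B = coeffAt x l (B (field x j)) := rfl

theorem cf_d1 (x : ℝ) (l : ℕ) {i j : ℕ} (hi : 2 ≤ i) (hj : 2 ≤ j) (B : Cochain1 lam mu) :
    cf x i j l (d1 lam mu B) = -((l : ℝ) + i * lam) * cf1 x j (i + l - 1) B
      + ((l : ℝ) + j * lam) * cf1 x i (j + l - 1) B - ((j : ℝ) - i) * cf1 x (i + j - 1) l B := by
  rw [cf_apply, d1_apply]
  simp only [map_sub, lie_field, map_smul, coeffAt_lie_of_two_le x hi,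
    coeffAt_lie_of_two_le x hj, ← cf1_apply, smul_eq_mul]
  ring

theorem cf_d1_one (x : ℝ) (l : ℕ) {j : ℕ} (hj : 2 ≤ j) (B : Cochain1 lam mu) :
    cf x 1 j l (d1 lam mu B) = (mu - lam + 1 - j - l) * cf1 x j l B
      + ((l : ℝ) + j * lam) * cf1 x 1 (j + l - 1) B := by
  rw [cf_apply, d1_apply]
  simp only [map_sub, lie_field, map_smul, coeffAt_lie_one,
    coeffAt_lie_of_two_le x hj, ← cf1_apply, smul_eq_mul]
  rw [show 1 + j - 1 = j by omega]
  push_cast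
  ring

/-- The 1-cochain `X ↦ u f^(j) ∂^l`. -/
def mon1 (u : Smooth) (j l : ℕ) : Cochain1 lam mu :=
  mulOp l ∘ₗ LinearMap.mulLeft ℝ u ∘ₗ dcoef j

theorem mon1_apply (u : Smooth) (j l : ℕ) (X : VectP) :
    (mon1 u j l : Cochain1 lam mu) X = mulOp l (u * dcoef j X) := rfl

theorem mon1_mem (u : Smooth) (j l : ℕ) : (mon1 u j l : Cochain1 lam mu) ∈ diffOneCochain lam mu :=
  ⟨Finsupp.single (j, l) u, fun X φ => by
    rw [Finsupp.sum_single_index (by simp)]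
    rfl⟩

theorem cf1_mon1 (x : ℝ) (j l j' l' : ℕ) (u : Smooth) :
    cf1 x j' l' (mon1 u j l : Cochain1 lam mu) =
      if j = j' ∧ l = l' then evalAt x u * j'.factorial * l'.factorial else 0 := by
  rw [cf1_apply, mon1_apply, coeffAt_mulOp, map_mul, evalAt_dcoef_field]
  split_ifs <;> simp_all

theorem exists_eq_sum_mon1 {B : Cochain1 lam mu} (hB : B ∈ diffOneCochain lam mu) :
    ∃ b : ℕ × ℕ →₀ Smooth, B = ∑ t ∈ b.support, mon1 (b t) t.1 t.2 := by
  obtain ⟨b, hb⟩ := hB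
  refine ⟨b, ?_⟩
  ext1 X
  apply DiffOp.eval_injective
  ext1 φ
  rw [hb, LinearMap.sum_apply, map_sum, LinearMap.sum_apply]
  rfl

theorem exists_eq_sum_mulOp {c : Cochain2 lam mu} (hc : c ∈ diffTwoCochain lam mu) :
    ∃ a : ℕ × ℕ × ℕ →₀ Smooth, ∀ X Y,
      c.val X Y = ∑ t ∈ a.support, mulOp t.2.2 (a t * dcoef t.1 X * dcoef t.2.1 Y) := by
  obtain ⟨a, ha⟩ := hc
  refine ⟨a, fun X Y => ?_⟩
  apply DiffOp.eval_injective
  ext1 φ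
  rw [ha, map_sum, LinearMap.sum_apply]
  rfl

theorem cf_of_eq_sum_mulOp {c : Cochain2 lam mu} {a : ℕ × ℕ × ℕ →₀ Smooth}
    (ha : ∀ X Y, c.val X Y = ∑ t ∈ a.support, mulOp t.2.2 (a t * dcoef t.1 X * dcoef t.2.1 Y))
    (x : ℝ) (i j l : ℕ) :
    cf x i j l c = evalAt x (a (i, j, l)) * (i.factorial * j.factorial * l.factorial) := by
  rw [cf_apply, ha, map_sum]
  simp only [coeffAt_mulOp, map_mul, evalAt_dcoef_field]
  rw [Finset.sum_eq_single (i, j, l)]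
  · simp [mul_assoc]
  · rintro ⟨i', j', l'⟩ _ h
    by_cases h1 : i' = i <;> by_cases h2 : j' = j <;> by_cases h3 : l' = l <;> simp_all
  · intro h
    rw [Finsupp.notMem_support_iff] at h
    simp [h]

/-- The maps `(X, Y, φ) ↦ ∑ a_{i,j,l} f^(i) g^(j) φ^(l)`. -/
def biDiff : Submodule ℝ (VectP → VectP → Smooth → Smooth) where
  carrier := {F | ∃ a : ℕ × ℕ × ℕ →₀ Smooth, ∀ X Y φ,
    F X Y φ = a.sum fun t u => u * dcoef t.1 X * dcoef t.2.1 Y * (D ^ t.2.2) φ}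
  zero_mem' := ⟨0, fun X Y φ => by simp⟩
  add_mem' := by
    rintro A B ⟨a, ha⟩ ⟨b, hb⟩
    refine ⟨a + b, fun X Y φ => ?_⟩
    rw [Finsupp.sum_add_index' (by simp) (by intros; ring), ← ha, ← hb]
    rfl
  smul_mem' := by
    rintro c A ⟨a, ha⟩
    refine ⟨c • a, fun X Y φ => ?_⟩
    rw [Finsupp.sum_smul_index' (by simp)]
    simp only [smul_mul_assoc]
    rw [← Finsupp.smul_sum, ← ha]
    rfl

theorem monomial_mem_biDiff (u : Smooth) (i j l : ℕ) :
    (fun X Y φ => u * dcoef i X * dcoef j Y * (D ^ l) φ) ∈ biDiff :=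
  ⟨Finsupp.single (i, j, l) u, fun X Y φ => by rw [Finsupp.sum_single_index (by simp)]⟩

theorem swap_mem_biDiff {F : VectP → VectP → Smooth → Smooth} (hF : F ∈ biDiff) :
    (fun X Y φ => F Y X φ) ∈ biDiff := by
  obtain ⟨a, ha⟩ := hF
  have h : (fun X Y φ => F Y X φ) = ∑ t ∈ a.support,
      fun X Y φ => a t * dcoef t.2.1 X * dcoef t.1 Y * (D ^ t.2.2) φ := by
    funext X Y φ
    simp only [ha, Finset.sum_apply, Finsupp.sum]
    exact Finset.sum_congr rfl fun t _ => by ring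
  rw [h]
  exact Submodule.sum_mem _ fun t _ => monomial_mem_biDiff _ _ _ _

theorem D_pow_mul_mem_biDiff (u : Smooth) (j l i n : ℕ) :
    (fun X Y φ => u * dcoef j Y * (D ^ l) (dcoef i X * (D ^ n) φ)) ∈ biDiff := by
  induction l generalizing i n with
  | zero =>
    convert monomial_mem_biDiff u i j n using 1
    funext X Y φ
    simp only [pow_zero, Module.End.one_apply]
    ring
  | succ l ih =>
    convert add_mem (ih (i + 1) n) (ih i (n + 1)) using 1
    funext X Y φ
    simp only [← D_pow_D, D_mul, D_dcoef, D_D_pow, Pi.add_apply, map_add]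
    ring

theorem D_pow_mul_mem_biDiff' (u : Smooth) (j l p q : ℕ) :
    (fun X Y φ => u * (D ^ j) (dcoef p X * dcoef q Y) * (D ^ l) φ) ∈ biDiff := by
  induction j generalizing p q with
  | zero =>
    convert monomial_mem_biDiff u p q l using 1
    funext X Y φ
    simp only [pow_zero, Module.End.one_apply]
    ring
  | succ j ih =>
    convert add_mem (ih (p + 1) q) (ih p (q + 1)) using 1
    funext X Y φ
    simp only [← D_pow_D j, D_mul, D_dcoef, Pi.add_apply, map_add]
    ring

/-- Each of the three terms of the differential of u f^(j) ∂^l expands by the Leibniz rule into an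
element of `biDiff`. This is what places coboundaries inside `Z2`. -/
theorem d1_mem_diffTwoCochain {B : Cochain1 lam mu} (hB : B ∈ diffOneCochain lam mu) :
    d1 lam mu B ∈ diffTwoCochain lam mu := by
  obtain ⟨b, rfl⟩ := exists_eq_sum_mon1 hB
  rw [map_sum]
  refine Submodule.sum_mem _ fun t _ => ?_
  generalize b t = u
  obtain ⟨j, l⟩ := t
  have h1 : (fun X Y φ => lieDer mu X (u * dcoef j Y * (D ^ l) φ)) ∈ biDiff := by
    convert add_mem (add_mem (monomial_mem_biDiff (D u) 0 j l) (monomial_mem_biDiff u 0 (j + 1) l))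
      (add_mem (monomial_mem_biDiff u 0 j (l + 1))
        (biDiff.smul_mem mu (monomial_mem_biDiff u 1 j l))) using 1
    funext X Y φ
    simp only [lieDer, D_mul, D_dcoef, D_D_pow, Pi.add_apply, Pi.smul_apply, ← dcoef_zero]
    simp only [Algebra.smul_def]
    ring
  have h2 : (fun X Y φ => u * dcoef j Y * (D ^ l) (lieDer lam X φ)) ∈ biDiff := by
    convert add_mem (D_pow_mul_mem_biDiff u j l 0 1)
      (biDiff.smul_mem lam (D_pow_mul_mem_biDiff u j l 1 0)) using 1
    funext X Y φ
    simp only [lieDer, ← dcoef_zero, D_dcoef, map_add, map_smul, Pi.add_apply, Pi.smul_apply,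
      pow_one, pow_zero, Module.End.one_apply, zero_add]
    simp only [Algebra.smul_def]
    ring
  have h3 : (fun X Y φ => u * dcoef j ⁅X, Y⁆ * (D ^ l) φ) ∈ biDiff := by
    convert sub_mem (D_pow_mul_mem_biDiff' u j l 0 1) (D_pow_mul_mem_biDiff' u j l 1 0) using 1
    funext X Y φ
    change u * (D ^ j) (coef ⁅X, Y⁆) * (D ^ l) φ = _
    rw [coef_lie, map_sub]
    simp only [← dcoef_zero, D_dcoef, Pi.sub_apply, zero_add]
    ring
  obtain ⟨a, ha⟩ := sub_mem (sub_mem (sub_mem h1 h2) (swap_mem_biDiff (sub_mem h1 h2))) h3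
  refine ⟨a, fun X Y φ => ?_⟩
  rw [← ha, d1_apply]
  simp only [map_sub, LinearMap.sub_apply, DiffOp.eval_lie, mon1_apply, eval_mulOp, Pi.sub_apply]

theorem d2_d1 (B : Cochain1 lam mu) : d2 lam mu (d1 lam mu B) = 0 :=
  LinearMap.congr_fun (d₂₃_comp_d₁₂ ℝ VectP (DiffOp lam mu)) B

theorem B2_le_Z2 : B2 lam mu ≤ Z2 lam mu := by
  rintro _ ⟨B, hB, rfl⟩
  exact ⟨d2_d1 B, d1_mem_diffTwoCochain hB⟩

end VectCoh
end

/-! ### Normalisation along d/dt and t d/dt -/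

noncomputable section
namespace VectCoh

variable {lam mu : ℝ}

/-- The differential 2-cochains that vanish on `d/dt` and are invariant under it. -/
def invCochain (lam mu : ℝ) : Submodule ℝ (Cochain2 lam mu) where
  carrier := {c | c ∈ diffTwoCochain lam mu ∧ (∀ Y, c.val (field 0 0) Y = 0) ∧
    ∀ Y Z, ⁅field 0 0, c.val Y Z⁆ = c.val ⁅field 0 0, Y⁆ Z + c.val Y ⁅field 0 0, Z⁆}
  zero_mem' := ⟨zero_mem _, fun Y => by simp, fun Y Z => by simp⟩
  add_mem' := by
    rintro a b ⟨ha, ha', ha''⟩ ⟨hb, hb', hb''⟩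
    refine ⟨add_mem ha hb, fun Y => ?_, fun Y Z => ?_⟩
    · rw [map_add, LinearMap.add_apply, LinearMap.add_apply, ha', hb', add_zero]
    · simp only [map_add, LinearMap.add_apply, lie_add, ha'', hb'']
      abel
  smul_mem' := by
    rintro r a ⟨ha, ha', ha''⟩
    refine ⟨Submodule.smul_mem _ r ha, fun Y => ?_, fun Y Z => ?_⟩
    · rw [map_smul, LinearMap.smul_apply, LinearMap.smul_apply, ha', smul_zero]
    · simp only [map_smul, LinearMap.smul_apply, lie_smul, ha'', smul_add]

/-- Cartan's formula: if c is closed and its contraction with d/dt is zero, then its Lie derivative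
along d/dt is zero. -/
theorem mem_invCochain_of_mem_Z2 {c : Cochain2 lam mu} (hc : c ∈ Z2 lam mu)
    (h : ∀ Y, c.val (field 0 0) Y = 0) : c ∈ invCochain lam mu := by
  refine ⟨hc.2, h, fun Y Z => ?_⟩
  have h1 : d2 lam mu c (field 0 0) Y Z = 0 := by
    rw [show d2 lam mu c = 0 from hc.1]
    rfl
  rw [d2_apply, h, h, c.val_swap (field 0 0) ⁅Y, Z⁆, h, lie_zero, lie_zero, neg_zero, sub_zero,
    sub_zero, add_zero, c.val_swap Y] at h1
  rw [← sub_eq_zero, ← h1]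
  abel

/-- Invariance under d/dt says that the cochain with coefficients a' is zero. Testing it on
monomials centred at z isolates a'(z), so the coefficients are constant and the base point is
immaterial. -/
theorem cf_eq_of_mem_invCochain {c : Cochain2 lam mu} (hc : c ∈ invCochain lam mu) (x y : ℝ)
    (i j l : ℕ) : cf x i j l c = cf y i j l c := by
  obtain ⟨h1, h2, h3⟩ := hc
  obtain ⟨a, ha⟩ := exists_eq_sum_mulOp h1
  have hD : D (a (i, j, l)) = 0 := by
    refine Smooth.ext_evalAt fun z => ?_
    have h5 : ∑ t ∈ a.support,
        (mulOp t.2.2 (D (a t) * dcoef t.1 (field z i) * dcoef t.2.1 (field z j)) :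
          DiffOp lam mu) = 0 := by
      have h4 := h3 (field z i) (field z j)
      rw [ha, ha, ha, lie_sum] at h4
      rw [← Finset.sum_add_distrib, ← sub_eq_zero, ← Finset.sum_sub_distrib] at h4
      rw [← h4]
      refine Finset.sum_congr rfl fun t _ => ?_
      rw [lie_field_zero_mulOp, ← map_add, ← map_sub, dcoef_lie_field_zero, dcoef_lie_field_zero,
        D_mul, D_mul, D_dcoef, D_dcoef]
      congr 1
      ring
    have h6 := congrArg (coeffAt z l) h5
    rw [map_sum, map_zero] at h6
    simp only [coeffAt_mulOp, map_mul, evalAt_dcoef_field] at h6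
    rw [Finset.sum_eq_single (i, j, l)] at h6
    · have hi : (i.factorial : ℝ) ≠ 0 := by positivity
      have hj : (j.factorial : ℝ) ≠ 0 := by positivity
      have hl : (l.factorial : ℝ) ≠ 0 := by positivity
      simpa [hi, hj, hl] using h6
    · rintro ⟨i', j', l'⟩ _ h
      by_cases h1 : i' = i <;> by_cases h2 : j' = j <;> by_cases h3 : l' = l <;> simp_all
    · intro h
      rw [Finsupp.notMem_support_iff] at h
      simp [h]
  rw [cf_of_eq_sum_mulOp ha, cf_of_eq_sum_mulOp ha, evalAt_eq_of_D_eq_zero hD x y]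

theorem cf_zero_left {c : Cochain2 lam mu} (hc : c ∈ invCochain lam mu) (x : ℝ) (j l : ℕ) :
    cf x 0 j l c = 0 := by
  rw [cf_apply, field_zero, hc.2.1, map_zero]

theorem ext_of_mem_invCochain {c c' : Cochain2 lam mu} (hc : c ∈ invCochain lam mu)
    (hc' : c' ∈ invCochain lam mu)
    (h : ∀ i j l, 1 ≤ i → i < j → cf 0 i j l c = cf 0 i j l c') : c = c' := by
  have h1 (i j l : ℕ) (hij : i < j) : cf 0 i j l c = cf 0 i j l c' := by
    rcases Nat.eq_zero_or_pos i with rfl | hi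
    · rw [cf_zero_left hc, cf_zero_left hc']
    · exact h i j l hi hij
  refine Cochain2.ext_cf fun x i j l => ?_
  rw [cf_eq_of_mem_invCochain hc x 0, cf_eq_of_mem_invCochain hc' x 0]
  rcases lt_trichotomy i j with hij | rfl | hij
  · exact h1 i j l hij
  · rw [cf_self, cf_self]
  · rw [cf_swap 0 j i, cf_swap 0 j i, h1 j i l hij]

theorem d1_val_field_zero (B : Cochain1 lam mu) (h : B (field 0 0) = 0) (Y : VectP) :
    (d1 lam mu B).val (field 0 0) Y = ⁅field 0 0, B Y⁆ - B ⁅field 0 0, Y⁆ := by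
  rw [d1_apply, h, lie_zero, sub_zero]

theorem d1_mon1_val_field_zero (u : Smooth) {j : ℕ} (hj : j ≠ 0) (l : ℕ) (Y : VectP) :
    (d1 lam mu (mon1 u j l)).val (field 0 0) Y = mulOp l (D u * dcoef j Y) := by
  rw [d1_val_field_zero _ (by rw [mon1_apply, dcoef_field_zero, if_neg hj, mul_zero, map_zero]),
    mon1_apply, mon1_apply, lie_field_zero_mulOp, dcoef_lie_field_zero, ← map_sub, D_mul, D_dcoef]
  congr 1
  ring

/-- For j ≠ 0 the coboundary of X ↦ u f^(j) ∂^l sends (d/dt, Y) to u' g^(j) ∂^l, so antiderivatives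
of the coefficients with index (0, j, l) cancel c(d/dt, Y). The coefficients with index (0, 0, l)
vanish because c alternates. -/
theorem exists_sub_d1_val_field_zero {c : Cochain2 lam mu} (hc : c ∈ diffTwoCochain lam mu) :
    ∃ B ∈ diffOneCochain lam mu, ∀ Y, (c - d1 lam mu B).val (field 0 0) Y = 0 := by
  obtain ⟨a, ha⟩ := exists_eq_sum_mulOp hc
  choose J hJ using exists_antideriv
  set S := a.support.filter fun t => t.1 = 0 ∧ t.2.1 ≠ 0
  refine ⟨∑ t ∈ S, mon1 (J (a t)) t.2.1 t.2.2, Submodule.sum_mem _ fun t _ => mon1_mem _ _ _,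
    fun Y => ?_⟩
  have h0 (l : ℕ) : a (0, 0, l) = 0 := by
    refine Smooth.ext_evalAt fun x => ?_
    have h := cf_of_eq_sum_mulOp ha x 0 0 l
    rw [cf_self] at h
    have hl : (l.factorial : ℝ) ≠ 0 := by positivity
    simpa [hl] using h.symm
  rw [map_sub, LinearMap.sub_apply, LinearMap.sub_apply, map_sum, map_sum, ha]
  simp only [LinearMap.sum_apply]
  rw [sub_eq_zero, ← Finset.sum_filter_add_sum_filter_not a.support fun t => t.1 = 0 ∧ t.2.1 ≠ 0]
  have h1 : ∑ t ∈ a.support with ¬(t.1 = 0 ∧ t.2.1 ≠ 0),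
      (mulOp t.2.2 (a t * dcoef t.1 (field 0 0) * dcoef t.2.1 Y) : DiffOp lam mu) = 0 := by
    refine Finset.sum_eq_zero ?_
    rintro ⟨i, j, l⟩ ht
    rw [Finset.mem_filter] at ht
    by_cases hi : i = 0
    · by_cases hj : j = 0
      · subst hi hj
        rw [h0]
        simp
      · exact absurd ⟨hi, hj⟩ ht.2
    · simp [dcoef_field_zero, hi]
  rw [h1, add_zero]
  refine Finset.sum_congr rfl ?_
  rintro ⟨i, j, l⟩ ht
  obtain ⟨hi, hj⟩ := (Finset.mem_filter.1 ht).2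
  rw [d1_mon1_val_field_zero _ hj, hJ, dcoef_field_zero, if_pos hi, mul_one]

theorem exists_sub_mem_invCochain {c : Cochain2 lam mu} (hc : c ∈ Z2 lam mu) :
    ∃ b ∈ B2 lam mu, c - b ∈ Z2 lam mu ∧ c - b ∈ invCochain lam mu := by
  obtain ⟨B, hB, h⟩ := exists_sub_d1_val_field_zero hc.2
  have h1 : d1 lam mu B ∈ B2 lam mu := ⟨B, hB, rfl⟩
  have h2 := sub_mem hc (B2_le_Z2 h1)
  exact ⟨_, h1, h2, mem_invCochain_of_mem_Z2 h2 h⟩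

/-- The 1-cochain `X ↦ f^(j) ∂^l / (j! l!)`. -/
def unit1 (j l : ℕ) : Cochain1 lam mu :=
  ((j.factorial : ℝ)⁻¹ * (l.factorial : ℝ)⁻¹) • mon1 1 j l

theorem unit1_mem (j l : ℕ) : (unit1 j l : Cochain1 lam mu) ∈ diffOneCochain lam mu :=
  Submodule.smul_mem _ _ (mon1_mem _ _ _)

theorem cf1_unit1 (x : ℝ) (j l j' l' : ℕ) :
    cf1 x j' l' (unit1 j l : Cochain1 lam mu) = if j = j' ∧ l = l' then 1 else 0 := by
  rw [unit1, map_smul, cf1_mon1]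
  split_ifs with h
  · obtain ⟨rfl, rfl⟩ := h
    have hj : (j.factorial : ℝ) ≠ 0 := by positivity
    have hl : (l.factorial : ℝ) ≠ 0 := by positivity
    rw [map_one, smul_eq_mul]
    field_simp
  · simp

theorem D_one : D 1 = 0 := by
  rw [← mono_zero 0, D_mono]
  simp

theorem d1_unit1_mem_invCochain {j : ℕ} (hj : j ≠ 0) (l : ℕ) :
    d1 lam mu (unit1 j l) ∈ invCochain lam mu := by
  have h1 : d1 lam mu (unit1 j l) ∈ B2 lam mu := ⟨_, unit1_mem j l, rfl⟩
  refine mem_invCochain_of_mem_Z2 (B2_le_Z2 h1) fun Y => ?_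
  rw [unit1, map_smul, map_smul, LinearMap.smul_apply, LinearMap.smul_apply,
    d1_mon1_val_field_zero _ hj, D_one, zero_mul, map_zero, smul_zero]

/-- The elements of `invCochain` whose components have `i + j + l = mu - lam + 2`. -/
def homogCochain (lam mu : ℝ) : Submodule ℝ (Cochain2 lam mu) where
  carrier := {c | c ∈ invCochain lam mu ∧
    ∀ i j l : ℕ, mu - lam + 2 - i - j - l ≠ 0 → cf 0 i j l c = 0}
  zero_mem' := ⟨zero_mem _, fun i j l _ => by simp⟩
  add_mem' := by
    rintro a b ⟨ha, ha'⟩ ⟨hb, hb'⟩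
    refine ⟨add_mem ha hb, fun i j l h => ?_⟩
    rw [map_add, ha' i j l h, hb' i j l h, add_zero]
  smul_mem' := by
    rintro r a ⟨ha, ha'⟩
    refine ⟨Submodule.smul_mem _ r ha, fun i j l h => ?_⟩
    rw [map_smul, ha' i j l h, smul_zero]

theorem d2_eq_zero_of_mem_Z2 {c : Cochain2 lam mu} (hc : c ∈ Z2 lam mu) (X Y Z : VectP) :
    d2 lam mu c X Y Z = 0 := by
  rw [show d2 lam mu c = 0 from hc.1]
  rfl

/-- By the cocycle equation with t d/dt, the weight times `cf 0 i j l c` is a combination of entries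
with first index 1 and the same weight. It is thus enough to kill the latter. -/
theorem mem_homogCochain_of_cf_one {c : Cochain2 lam mu} (hc : c ∈ Z2 lam mu)
    (hi : c ∈ invCochain lam mu)
    (h : ∀ j l : ℕ, mu - lam + 2 - 1 - j - l ≠ 0 → cf 0 1 j l c = 0) :
    c ∈ homogCochain lam mu := by
  have key (i j l : ℕ) (hij : i < j) (hw : mu - lam + 2 - i - j - l ≠ 0) : cf 0 i j l c = 0 := by
    rcases i with _ | _ | i
    · exact cf_zero_left hi 0 j l
    · exact h j l (by simpa using hw)
    · have h1 := coeffAt_d2_one 0 l (j := i + 2) (m := j) (by omega) (by omega) c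
      rw [d2_eq_zero_of_mem_Z2 hc, map_zero] at h1
      have e1 : mu - lam + 2 - 1 - j - (i + 2 + l - 1 : ℕ) ≠ 0 := by
        rw [show i + 2 + l - 1 = i + l + 1 by omega]
        push_cast at hw ⊢
        contrapose! hw
        linarith
      have e2 : mu - lam + 2 - 1 - (i + 2 : ℕ) - (j + l - 1 : ℕ) ≠ 0 := by
        obtain ⟨j, rfl⟩ : ∃ j', j = j' + 1 := ⟨j - 1, by omega⟩
        rw [show j + 1 + l - 1 = j + l by omega]
        push_cast at hw ⊢
        contrapose! hw
        linarith
      have e3 : mu - lam + 2 - 1 - (i + 2 + j - 1 : ℕ) - l ≠ 0 := by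
        rw [show i + 2 + j - 1 = i + j + 1 by omega]
        push_cast at hw ⊢
        contrapose! hw
        linarith
      rw [h _ _ e1, h _ _ e2, h _ _ e3, mul_zero, mul_zero, mul_zero, sub_zero, add_zero,
        add_zero] at h1
      exact (mul_eq_zero.1 h1.symm).resolve_left hw
  refine ⟨hi, fun i j l hw => ?_⟩
  rcases lt_trichotomy i j with hij | rfl | hij
  · exact key i j l hij hw
  · exact cf_self _ _ _ _
  · rw [cf_swap, key j i l hij (by convert hw using 1; ring), neg_zero]

theorem exists_finset_cf {c : Cochain2 lam mu} (hc : c ∈ diffTwoCochain lam mu) :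
    ∃ S : Finset (ℕ × ℕ × ℕ), ∀ i j l, (i, j, l) ∉ S → cf 0 i j l c = 0 := by
  obtain ⟨a, ha⟩ := exists_eq_sum_mulOp hc
  refine ⟨a.support, fun i j l h => ?_⟩
  rw [cf_of_eq_sum_mulOp ha, Finsupp.notMem_support_iff.1 h, map_zero, zero_mul]

theorem exists_sub_mem_homogCochain {c : Cochain2 lam mu} (hc : c ∈ Z2 lam mu) :
    ∃ b ∈ B2 lam mu, c - b ∈ Z2 lam mu ∧ c - b ∈ homogCochain lam mu := by
  obtain ⟨b, hb, hz, hi⟩ := exists_sub_mem_invCochain hc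
  set c' := c - b with hc'
  obtain ⟨S, hS⟩ := exists_finset_cf hz.2
  set T := S.filter fun t => t.1 = 1 ∧ t.2.1 ≠ 0
  let w : ℕ × ℕ × ℕ → ℝ := fun t => mu - lam + 2 - 1 - t.2.1 - t.2.2
  -- In weight zero `(w t)⁻¹` is 0, so those components are left untouched.
  let B : Cochain1 lam mu :=
    ∑ t ∈ T, ((w t)⁻¹ * cf 0 1 t.2.1 t.2.2 c') • unit1 t.2.1 t.2.2
  have hB : B ∈ diffOneCochain lam mu :=
    Submodule.sum_mem _ fun t _ => Submodule.smul_mem _ _ (unit1_mem _ _)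
  have hdB : d1 lam mu B ∈ B2 lam mu := ⟨B, hB, rfl⟩
  have hinv : d1 lam mu B ∈ invCochain lam mu := by
    rw [map_sum]
    refine Submodule.sum_mem _ fun t ht => ?_
    rw [map_smul]
    exact Submodule.smul_mem _ _ (d1_unit1_mem_invCochain (Finset.mem_filter.1 ht).2.2 _)
  have hcf (j l : ℕ) :
      cf1 0 j l B = (mu - lam + 2 - 1 - j - l)⁻¹ * cf 0 1 j l c' := by
    rw [map_sum]
    simp only [map_smul, cf1_unit1, smul_eq_mul]
    rw [Finset.sum_eq_single (1, j, l)]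
    · simp [w]
    · rintro ⟨i', j', l'⟩ ht hne
      rw [Finset.mem_filter] at ht
      rw [if_neg, mul_zero]
      rintro ⟨rfl, rfl⟩
      exact hne (Prod.ext ht.2.1 rfl)
    · intro ht
      suffices h : cf 0 1 j l c' = 0 by simp [h]
      by_cases hj : j = 0
      · rw [hj, cf_swap, cf_zero_left hi, neg_zero]
      · exact hS _ _ _ fun h => ht (Finset.mem_filter.2 ⟨h, rfl, hj⟩)
  refine ⟨b + d1 lam mu B, add_mem hb hdB, ?_, ?_⟩
  · rw [← sub_sub]
    exact sub_mem hz (B2_le_Z2 hdB)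
  · rw [← sub_sub]
    refine mem_homogCochain_of_cf_one (sub_mem hz (B2_le_Z2 hdB)) (sub_mem hi hinv) ?_
    intro j l hw
    rcases j with _ | _ | j
    · rw [cf_swap, cf_zero_left (sub_mem hi hinv), neg_zero]
    · exact cf_self _ _ _ _
    -- The cross term of the coboundary contains the component of B of index 1, which is a multiple
    -- of `cf 0 1 1 _ c'` and hence zero.
    · rw [map_sub, cf_d1_one _ _ (by omega), hcf, hcf, cf_self, mul_zero, mul_zero, add_zero]
      field_simp
      ring

end VectCoh
end

/-! ### Homogeneous cocycles as arrays of structure constants; normalisation along t² d/dt -/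

noncomputable section
namespace VectCoh

/-- An entry of weight zero with 1 ≤ i < j has mu - lam = i + j + l - 2, a positive integer. -/
theorem eq_zero_of_mem_homogCochain {lam mu : ℝ} {c : Cochain2 lam mu}
    (hc : c ∈ homogCochain lam mu) (h : ∀ k : ℕ, 1 ≤ k → mu - lam ≠ k) : c = 0 := by
  refine ext_of_mem_invCochain hc.1 (zero_mem _) fun i j l hi hij => ?_
  rw [map_zero]
  refine hc.2 i j l fun h0 => h (i + j + l - 2) (by omega) ?_
  rw [Nat.cast_sub (by omega)]
  push_cast
  linarith

theorem Z2_le_B2_of_forall_ne {lam mu : ℝ} (h : ∀ k : ℕ, 1 ≤ k → mu - lam ≠ k) :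
    Z2 lam mu ≤ B2 lam mu := by
  intro c hc
  obtain ⟨b, hb, -, h1⟩ := exists_sub_mem_homogCochain hc
  rwa [sub_eq_zero.1 (eq_zero_of_mem_homogCochain h1 h)]

variable {lam : ℝ} {k : ℕ}

/-- The structure constants of a homogeneous 2-cochain in the monomial basis. -/
def nm (i j : ℕ) : Cochain2 lam (lam + k) →ₗ[ℝ] ℝ := cf 0 i j (k + 2 - i - j)

theorem cf_eq_nm {i j l : ℕ} (h : i + j + l = k + 2) (c : Cochain2 lam (lam + k)) :
    cf 0 i j l c = nm i j c := by
  rw [nm, show k + 2 - i - j = l by omega]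

theorem nm_swap (i j : ℕ) (c : Cochain2 lam (lam + k)) : nm j i c = -nm i j c := by
  rw [nm, nm, cf_swap, Nat.sub_right_comm]

theorem nm_self (i : ℕ) (c : Cochain2 lam (lam + k)) : nm i i c = 0 := cf_self _ _ _ _

theorem cf_eq_zero_of_ne {c : Cochain2 lam (lam + k)} (hc : c ∈ homogCochain lam (lam + k))
    {i j l : ℕ} (h : i + j + l ≠ k + 2) : cf 0 i j l c = 0 := by
  refine hc.2 i j l fun h0 => h ?_
  have h1 : ((i + j + l : ℕ) : ℝ) = (k + 2 : ℕ) := by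
    push_cast
    linarith
  exact_mod_cast h1

theorem nm_eq_zero_of_lt {c : Cochain2 lam (lam + k)} (hc : c ∈ homogCochain lam (lam + k))
    {i j : ℕ} (h : k + 2 < i + j) : nm i j c = 0 := cf_eq_zero_of_ne hc (by omega)

theorem ext_nm {c c' : Cochain2 lam (lam + k)} (hc : c ∈ homogCochain lam (lam + k))
    (hc' : c' ∈ homogCochain lam (lam + k))
    (h : ∀ i j, 1 ≤ i → i < j → i + j ≤ k + 2 → nm i j c = nm i j c') : c = c' := by
  refine ext_of_mem_invCochain hc.1 hc'.1 fun i j l hi hij => ?_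
  by_cases hw : i + j + l = k + 2
  · rw [cf_eq_nm hw, cf_eq_nm hw]
    exact h i j hi hij (by omega)
  · rw [cf_eq_zero_of_ne hc hw, cf_eq_zero_of_ne hc' hw]

/-- The value of the differential of a 2-cochain with structure constants `N` on a triple of
monomial fields of degree at least two. -/
def tripleRel (lam : ℝ) (N : ℕ → ℕ → ℝ) (i j m : ℕ) (l : ℝ) : ℝ :=
  -(l + i * lam) * N j m + (l + j * lam) * N i m - (l + m * lam) * N i j
    - ((j : ℝ) - i) * N (i + j - 1) m + ((m : ℝ) - i) * N (i + m - 1) j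
    - ((m : ℝ) - j) * N (j + m - 1) i

/-- The value of the differential of a 2-cochain with structure constants `N` on a triple
consisting of `t d/dt` and two monomial fields of degree at least two. -/
def eulerRel (lam : ℝ) (N : ℕ → ℕ → ℝ) (j m : ℕ) (l : ℝ) : ℝ :=
  (l + j * lam) * N 1 m - (l + m * lam) * N 1 j + ((m : ℝ) - j) * N 1 (j + m - 1)

theorem tripleRel_of_mem_Z2 {c : Cochain2 lam (lam + k)} (hc : c ∈ Z2 lam (lam + k))
    {i j m : ℕ} (hi : 2 ≤ i) (hj : 2 ≤ j) (hm : 2 ≤ m) (h : i + j + m ≤ k + 3) :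
    tripleRel lam (fun i j => nm i j c) i j m (k + 3 - i - j - m) = 0 := by
  obtain ⟨l, hl⟩ := Nat.exists_eq_add_of_le h
  have h1 := coeffAt_d2 0 l hi hj hm c
  rw [d2_eq_zero_of_mem_Z2 hc, map_zero, cf_eq_nm (by omega), cf_eq_nm (by omega),
    cf_eq_nm (by omega), cf_eq_nm (by omega), cf_eq_nm (by omega), cf_eq_nm (by omega)] at h1
  have h2 : (k : ℝ) + 3 - i - j - m = l := by
    have : ((k + 3 : ℕ) : ℝ) = (i + j + m + l : ℕ) := by rw [hl]
    push_cast at this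
    linarith
  rw [h2]
  exact h1.symm

/-- In weight zero the eigenvalue term disappears from the equation with t d/dt. What remains is, up
to sign, the closedness of the 1-cochain j ↦ `nm 1 j c`, the contraction of c with t d/dt. -/
theorem eulerRel_of_mem_Z2 {c : Cochain2 lam (lam + k)} (hc : c ∈ Z2 lam (lam + k))
    {j m : ℕ} (hj : 2 ≤ j) (hm : 2 ≤ m) (h : j + m ≤ k + 2) :
    eulerRel lam (fun i j => nm i j c) j m (k + 2 - j - m) = 0 := by
  obtain ⟨l, hl⟩ := Nat.exists_eq_add_of_le h
  have h1 := coeffAt_d2_one 0 l hj hm c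
  have h2 : (k : ℝ) + 2 - j - m = l := by
    have : ((k + 2 : ℕ) : ℝ) = (j + m + l : ℕ) := by rw [hl]
    push_cast at this
    linarith
  rw [d2_eq_zero_of_mem_Z2 hc, map_zero, cf_eq_nm (by omega), cf_eq_nm (by omega),
    cf_eq_nm (by omega), cf_eq_nm (by omega)] at h1
  rw [h2, eulerRel, h1]
  linear_combination (-nm j m c) * h2

theorem d2_swap_left {lam mu : ℝ} (c : Cochain2 lam mu) (X Y Z : VectP) :
    d2 lam mu c Y X Z = -d2 lam mu c X Y Z := by
  rw [d2_apply, d2_apply, c.val_swap X Y, ← lie_skew Y X, lie_neg, map_neg, LinearMap.neg_apply]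
  abel

theorem d2_swap_right {lam mu : ℝ} (c : Cochain2 lam mu) (X Y Z : VectP) :
    d2 lam mu c X Z Y = -d2 lam mu c X Y Z := by
  rw [d2_apply, d2_apply, c.val_swap Y Z, ← lie_skew Z Y, lie_neg, map_neg, LinearMap.neg_apply]
  abel

theorem d2_field_zero {lam mu : ℝ} {c : Cochain2 lam mu} (hc : c ∈ invCochain lam mu)
    (Y Z : VectP) : d2 lam mu c (field 0 0) Y Z = 0 := by
  rw [d2_apply, hc.2.1, hc.2.1, c.val_swap (field 0 0) ⁅Y, Z⁆, hc.2.1, hc.2.2, c.val_swap Y,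
    lie_zero, lie_zero]
  abel

theorem eq_zero_of_antisymm {f : ℕ → ℕ → ℕ → ℝ} (h1 : ∀ i j m, f j i m = -f i j m)
    (h2 : ∀ i j m, f i m j = -f i j m) (h : ∀ i j m, i < j → j < m → f i j m = 0) (i j m : ℕ) :
    f i j m = 0 := by
  have e1 (i m : ℕ) : f i i m = 0 := by linarith [h1 i i m]
  have e2 (i j : ℕ) : f i j j = 0 := by linarith [h2 i j j]
  have e3 (i j : ℕ) : f i j i = 0 := by linarith [h2 i i j, e1 i j]
  have key (i j m : ℕ) (hij : i < j) : f i j m = 0 := by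
    rcases lt_trichotomy j m with hjm | rfl | hjm
    · exact h i j m hij hjm
    · exact e2 i j
    · rw [h2 i m j]
      rcases lt_trichotomy i m with him | rfl | him
      · rw [h i m j him hjm, neg_zero]
      · rw [e1, neg_zero]
      · rw [h1 m i j, h m i j him hij, neg_zero, neg_zero]
  rcases lt_trichotomy i j with hij | rfl | hij
  · exact key i j m hij
  · exact e1 i m
  · rw [h1 j i m, key j i m hij, neg_zero]

/-- By multilinearity and antisymmetry the differential is tested on monomial fields with i < j < m,
and the base point can be moved to 0. The case i = 0 is invariance under d/dt, and outside the
critical degree all entries vanish. -/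
theorem mem_Z2_of_rel {c : Cochain2 lam (lam + k)} (hc : c ∈ homogCochain lam (lam + k))
    (h1 : ∀ j m, 2 ≤ j → j < m → j + m ≤ k + 2 →
      eulerRel lam (fun i j => nm i j c) j m (k + 2 - j - m) = 0)
    (h2 : ∀ i j m, 2 ≤ i → i < j → j < m → i + j + m ≤ k + 3 →
      tripleRel lam (fun i j => nm i j c) i j m (k + 3 - i - j - m) = 0) :
    c ∈ Z2 lam (lam + k) := by
  refine ⟨?_, hc.1.1⟩
  have key (x : ℝ) (l i j m : ℕ) (hij : i < j) (hjm : j < m) :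
      coeffAt x l (d2 lam (lam + k) c (field x i) (field x j) (field x m)) = 0 := by
    rcases i with _ | _ | i
    · rw [field_zero, d2_field_zero hc.1, map_zero]
    · rw [coeffAt_d2_one x l (by omega) (by omega)]
      simp only [cf_eq_of_mem_invCochain hc.1 x 0]
      by_cases hw : j + m + l = k + 2
      · have h3 := h1 j m (by omega) hjm (by omega)
        have h4 : (k : ℝ) + 2 - j - m = l := by
          have : ((k + 2 : ℕ) : ℝ) = (j + m + l : ℕ) := by rw [hw]
          push_cast at this
          linarith
        rw [cf_eq_nm (by omega), cf_eq_nm (by omega), cf_eq_nm (by omega), cf_eq_nm (by omega)]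
        rw [h4, eulerRel] at h3
        linear_combination h3 + nm j m c * h4
      · rw [cf_eq_zero_of_ne hc (by omega), cf_eq_zero_of_ne hc (by omega),
          cf_eq_zero_of_ne hc (by omega), cf_eq_zero_of_ne hc (by omega)]
        ring
    · rw [coeffAt_d2 x l (by omega) (by omega) (by omega)]
      simp only [cf_eq_of_mem_invCochain hc.1 x 0]
      by_cases hw : i + 2 + j + m + l = k + 3
      · have h3 := h2 (i + 2) j m (by omega) hij hjm (by omega)
        have h4 : (k : ℝ) + 3 - (i + 2 : ℕ) - j - m = l := by
          have : ((k + 3 : ℕ) : ℝ) = (i + 2 + j + m + l : ℕ) := by rw [hw]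
          push_cast at this ⊢
          linarith
        rw [cf_eq_nm (by omega), cf_eq_nm (by omega), cf_eq_nm (by omega), cf_eq_nm (by omega),
          cf_eq_nm (by omega), cf_eq_nm (by omega)]
        rw [h4] at h3
        exact h3
      · rw [cf_eq_zero_of_ne hc (by omega), cf_eq_zero_of_ne hc (by omega),
          cf_eq_zero_of_ne hc (by omega), cf_eq_zero_of_ne hc (by omega),
          cf_eq_zero_of_ne hc (by omega), cf_eq_zero_of_ne hc (by omega)]
        ring
  have key' (x : ℝ) (l i j m : ℕ) :
      coeffAt x l (d2 lam (lam + k) c (field x i) (field x j) (field x m)) = 0 :=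
    eq_zero_of_antisymm (f := fun i j m =>
        coeffAt x l (d2 lam (lam + k) c (field x i) (field x j) (field x m)))
      (fun i j m => by rw [d2_swap_left, map_neg]) (fun i j m => by rw [d2_swap_right, map_neg])
      (key x l) i j m
  change d2 lam (lam + k) c = 0
  refine LinearMap.ext fun X => LinearMap.ext₂ fun Y Z => DiffOp.ext_coeffAt fun x l => ?_
  have e1 (Y Z : VectP) : coeffAt x l ∘ₗ ((d2 lam (lam + k) c).flip Y).flip Z =
      coeffAt x l ∘ₗ ((0 : VectP →ₗ[ℝ] VectP →ₗ[ℝ] VectP →ₗ[ℝ] DiffOp lam (lam + k)).flip Y).flip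
        Z := by
    refine hom_ext_field x fun i => ?_
    have e2 (Z : VectP) : coeffAt x l ∘ₗ (d2 lam (lam + k) c (field x i)).flip Z = 0 := by
      refine hom_ext_field x fun j => ?_
      have e3 : coeffAt x l ∘ₗ d2 lam (lam + k) c (field x i) (field x j) = 0 :=
        hom_ext_field x fun m => key' x l i j m
      exact LinearMap.congr_fun e3 Z
    simpa using LinearMap.congr_fun (e2 Z) Y
  exact LinearMap.congr_fun (e1 Y Z) X

/-- The homogeneous 1-cochain with structure constants `b`. -/
def hom1 (k : ℕ) (b : ℕ → ℝ) : Cochain1 lam (lam + k) :=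
  ∑ j ∈ Finset.Icc 1 (k + 1), b j • unit1 j (k + 1 - j)

theorem hom1_mem (b : ℕ → ℝ) : (hom1 k b : Cochain1 lam (lam + k)) ∈ diffOneCochain lam (lam + k) :=
  Submodule.sum_mem _ fun _ _ => Submodule.smul_mem _ _ (unit1_mem _ _)

theorem cf1_hom1 (b : ℕ → ℝ) (j l : ℕ) : cf1 0 j l (hom1 k b : Cochain1 lam (lam + k)) =
    if 1 ≤ j ∧ j + l = k + 1 then b j else 0 := by
  rw [hom1, map_sum]
  simp only [map_smul, cf1_unit1, smul_eq_mul, mul_ite, mul_one, mul_zero]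
  by_cases h : 1 ≤ j ∧ j + l = k + 1
  · rw [if_pos h, Finset.sum_eq_single j]
    · rw [if_pos ⟨rfl, by omega⟩]
    · intro i _ hij
      rw [if_neg fun h => hij h.1]
    · intro hj
      exact absurd (Finset.mem_Icc.2 ⟨h.1, by omega⟩) hj
  · rw [if_neg h]
    refine Finset.sum_eq_zero fun i hi => if_neg ?_
    rintro ⟨rfl, rfl⟩
    have := Finset.mem_Icc.1 hi
    exact h ⟨this.1, by omega⟩

theorem d1_hom1_mem_B2 (b : ℕ → ℝ) : d1 lam (lam + k) (hom1 k b) ∈ B2 lam (lam + k) :=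
  ⟨_, hom1_mem b, rfl⟩

theorem d1_hom1_mem_homogCochain (b : ℕ → ℝ) :
    d1 lam (lam + k) (hom1 k b) ∈ homogCochain lam (lam + k) := by
  have hi : d1 lam (lam + k) (hom1 k b) ∈ invCochain lam (lam + k) := by
    rw [hom1, map_sum]
    refine Submodule.sum_mem _ fun j hj => ?_
    rw [map_smul]
    exact Submodule.smul_mem _ _
      (d1_unit1_mem_invCochain (by have := Finset.mem_Icc.1 hj; omega) _)
  refine mem_homogCochain_of_cf_one (B2_le_Z2 (d1_hom1_mem_B2 b)) hi fun j l hw => ?_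
  rcases j with _ | _ | j
  · rw [cf_swap, cf_zero_left hi, neg_zero]
  · exact cf_self _ _ _ _
  · have h : j + 1 + 1 + l ≠ k + 1 := fun h => hw <| by
      have : ((j + 1 + 1 + l : ℕ) : ℝ) = (k + 1 : ℕ) := by rw [h]
      push_cast at this ⊢
      linarith
    rw [cf_d1_one _ _ (by omega), cf1_hom1, cf1_hom1, if_neg (by omega), if_neg (by omega),
      mul_zero, mul_zero, add_zero]

theorem nm_d1 (B : Cochain1 lam (lam + k)) {i j : ℕ} (hi : 2 ≤ i) (hj : 2 ≤ j)
    (h : i + j ≤ k + 2) : nm i j (d1 lam (lam + k) B) =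
      -((k : ℝ) + 2 - i - j + i * lam) * cf1 0 j (k + 1 - j) B
        + ((k : ℝ) + 2 - i - j + j * lam) * cf1 0 i (k + 1 - i) B
        - ((j : ℝ) - i) * cf1 0 (i + j - 1) (k + 1 - (i + j - 1)) B := by
  obtain ⟨l, hl⟩ := Nat.exists_eq_add_of_le h
  have h2 : (k : ℝ) + 2 - i - j = l := by
    have : ((k + 2 : ℕ) : ℝ) = (i + j + l : ℕ) := by rw [hl]
    push_cast at this
    linarith
  rw [nm, cf_d1 0 _ hi hj, h2, show k + 2 - i - j = l by omega, show i + l - 1 = k + 1 - j by omega,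
    show j + l - 1 = k + 1 - i by omega, show k + 1 - (i + j - 1) = l by omega]

theorem nm_one_d1 (B : Cochain1 lam (lam + k)) {j : ℕ} (hj : 2 ≤ j) (h : j ≤ k + 1) :
    nm 1 j (d1 lam (lam + k) B) = ((k : ℝ) + 1 - j + j * lam) * cf1 0 1 k B := by
  obtain ⟨l, hl⟩ := Nat.exists_eq_add_of_le h
  have h2 : (k : ℝ) + 1 - j = l := by
    have : ((k + 1 : ℕ) : ℝ) = (j + l : ℕ) := by rw [hl]
    push_cast at this
    linarith
  rw [nm, show k + 2 - 1 - j = l by omega, cf_d1_one 0 _ hj, h2, show j + l - 1 = k by omega,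
    ← h2]
  ring

/-- The homogeneous cocycles that vanish on `t² d/dt` and `t^j d/dt` for `j ≥ 3`. -/
def normalZ2 (lam : ℝ) (k : ℕ) : Submodule ℝ (Cochain2 lam (lam + k)) where
  carrier := {c | c ∈ Z2 lam (lam + k) ∧ c ∈ homogCochain lam (lam + k) ∧
    ∀ j, 3 ≤ j → nm 2 j c = 0}
  zero_mem' := ⟨zero_mem _, zero_mem _, fun j _ => map_zero _⟩
  add_mem' := by
    rintro a b ⟨ha, ha', ha''⟩ ⟨hb, hb', hb''⟩
    refine ⟨add_mem ha hb, add_mem ha' hb', fun j hj => ?_⟩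
    rw [map_add, ha'' j hj, hb'' j hj, add_zero]
  smul_mem' := by
    rintro r a ⟨ha, ha', ha''⟩
    refine ⟨Submodule.smul_mem _ r ha, Submodule.smul_mem _ r ha', fun j hj => ?_⟩
    rw [map_smul, ha'' j hj, smul_zero]

/-- The recursive solution of `(δb)(2, j) = N j` with vanishing initial terms, shifted by three. -/
def normalizer (lam : ℝ) (k : ℕ) (N : ℕ → ℝ) : ℕ → ℝ
  | 0 => 0
  | n + 1 => -(N (n + 3) + ((k : ℝ) - (n + 3) + 2 * lam) * normalizer lam k N n) / (n + 1)

/-- In the equation (δb)(2, j) = `nm 2 j` the unknown b (j + 1) has coefficient -(j - 2), non-zero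
for j ≥ 3. The equations can thus be solved one after another from b 2 = b 3 = 0. -/
theorem exists_sub_mem_normalZ2 {c : Cochain2 lam (lam + k)} (hc : c ∈ Z2 lam (lam + k)) :
    ∃ b ∈ B2 lam (lam + k), c - b ∈ normalZ2 lam k := by
  obtain ⟨b, hb, hz, hh⟩ := exists_sub_mem_homogCochain hc
  set c' := c - b with hc'
  set f := normalizer lam k fun j => nm 2 j c'
  set B : Cochain1 lam (lam + k) := hom1 k fun j => if 3 ≤ j then f (j - 3) else 0
  have hdB := d1_hom1_mem_B2 (lam := lam) (k := k) fun j => if 3 ≤ j then f (j - 3) else 0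
  have hdB' := d1_hom1_mem_homogCochain (lam := lam) (k := k)
    fun j => if 3 ≤ j then f (j - 3) else 0
  refine ⟨b + d1 lam (lam + k) B, add_mem hb hdB, ?_⟩
  rw [← sub_sub]
  have h2 := sub_mem hh hdB'
  refine ⟨sub_mem hz (B2_le_Z2 hdB), h2, fun j hj => ?_⟩
  by_cases hjk : k < j
  · exact nm_eq_zero_of_lt h2 (by omega)
  · rw [map_sub, nm_d1 _ (by omega) (by omega) (by omega), cf1_hom1, cf1_hom1, cf1_hom1,
      if_pos (by omega), if_pos hj, if_pos (by omega), if_neg (by omega), if_pos (by omega),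
      if_pos (by omega)]
    obtain ⟨n, rfl⟩ := Nat.exists_eq_add_of_le' hj
    rw [show 2 + (n + 3) - 1 - 3 = n + 1 by omega, show n + 3 - 3 = n by omega,
      show f (n + 1) = -(nm 2 (n + 3) c' + ((k : ℝ) - (n + 3) + 2 * lam) * f n) / (n + 1) from rfl]
    have hn : (n : ℝ) + 1 ≠ 0 := by positivity
    push_cast
    field_simp
    ring

end VectCoh
end

/-! ### Rigidity of normalised cocycles, and the normalised coboundaries -/

noncomputable section
namespace VectCoh

/-- The quadratic factor of the `(3, 4)` structure constant of a normalised coboundary. -/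
def qPoly (k y : ℝ) : ℝ := y ^ 2 - 1 - 3 * k

/-- The factor of the `(4, 5)` structure constant of a normalised coboundary. -/
def rPoly (k y : ℝ) : ℝ :=
  60 * k * y - 120 * k + y ^ 4 - 20 * y ^ 3 + 35 * y ^ 2 + 20 * y - 36

/-- Modulo `qPoly`, that is for y² = 1 + 3 k, `rPoly` reduces to (y² - 1)(y² - 4), whose roots give
k = 0 or k = 1. -/
theorem qPoly_ne_zero_or_rPoly_ne_zero {k : ℝ} (hk : 1 < k) (y : ℝ) :
    qPoly k y ≠ 0 ∨ rPoly k y ≠ 0 := by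
  by_contra! h
  obtain ⟨h1, h2⟩ := h
  rw [qPoly] at h1
  rw [rPoly] at h2
  have h3 : (y ^ 2 - 1) * (y ^ 2 - 4) = 0 := by linear_combination h2 + (20 * y - 40) * h1
  rcases mul_eq_zero.1 h3 with h | h <;> linarith

/-- The hypotheses say (δg)(2, j) = 0 for j = 3, 4, 5, and the left side is -(δg)(3, 4). There are
two uses. If g is the row `nm 1 j` of a cocycle, the left side must vanish, which constrains `gDet`.
If g is a 1-cochain with normalised coboundary, the left side is minus the entry `nm 3 4` of that
coboundary. `seq_rel_four_five` plays the same role for the pair (4, 5). -/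
theorem seq_rel_three_four {k lam g2 g3 g4 g5 g6 : ℝ}
    (h3 : (k - 3 + 2 * lam) * g3 - (k - 3 + 3 * lam) * g2 + g4 = 0)
    (h4 : (k - 4 + 2 * lam) * g4 - (k - 4 + 4 * lam) * g2 + 2 * g5 = 0)
    (h5 : (k - 5 + 2 * lam) * g5 - (k - 5 + 5 * lam) * g2 + 3 * g6 = 0) :
    (k - 5 + 3 * lam) * g4 - (k - 5 + 4 * lam) * g3 + g6 =
      -(qPoly k (2 * lam + k - 1) / 6 * ((2 * lam + k - 1) * g3 - (k - 2 + 3 * lam) * g2)) := by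
  obtain rfl : g4 = -((k - 3 + 2 * lam) * g3 - (k - 3 + 3 * lam) * g2) := by linarith
  obtain rfl : g5 = -((k - 4 + 2 * lam) * (-((k - 3 + 2 * lam) * g3 - (k - 3 + 3 * lam) * g2))
    - (k - 4 + 4 * lam) * g2) / 2 := by linarith
  rw [qPoly]
  linear_combination h5 / 3

theorem seq_rel_four_five {k lam g2 g3 g4 g5 g6 g7 g8 : ℝ}
    (h3 : (k - 3 + 2 * lam) * g3 - (k - 3 + 3 * lam) * g2 + g4 = 0)
    (h4 : (k - 4 + 2 * lam) * g4 - (k - 4 + 4 * lam) * g2 + 2 * g5 = 0)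
    (h5 : (k - 5 + 2 * lam) * g5 - (k - 5 + 5 * lam) * g2 + 3 * g6 = 0)
    (h6 : (k - 6 + 2 * lam) * g6 - (k - 6 + 6 * lam) * g2 + 4 * g7 = 0)
    (h7 : (k - 7 + 2 * lam) * g7 - (k - 7 + 7 * lam) * g2 + 5 * g8 = 0) :
    (k - 7 + 4 * lam) * g5 - (k - 7 + 5 * lam) * g4 + g8 =
      -(rPoly k (2 * lam + k - 1) / 120 *
        ((2 * lam + k - 1) * g3 - (k - 2 + 3 * lam) * g2)) := by
  obtain rfl : g4 = -((k - 3 + 2 * lam) * g3 - (k - 3 + 3 * lam) * g2) := by linarith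
  obtain rfl : g5 = -((k - 4 + 2 * lam) * (-((k - 3 + 2 * lam) * g3 - (k - 3 + 3 * lam) * g2))
    - (k - 4 + 4 * lam) * g2) / 2 := by linarith
  rw [rPoly]
  linear_combination h7 / 5 - (k - 7 + 2 * lam) / 20 * h6 +
    (k - 7 + 2 * lam) * (k - 6 + 2 * lam) / 60 * h5

variable {lam : ℝ} {k : ℕ}

theorem nm_rel_one {c : Cochain2 lam (lam + k)} (hc : c ∈ Z2 lam (lam + k)) {j : ℕ} (hj : 3 ≤ j)
    (hjk : j ≤ k) :
    ((k : ℝ) - j + 2 * lam) * nm 1 j c - ((k : ℝ) - j + j * lam) * nm 1 2 c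
      + ((j : ℝ) - 2) * nm 1 (j + 1) c = 0 := by
  have h1 := eulerRel_of_mem_Z2 hc le_rfl (by omega : 2 ≤ j) (by omega)
  rw [eulerRel, show 2 + j - 1 = j + 1 by omega] at h1
  push_cast at h1
  linear_combination h1

theorem nm_rel_two {c : Cochain2 lam (lam + k)} (hc : c ∈ normalZ2 lam k) {i j : ℕ} (hi : 3 ≤ i)
    (hj : 3 ≤ j) (hij : i + j ≤ k + 1) :
    ((i : ℝ) - 2) * nm (i + 1) j c + ((j : ℝ) - 2) * nm i (j + 1) c
      + (2 * lam + k + 1 - i - j) * nm i j c = 0 := by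
  have h1 := tripleRel_of_mem_Z2 hc.1 le_rfl (by omega : 2 ≤ i) (by omega : 2 ≤ j) (by omega)
  simp only [tripleRel] at h1
  rw [show 2 + i - 1 = i + 1 by omega, show 2 + j - 1 = j + 1 by omega, hc.2.2 i hi,
    hc.2.2 j hj, nm_swap i (j + 1), nm_swap 2 (i + j - 1), hc.2.2 (i + j - 1) (by omega)] at h1
  push_cast at h1
  linear_combination -h1

theorem nm_one_eq_zero {c : Cochain2 lam (lam + k)} (hc : c ∈ Z2 lam (lam + k))
    (h2 : nm 1 2 c = 0) (h3 : nm 1 3 c = 0) {j : ℕ} (hj : 2 ≤ j) (hjk : j ≤ k + 1) :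
    nm 1 j c = 0 := by
  induction j, hj using Nat.le_induction with
  | base => exact h2
  | succ j hj ih =>
    rcases hj.eq_or_lt with rfl | hj
    · exact h3
    · have h := nm_rel_one hc hj (by omega)
      rw [ih (by omega), h2, mul_zero, mul_zero, sub_zero, zero_add] at h
      have hj' : (2 : ℝ) < j := by exact_mod_cast hj
      exact (mul_eq_zero.1 h).resolve_left (by linarith)

/-- Once all lower degrees vanish, the (2, i, j) relation ties `nm (i + 1) j` to its neighbour `nm i
(j + 1)` on the same antidiagonal, with coefficient i - 2 ≠ 0. So the entry with first index 3
controls the whole antidiagonal. -/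
theorem nm_eq_zero_of_three {c : Cochain2 lam (lam + k)} (hc : c ∈ normalZ2 lam k) {s : ℕ}
    (hs : s ≤ k + 2) (h3 : nm 3 (s - 3) c = 0)
    (hlt : ∀ i j, 3 ≤ i → 3 ≤ j → i + j < s → nm i j c = 0) {i j : ℕ} (hi : 3 ≤ i) (hj : 3 ≤ j)
    (hij : i + j = s) : nm i j c = 0 := by
  induction i, hi using Nat.le_induction generalizing j with
  | base => rwa [show j = s - 3 by omega]
  | succ i hi ih =>
    have h := nm_rel_two hc hi hj (by omega)
    rw [ih (by omega) (by omega), hlt i j hi hj (by omega), mul_zero, mul_zero, add_zero,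
      add_zero] at h
    have hi' : (2 : ℝ) < i := by exact_mod_cast hi
    exact (mul_eq_zero.1 h).resolve_left (by linarith)

/-- With lower degrees zero, three (2, i, j) relations express the entries (4, m + 2), (5, m + 1)
and (6, m) through (3, m + 3). The triple (3, 4, m) then says that a polynomial in m, positive for m
≥ 5, kills the entry (3, m + 3). -/
theorem nm_three_eq_zero {c : Cochain2 lam (lam + k)} (hc : c ∈ normalZ2 lam k) {m : ℕ}
    (hm : 5 ≤ m) (hs : m + 6 ≤ k + 2)
    (hlt : ∀ i j, 3 ≤ i → 3 ≤ j → i + j < m + 6 → nm i j c = 0) : nm 3 (m + 3) c = 0 := by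
  have e1 := nm_rel_two hc le_rfl (by omega : 3 ≤ m + 2) (by omega)
  have e2 := nm_rel_two hc (by omega : 3 ≤ 4) (by omega : 3 ≤ m + 1) (by omega)
  have e3 := nm_rel_two hc (by omega : 3 ≤ 5) (by omega : 3 ≤ m) (by omega)
  have e4 := tripleRel_of_mem_Z2 hc.1 (by omega : 2 ≤ 3) (by omega : 2 ≤ 4) (by omega : 2 ≤ m)
    (by omega)
  simp only [tripleRel] at e4
  rw [hlt 3 (m + 2) le_rfl (by omega) (by omega)] at e1
  rw [hlt 4 (m + 1) (by omega) (by omega) (by omega)] at e2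
  rw [hlt 5 m (by omega) (by omega) (by omega)] at e3
  rw [hlt 4 m (by omega) (by omega) (by omega), hlt 3 m (by omega) (by omega) (by omega),
    hlt 3 4 (by omega) (by omega) (by omega), show 3 + 4 - 1 = 6 from rfl,
    show 3 + m - 1 = m + 2 by omega, show 4 + m - 1 = m + 3 by omega, nm_swap 4 (m + 2),
    nm_swap 3 (m + 3)] at e4
  simp only [show 3 + 1 = 4 from rfl, show 4 + 1 = 5 from rfl, show 5 + 1 = 6 from rfl,
    show m + 2 + 1 = m + 3 from rfl, show m + 1 + 1 = m + 2 from rfl] at e1 e2 e3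
  push_cast at e1 e2 e3 e4
  have h4 : nm 4 (m + 2) c = -(m * nm 3 (m + 3) c) := by linear_combination e1
  rw [h4] at e2 e4
  have h5 : nm 5 (m + 1) c = m * (m - 1) / 2 * nm 3 (m + 3) c := by linear_combination e2 / 2
  rw [h5] at e3
  have h6 : nm 6 m c = -(m * (m - 1) * (m - 2) / 6 * nm 3 (m + 3) c) := by
    linear_combination e3 / 3
  rw [h6] at e4
  have h7 : ((m : ℝ) * (m - 1) * (m - 2) / 6 + (m - 3) * m + (m - 4)) * nm 3 (m + 3) c = 0 := by
    linear_combination e4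
  -- After the substitution m = n + 5 every coefficient of the polynomial is positive.
  obtain ⟨n, rfl⟩ := Nat.exists_eq_add_of_le' hm
  refine (mul_eq_zero.1 h7).resolve_left (ne_of_gt ?_)
  push_cast
  ring_nf
  positivity

/-- Induction on the degree i + j. From degree 11 on `nm_three_eq_zero` applies; in degrees 6 to 10
the (2, i, j) relations leave only (3, 4) and (4, 5) free. -/
theorem nm_eq_zero_of_three_four {c : Cochain2 lam (lam + k)} (hc : c ∈ normalZ2 lam k)
    (h34 : nm 3 4 c = 0) (h45 : nm 4 5 c = 0) {i j : ℕ} (hi : 3 ≤ i) (hj : 3 ≤ j) :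
    nm i j c = 0 := by
  obtain ⟨s, hs⟩ : ∃ s, i + j = s := ⟨_, rfl⟩
  induction s using Nat.strong_induction_on generalizing i j with
  | _ s ih =>
    by_cases hk : k + 2 < s
    · exact nm_eq_zero_of_lt hc.2.1 (by omega)
    · have hlt : ∀ i j, 3 ≤ i → 3 ≤ j → i + j < s → nm i j c = 0 :=
        fun i j hi hj hij => ih (i + j) hij hi hj rfl
      refine nm_eq_zero_of_three hc (by omega) ?_ hlt hi hj hs
      by_cases h11 : 11 ≤ s
      · have := nm_three_eq_zero hc (m := s - 6) (by omega) (by omega) (by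
          rwa [show s - 6 + 6 = s by omega])
        rwa [show s - 6 + 3 = s - 3 by omega] at this
      · have h6 : 6 ≤ s := by omega
        interval_cases s
        · exact nm_self 3 c
        · exact h34
        · have e := nm_rel_two hc le_rfl (by omega : 3 ≤ 4) (by omega)
          rw [h34, nm_self] at e
          norm_num at e
          exact e
        · have e := nm_rel_two hc le_rfl (by omega : 3 ≤ 5) (by omega)
          rw [hlt 3 5 (by omega) (by omega) (by omega), h45] at e
          norm_num at e
          exact e
        · have e := nm_rel_two hc le_rfl (by omega : 3 ≤ 6) (by omega)
          have e' := nm_rel_two hc (by omega : 3 ≤ 4) (by omega : 3 ≤ 5) (by omega)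
          rw [hlt 4 5 (by omega) (by omega) (by omega), nm_self] at e'
          norm_num at e'
          rw [hlt 3 6 (by omega) (by omega) (by omega), e'] at e
          norm_num at e
          exact e

theorem eq_zero_of_mem_normalZ2 {c : Cochain2 lam (lam + k)} (hc : c ∈ normalZ2 lam k)
    (h12 : nm 1 2 c = 0) (h13 : nm 1 3 c = 0) (h34 : nm 3 4 c = 0) (h45 : nm 4 5 c = 0) :
    c = 0 := by
  refine ext_nm hc.2.1 (zero_mem _) fun i j hi hij hk => ?_
  rw [map_zero]
  rcases i with _ | _ | _ | i
  · omega
  · exact nm_one_eq_zero hc.1 h12 h13 (by omega) (by omega)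
  · exact hc.2.2 j hij
  · exact nm_eq_zero_of_three_four hc h34 h45 (by omega) (by omega)

/-- The determinant of `(nm 1 2, nm 1 3)` with the corresponding vector of the coboundary of
`t d/dt ↦ ∂^k`. -/
def gDet (lam : ℝ) (k : ℕ) : Cochain2 lam (lam + k) →ₗ[ℝ] ℝ :=
  (2 * lam + k - 1) • nm 1 3 - (k - 2 + 3 * lam) • nm 1 2

theorem gDet_apply (c : Cochain2 lam (lam + k)) :
    gDet lam k c = (2 * lam + k - 1) * nm 1 3 c - (k - 2 + 3 * lam) * nm 1 2 c := rfl

theorem qPoly_mul_gDet {c : Cochain2 lam (lam + k)} (hc : c ∈ Z2 lam (lam + k)) (hk : 5 ≤ k) :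
    qPoly k (2 * lam + k - 1) * gDet lam k c = 0 := by
  have e3 := nm_rel_one hc (le_refl 3) (by omega)
  have e4 := nm_rel_one hc (by omega : 3 ≤ 4) (by omega)
  have e5 := nm_rel_one hc (by omega : 3 ≤ 5) (by omega)
  have e := eulerRel_of_mem_Z2 hc (by omega : 2 ≤ 3) (by omega : 2 ≤ 4) (by omega)
  rw [eulerRel] at e
  norm_num at e e3 e4 e5
  have h := seq_rel_three_four (k := k) (lam := lam) (g2 := nm 1 2 c) (g3 := nm 1 3 c)
    (g4 := nm 1 4 c) (g5 := nm 1 5 c) (g6 := nm 1 6 c)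
    (by linear_combination e3) (by linear_combination e4) (by linear_combination e5)
  rw [gDet_apply]
  linear_combination 6 * h - 6 * e

theorem rPoly_mul_gDet {c : Cochain2 lam (lam + k)} (hc : c ∈ Z2 lam (lam + k)) (hk : 7 ≤ k) :
    rPoly k (2 * lam + k - 1) * gDet lam k c = 0 := by
  have e3 := nm_rel_one hc (le_refl 3) (by omega)
  have e4 := nm_rel_one hc (by omega : 3 ≤ 4) (by omega)
  have e5 := nm_rel_one hc (by omega : 3 ≤ 5) (by omega)
  have e6 := nm_rel_one hc (by omega : 3 ≤ 6) (by omega)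
  have e7 := nm_rel_one hc (by omega : 3 ≤ 7) (by omega)
  have e := eulerRel_of_mem_Z2 hc (by omega : 2 ≤ 4) (by omega : 2 ≤ 5) (by omega)
  rw [eulerRel] at e
  norm_num at e e3 e4 e5 e6 e7
  have h := seq_rel_four_five (k := k) (lam := lam) (g2 := nm 1 2 c) (g3 := nm 1 3 c)
    (g4 := nm 1 4 c) (g5 := nm 1 5 c) (g6 := nm 1 6 c)
    (g7 := nm 1 7 c) (g8 := nm 1 8 c)
    (by linear_combination e3) (by linear_combination e4) (by linear_combination e5)
    (by linear_combination e6) (by linear_combination e7)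
  rw [gDet_apply]
  linear_combination 120 * h - 120 * e

theorem gDet_eq_zero {c : Cochain2 lam (lam + k)} (hc : c ∈ Z2 lam (lam + k)) (hk : 7 ≤ k) :
    gDet lam k c = 0 := by
  have hk' : (1 : ℝ) < k := by exact_mod_cast (by omega : 1 < k)
  rcases qPoly_ne_zero_or_rPoly_ne_zero hk' (2 * lam + k - 1) with h | h
  · exact (mul_eq_zero.1 (qPoly_mul_gDet hc (by omega))).resolve_left h
  · exact (mul_eq_zero.1 (rPoly_mul_gDet hc hk)).resolve_left h

/-- Here s is the component of a primitive on t d/dt, and t is the determinant form of `gDet`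
applied to its components on t² d/dt and t³ d/dt. The bounds on k express that the entry (i, j) is
present only if i + j ≤ k + 2. -/
theorem nm_of_mem_B2 {c : Cochain2 lam (lam + k)} (hc : c ∈ normalZ2 lam k)
    (hB : c ∈ B2 lam (lam + k)) :
    (∃ s : ℝ, (1 ≤ k → nm 1 2 c = (2 * lam + k - 1) * s) ∧
      (2 ≤ k → nm 1 3 c = (k - 2 + 3 * lam) * s)) ∧
    ∃ t : ℝ, (5 ≤ k → nm 3 4 c = qPoly k (2 * lam + k - 1) / 6 * t) ∧
      (7 ≤ k → nm 4 5 c = rPoly k (2 * lam + k - 1) / 120 * t) := by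
  obtain ⟨B, -, rfl⟩ := hB
  refine ⟨⟨cf1 0 1 k B, fun h => ?_, fun h => ?_⟩, (2 * lam + k - 1) * cf1 0 3 (k + 1 - 3) B
    - (k - 2 + 3 * lam) * cf1 0 2 (k + 1 - 2) B, fun h => ?_, fun h => ?_⟩
  · rw [nm_one_d1 _ le_rfl (by omega)]
    push_cast
    ring
  · rw [nm_one_d1 _ (by omega) (by omega)]
    push_cast
    ring
  · have e (j : ℕ) (hj : 3 ≤ j) (hjk : j ≤ k) := nm_d1 B le_rfl (by omega : 2 ≤ j) (by omega)
    have e3 := e 3 le_rfl (by omega)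
    have e4 := e 4 (by omega) (by omega)
    have e5 := e 5 (by omega) (by omega)
    rw [hc.2.2 _ (by omega)] at e3 e4 e5
    norm_num at e3 e4 e5
    rw [nm_d1 B (by omega) (by omega) (by omega)]
    norm_num
    have h := seq_rel_three_four (k := k) (lam := lam) (g2 := cf1 0 2 (k + 1 - 2) B)
      (g3 := cf1 0 3 (k + 1 - 3) B) (g4 := cf1 0 4 (k + 1 - 4) B) (g5 := cf1 0 5 (k + 1 - 5) B)
      (g6 := cf1 0 6 (k + 1 - 6) B)
      (by linear_combination e3) (by linear_combination e4) (by linear_combination e5)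
    linear_combination -h
  · have e (j : ℕ) (hj : 3 ≤ j) (hjk : j ≤ k) := nm_d1 B le_rfl (by omega : 2 ≤ j) (by omega)
    have e3 := e 3 le_rfl (by omega)
    have e4 := e 4 (by omega) (by omega)
    have e5 := e 5 (by omega) (by omega)
    have e6 := e 6 (by omega) (by omega)
    have e7 := e 7 (by omega) (by omega)
    rw [hc.2.2 _ (by omega)] at e3 e4 e5 e6 e7
    norm_num at e3 e4 e5 e6 e7
    rw [nm_d1 B (by omega) (by omega) (by omega)]
    norm_num
    have h := seq_rel_four_five (k := k) (lam := lam) (g2 := cf1 0 2 (k + 1 - 2) B)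
      (g3 := cf1 0 3 (k + 1 - 3) B) (g4 := cf1 0 4 (k + 1 - 4) B) (g5 := cf1 0 5 (k + 1 - 5) B)
      (g6 := cf1 0 6 (k + 1 - 6) B) (g7 := cf1 0 7 (k + 1 - 7) B) (g8 := cf1 0 8 (k + 1 - 8) B)
      (by linear_combination e3) (by linear_combination e4) (by linear_combination e5)
      (by linear_combination e6) (by linear_combination e7)
    linear_combination -h

/-- The structure constants of a 1-cochain with normalised coboundary, shifted by three. -/
def coboundarySeq (lam : ℝ) (k : ℕ) (b2 b3 : ℝ) : ℕ → ℝ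
  | 0 => b3
  | n + 1 => (((k : ℝ) - (n + 3) + (n + 3) * lam) * b2
      - ((k : ℝ) - (n + 3) + 2 * lam) * coboundarySeq lam k b2 b3 n) / (n + 1)

theorem exists_mem_normalZ2_B2 (hk : 1 ≤ k) (s t : ℝ) :
    ∃ c ∈ normalZ2 lam k, c ∈ B2 lam (lam + k) ∧ nm 1 2 c = (2 * lam + k - 1) * s ∧
      (2 ≤ k → nm 1 3 c = (k - 2 + 3 * lam) * s) ∧
      (5 ≤ k → nm 3 4 c = qPoly k (2 * lam + k - 1) / 6 * t) ∧
      (7 ≤ k → nm 4 5 c = rPoly k (2 * lam + k - 1) / 120 * t) := by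
  -- The two coefficients of this linear form cannot vanish together, since that would force k = -1.
  obtain ⟨b2, b3, hb⟩ : ∃ b2 b3 : ℝ, (2 * lam + k - 1) * b3 - (k - 2 + 3 * lam) * b2 = t := by
    by_cases h0 : 2 * lam + k - 1 = 0
    · have h1 : (k : ℝ) - 2 + 3 * lam ≠ 0 := fun h => by
        have : (0 : ℝ) ≤ k := by positivity
        linarith
      exact ⟨-((k - 2 + 3 * lam)⁻¹ * t), 0, by linear_combination t * mul_inv_cancel₀ h1⟩
    · exact ⟨0, (2 * lam + k - 1)⁻¹ * t, by linear_combination t * mul_inv_cancel₀ h0⟩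
  set f := coboundarySeq lam k b2 b3 with hf
  -- The truncated subtraction at j = 0 is harmless: `hom1` only uses indices from 1 on.
  set b : ℕ → ℝ := fun j => if j = 1 then s else if j = 2 then b2 else f (j - 3) with hbdef
  have hcf (j : ℕ) (h1 : 1 ≤ j) (h2 : j ≤ k + 1) :
      cf1 0 j (k + 1 - j) (hom1 k b : Cochain1 lam (lam + k)) = b j := by
    rw [cf1_hom1, if_pos (by omega)]
  have hn : d1 lam (lam + k) (hom1 k b) ∈ normalZ2 lam k := by
    refine ⟨B2_le_Z2 (d1_hom1_mem_B2 b), d1_hom1_mem_homogCochain b, fun j hj => ?_⟩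
    by_cases hjk : k < j
    · exact nm_eq_zero_of_lt (d1_hom1_mem_homogCochain b) (by omega)
    · rw [nm_d1 _ le_rfl (by omega) (by omega), hcf _ (by omega) (by omega),
        hcf _ (by omega) (by omega), hcf _ (by omega) (by omega)]
      obtain ⟨n, rfl⟩ := Nat.exists_eq_add_of_le' hj
      have h1 : b (n + 3) = f n := by simp [hbdef]
      have h2 : b (2 + (n + 3) - 1) = f (n + 1) := by
        rw [show 2 + (n + 3) - 1 = n + 4 by omega]
        simp [hbdef]
      have h3 : b 2 = b2 := by simp [hbdef]
      have hn : (n : ℝ) + 1 ≠ 0 := by positivity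
      rw [h1, h2, h3, show f (n + 1) = (((k : ℝ) - (n + 3) + (n + 3) * lam) * b2
        - ((k : ℝ) - (n + 3) + 2 * lam) * f n) / (n + 1) from rfl]
      push_cast
      field_simp
      ring
  have hb' : (2 * lam + k - 1) * b 3 - (k - 2 + 3 * lam) * b 2 = t := hb
  have hcf1 : cf1 0 1 k (hom1 k b : Cochain1 lam (lam + k)) = s := by
    rw [cf1_hom1, if_pos (by omega)]
    rfl
  refine ⟨_, hn, d1_hom1_mem_B2 b, ?_, fun h => ?_, fun h => ?_, fun h => ?_⟩
  · rw [nm_one_d1 _ le_rfl (by omega), hcf1]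
    push_cast
    ring
  · rw [nm_one_d1 _ (by omega) (by omega), hcf1]
    push_cast
    ring
  · have e (j : ℕ) (hj : 3 ≤ j) (hjk : j ≤ k) :=
      nm_d1 (hom1 k b : Cochain1 lam (lam + k)) le_rfl (by omega : 2 ≤ j) (by omega)
    have e3 := e 3 le_rfl (by omega)
    have e4 := e 4 (by omega) (by omega)
    have e5 := e 5 (by omega) (by omega)
    rw [hn.2.2 _ (by omega), hcf _ (by omega) (by omega), hcf _ (by omega) (by omega),
      hcf _ (by omega) (by omega)] at e3 e4 e5
    norm_num at e3 e4 e5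
    rw [nm_d1 _ (by omega) (by omega) (by omega), hcf _ (by omega) (by omega),
      hcf _ (by omega) (by omega), hcf _ (by omega) (by omega)]
    norm_num
    have h := seq_rel_three_four (k := k) (lam := lam) (g2 := b 2) (g3 := b 3) (g4 := b 4)
      (g5 := b 5) (g6 := b 6)
      (by linear_combination e3) (by linear_combination e4) (by linear_combination e5)
    rw [hb'] at h
    linear_combination -h
  · have e (j : ℕ) (hj : 3 ≤ j) (hjk : j ≤ k) :=
      nm_d1 (hom1 k b : Cochain1 lam (lam + k)) le_rfl (by omega : 2 ≤ j) (by omega)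
    have e3 := e 3 le_rfl (by omega)
    have e4 := e 4 (by omega) (by omega)
    have e5 := e 5 (by omega) (by omega)
    have e6 := e 6 (by omega) (by omega)
    have e7 := e 7 (by omega) (by omega)
    rw [hn.2.2 _ (by omega), hcf _ (by omega) (by omega), hcf _ (by omega) (by omega),
      hcf _ (by omega) (by omega)] at e3 e4 e5 e6 e7
    norm_num at e3 e4 e5 e6 e7
    rw [nm_d1 _ (by omega) (by omega) (by omega), hcf _ (by omega) (by omega),
      hcf _ (by omega) (by omega), hcf _ (by omega) (by omega)]
    norm_num
    have h := seq_rel_four_five (k := k) (lam := lam) (g2 := b 2) (g3 := b 3) (g4 := b 4)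
      (g5 := b 5) (g6 := b 6) (g7 := b 7) (g8 := b 8)
      (by linear_combination e3) (by linear_combination e4) (by linear_combination e5)
      (by linear_combination e6) (by linear_combination e7)
    rw [hb'] at h
    linear_combination -h

end VectCoh
end

/-! ### Indices at least three: the universal polynomial solution up to degree 16 -/

noncomputable section
namespace VectCoh

/-- The structure constant with indices `(3, 4)`, see `solN`. -/
def solN3_4 (_k _y a _b : ℝ) : ℝ :=
  a

/-- The structure constant with indices `(3, 5)`, see `solN`. -/
def solN3_5 (_k y a _b : ℝ) : ℝ :=
  a * (-y + 5) / 2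

/-- The structure constant with indices `(3, 6)`, see `solN`. -/
def solN3_6 (_k y a b : ℝ) : ℝ :=
  a * (y ^ 2 - 11 * y + 30) / 6 + b * (-1) / 3

/-- The structure constant with indices `(4, 5)`, see `solN`. -/
def solN4_5 (_k _y _a b : ℝ) : ℝ :=
  b

/-- The structure constant with indices `(3, 7)`, see `solN`. -/
def solN3_7 (_k y a b : ℝ) : ℝ :=
  a * (-y ^ 3 + 18 * y ^ 2 - 107 * y + 210) / 24 + b * (y - 7) / 6

/-- The structure constant with indices `(4, 6)`, see `solN`. -/
def solN4_6 (_k y _a b : ℝ) : ℝ :=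
  b * (-y + 7) / 3

/-- The structure constant with indices `(3, 8)`, see `solN`. -/
def solN3_8 (k y a b : ℝ) : ℝ :=
  a * (y ^ 4 - 26 * y ^ 3 + 257 * y ^ 2 - 3 * k * y - 1102 * y + 6 * k + 1746) / 126 + b * (-5 * y
      ^ 2 + 84 * y - 3 * k - 325) / 126

/-- The structure constant with indices `(4, 7)`, see `solN`. -/
def solN4_7 (k y a b : ℝ) : ℝ :=
  a * (y ^ 4 - 26 * y ^ 3 + 131 * y ^ 2 + 60 * k * y - 346 * y - 120 * k + 360) / 504 + b * (4 * y
      ^ 2 - 105 * y + 15 * k + 449) / 126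

/-- The structure constant with indices `(5, 6)`, see `solN`. -/
def solN5_6 (k y a b : ℝ) : ℝ :=
  a * (-y ^ 4 + 26 * y ^ 3 - 131 * y ^ 2 - 60 * k * y + 346 * y + 120 * k - 360) / 252 + b * (13 *
      y ^ 2 - 105 * y - 30 * k + 278) / 126

/-- The structure constant with indices `(3, 9)`, see `solN`. -/
def solN3_9 (k y a b : ℝ) : ℝ :=
  a * (-y ^ 5 + 35 * y ^ 4 - 505 * y ^ 3 + 10 * k * y ^ 2 + 3625 * y ^ 2 - 110 * k * y - 12574 * y
      + 180 * k + 17100) / 840 + b * (y ^ 3 - 30 * y ^ 2 + 2 * k * y + 275 * y - 18 * k - 774) /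
      168

/-- The structure constant with indices `(4, 8)`, see `solN`. -/
def solN4_8 (k y a b : ℝ) : ℝ :=
  a * (-y ^ 5 + 35 * y ^ 4 - 365 * y ^ 3 - 60 * k * y ^ 2 + 1525 * y ^ 2 + 660 * k * y - 3474 * y
      - 1080 * k + 3240) / 1260 + b * (y ^ 3 + 12 * y ^ 2 - 12 * k * y - 313 * y + 108 * k + 1116)
      / 252

/-- The structure constant with indices `(5, 7)`, see `solN`. -/
def solN5_7 (k y a b : ℝ) : ℝ :=
  a * (y ^ 5 - 35 * y ^ 4 + 365 * y ^ 3 + 60 * k * y ^ 2 - 1525 * y ^ 2 - 660 * k * y + 3474 * y +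
      1080 * k - 3240) / 1008 + b * (-13 * y ^ 3 + 222 * y ^ 2 + 30 * k * y - 1223 * y - 270 * k +
      2502) / 504

/-- The structure constant with indices `(3, 10)`, see `solN`. -/
def solN3_10 (k y a b : ℝ) : ℝ :=
  a * (49 * y ^ 6 - 2190 * y ^ 5 - 5 * k * y ^ 4 + 42530 * y ^ 4 - 920 * k * y ^ 3 - 447590 * y ^
      3 + 21665 * k * y ^ 2 - 300 * k ^ 2 * y + 2604201 * y ^ 2 - 135760 * k * y + 600 * k ^ 2 -
      7757980 * y + 192300 * k + 9396900) / 332640 + b * (-21 * y ^ 4 + 990 * y ^ 3 - 92 * k * y ^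
      2 - 16049 * y ^ 2 + 1980 * k * y - 30 * k ^ 2 + 105930 * y - 9616 * k - 241594) / 33264

/-- The structure constant with indices `(4, 9)`, see `solN`. -/
def solN4_9 (k y a b : ℝ) : ℝ :=
  a * (53 * y ^ 6 - 2490 * y ^ 5 + 35 * k * y ^ 4 + 40870 * y ^ 4 + 2480 * k * y ^ 3 - 302170 * y
      ^ 3 - 68495 * k * y ^ 2 + 2100 * k ^ 2 * y + 1104897 * y ^ 2 + 443440 * k * y - 4200 * k ^ 2
      - 2258780 * y - 633300 * k + 1937700) / 332640 + b * (-51 * y ^ 4 + 990 * y ^ 3 + 248 * k *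
      y ^ 2 - 1507 * y ^ 2 - 6336 * k * y + 210 * k ^ 2 - 43758 * y + 31672 * k + 158638) / 33264

/-- The structure constant with indices `(5, 8)`, see `solN`. -/
def solN5_8 (k y a b : ℝ) : ℝ :=
  a * (-9 * y ^ 6 + 510 * y ^ 5 - 35 * k * y ^ 4 - 9410 * y ^ 4 + 160 * k * y ^ 3 + 74470 * y ^ 3
      + 13055 * k * y ^ 2 - 2100 * k ^ 2 * y - 281041 * y ^ 2 - 105520 * k * y + 4200 * k ^ 2 +
      587660 * y + 158100 * k - 512100) / 110880 + b * (29 * y ^ 4 - 1034 * y ^ 3 + 16 * k * y ^ 2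
      + 11033 * y ^ 2 + 1320 * k * y - 210 * k ^ 2 - 49654 * y - 7912 * k + 86882) / 11088

/-- The structure constant with indices `(6, 7)`, see `solN`. -/
def solN6_7 (k y a b : ℝ) : ℝ :=
  a * (-13 * y ^ 6 + 480 * y ^ 5 + 35 * k * y ^ 4 - 6320 * y ^ 4 - 1480 * k * y ^ 3 + 39380 * y ^
      3 + 14665 * k * y ^ 2 + 2100 * k ^ 2 * y - 130887 * y ^ 2 - 63440 * k * y - 4200 * k ^ 2 +
      247900 * y + 79500 * k - 200700) / 66528 + b * (141 * y ^ 4 - 2574 * y ^ 3 - 740 * k * y ^ 2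
      + 20581 * y ^ 2 + 5940 * k * y + 1050 * k ^ 2 - 75834 * y - 19840 * k + 116030) / 33264

/-- The structure constant with indices `(3, 11)`, see `solN`. -/
def solN3_11 (k y a b : ℝ) : ℝ :=
  a * (-21 * y ^ 7 + 1146 * y ^ 6 + 10 * k * y ^ 5 - 28190 * y ^ 5 + 410 * k * y ^ 4 + 399080 * y
      ^ 4 - 21330 * k * y ^ 3 + 600 * k ^ 2 * y ^ 2 - 3409209 * y ^ 3 + 274270 * k * y ^ 2 - 7800
      * k ^ 2 * y + 17030374 * y ^ 2 - 1275160 * k * y + 13200 * k ^ 2 - 45164980 * y + 1617000 *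
      k + 49915800) / 1330560 + b * (17 * y ^ 5 - 1155 * y ^ 4 + 130 * k * y ^ 3 + 29205 * y ^ 3 -
      5060 * k * y ^ 2 + 150 * k ^ 2 * y - 338195 * y ^ 2 + 58310 * k * y - 1650 * k ^ 2 + 1793698
      * y - 202180 * k - 3508450) / 332640

/-- The structure constant with indices `(4, 10)`, see `solN`. -/
def solN4_10 (k y a b : ℝ) : ℝ :=
  a * (-7 * y ^ 7 + 437 * y ^ 6 - 15 * k * y ^ 5 - 10240 * y ^ 5 + 45 * k * y ^ 4 + 117260 * y ^ 4
      + 10875 * k * y ^ 3 - 900 * k ^ 2 * y ^ 2 - 709273 * y ^ 3 - 174465 * k * y ^ 2 + 11700 * k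
      ^ 2 * y + 2343443 * y ^ 2 + 864660 * k * y - 19800 * k ^ 2 - 4404720 * y - 1118700 * k +
      3534300) / 332640 + b * (37 * y ^ 5 - 1485 * y ^ 4 - 60 * k * y ^ 3 + 17875 * y ^ 3 + 5280 *
      k * y ^ 2 - 450 * k ^ 2 * y - 59565 * y ^ 2 - 76260 * k * y + 4950 * k ^ 2 - 140672 * y +
      279840 * k + 746130) / 166320

/-- The structure constant with indices `(5, 9)`, see `solN`. -/
def solN5_9 (k y a b : ℝ) : ℝ :=
  a * (-2 * y ^ 7 + 7 * y ^ 6 + 35 * k * y ^ 5 + 1710 * y ^ 5 - 1205 * k * y ^ 4 - 34540 * y ^ 4 +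
      9825 * k * y ^ 3 + 2100 * k ^ 2 * y ^ 2 + 268072 * y ^ 3 + 12185 * k * y ^ 2 - 27300 * k ^ 2
      * y - 995727 * y ^ 2 - 270740 * k * y + 46200 * k ^ 2 + 2024380 * y + 432300 * k - 1712700)
      / 332640 + b * (-y ^ 5 + 660 * y ^ 4 - 205 * k * y ^ 3 - 15785 * y ^ 3 + 2090 * k * y ^ 2 +
      525 * k ^ 2 * y + 138215 * y ^ 2 + 6745 * k * y - 5775 * k ^ 2 - 553794 * y - 54230 * k +
      875545) / 83160

/-- The structure constant with indices `(6, 8)`, see `solN`. -/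
def solN6_8 (k y a b : ℝ) : ℝ :=
  a * (13 * y ^ 7 - 623 * y ^ 6 - 35 * k * y ^ 5 + 11600 * y ^ 5 + 1865 * k * y ^ 4 - 108900 * y ^
      4 - 30945 * k * y ^ 3 - 2100 * k ^ 2 * y ^ 2 + 564067 * y ^ 3 + 224755 * k * y ^ 2 + 27300 *
      k ^ 2 * y - 1687657 * y ^ 2 - 777340 * k * y - 46200 * k ^ 2 + 2927600 * y + 874500 * k -
      2207700) / 332640 + b * (-141 * y ^ 5 + 4125 * y ^ 4 + 740 * k * y ^ 3 - 48895 * y ^ 3 -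
      14080 * k * y ^ 2 - 1050 * k ^ 2 * y + 302225 * y ^ 2 + 85180 * k * y + 11550 * k ^ 2 -
      950204 * y - 218240 * k + 1276330) / 166320

/-- The structure constant with indices `(3, 12)`, see `solN`. -/
def solN3_12 (k y a b : ℝ) : ℝ :=
  a * (146 * y ^ 8 - 9364 * y ^ 7 - 188 * k * y ^ 6 + 277237 * y ^ 6 + 1188 * k * y ^ 5 - 35 * k ^
      2 * y ^ 4 - 4940332 * y ^ 5 + 202660 * k * y ^ 4 - 10580 * k ^ 2 * y ^ 3 + 56717664 * y ^ 4
      - 5082360 * k * y ^ 3 + 285215 * k ^ 2 * y ^ 2 - 2100 * k ^ 3 * y - 415954316 * y ^ 3 +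
      47122768 * k * y ^ 2 - 2033260 * k ^ 2 * y + 4200 * k ^ 3 + 1847159013 * y ^ 2 - 180028908 *
      k * y + 3010860 * k ^ 2 - 4464822548 * y + 208957080 * k + 4578344820) / 95135040 + b *
      (-173 * y ^ 6 + 14676 * y ^ 5 - 1605 * k * y ^ 4 - 528680 * y ^ 4 + 110190 * k * y ^ 3 -
      5290 * k ^ 2 * y ^ 2 + 9487170 * y ^ 3 - 2309805 * k * y ^ 2 + 131940 * k ^ 2 * y - 1050 * k
      ^ 3 - 87667297 * y ^ 2 + 18879450 * k * y - 752750 * k ^ 2 + 395954634 * y - 52264350 * k -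
      687538810) / 47567520

/-- The structure constant with indices `(4, 11)`, see `solN`. -/
def solN4_11 (k y a b : ℝ) : ℝ :=
  a * (375 * y ^ 8 - 31362 * y ^ 7 + 1954 * k * y ^ 6 + 1007440 * y ^ 6 - 62854 * k * y ^ 5 + 630
      * k ^ 2 * y ^ 4 - 16516504 * y ^ 5 + 105870 * k * y ^ 4 + 104640 * k ^ 2 * y ^ 3 + 151420215
      * y ^ 4 + 15659590 * k * y ^ 3 - 2988870 * k ^ 2 * y ^ 2 + 37800 * k ^ 3 * y - 798368438 * y
      ^ 3 - 195214624 * k * y ^ 2 + 21326280 * k ^ 2 * y - 75600 * k ^ 3 + 2433851690 * y ^ 2 +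
      821114784 * k * y - 31544280 * k ^ 2 - 4274259216 * y - 986455440 * k + 3245306040) /
      190270080 + b * (-874 * y ^ 6 + 62253 * y ^ 5 - 4145 * k * y ^ 4 - 1400175 * y ^ 4 - 45050 *
      k * y ^ 3 + 26160 * k ^ 2 * y ^ 2 + 13093135 * y ^ 3 + 3766955 * k * y ^ 2 - 694110 * k ^ 2
      * y + 9450 * k ^ 3 - 47835761 * y ^ 2 - 40943350 * k * y + 3943350 * k ^ 2 + 16102412 * y +
      123438270 * k + 167349090) / 47567520

/-- The structure constant with indices `(5, 10)`, see `solN`. -/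
def solN5_10 (k y a b : ℝ) : ℝ :=
  a * (251 * y ^ 8 - 11779 * y ^ 7 - 1763 * k * y ^ 6 + 199332 * y ^ 6 + 93533 * k * y ^ 5 - 1260
      * k ^ 2 * y ^ 4 - 1307012 * y ^ 5 - 1689645 * k * y ^ 4 - 80580 * k ^ 2 * y ^ 3 - 196231 * y
      ^ 4 + 12290815 * k * y ^ 3 + 2760240 * k ^ 2 * y ^ 2 - 75600 * k ^ 3 * y + 44512059 * y ^ 3
      - 32599072 * k * y ^ 2 - 19743960 * k ^ 2 * y + 151200 * k ^ 3 - 216480232 * y ^ 2 + 1501092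
      * k * y + 29111760 * k ^ 2 + 484614012 * y + 53221680 * k - 425753280) / 95135040 + b *
      (-359 * y ^ 6 + 5367 * y ^ 5 + 5032 * k * y ^ 4 + 99263 * y ^ 4 - 135560 * k * y ^ 3 - 8058
      * k ^ 2 * y ^ 2 - 2636249 * y ^ 3 + 979568 * k * y ^ 2 + 259278 * k ^ 2 * y - 7560 * k ^ 3 +
      21849120 * y ^ 2 - 1421176 * k * y - 1455840 * k ^ 2 - 82499878 * y - 2709528 * k +
      122192544) / 9513504

/-- The structure constant with indices `(6, 9)`, see `solN`. -/
def solN6_9 (k y a b : ℝ) : ℝ :=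
  a * (-395 * y ^ 8 + 24529 * y ^ 7 + 777 * k * y ^ 6 - 620120 * y ^ 6 - 63327 * k * y ^ 5 + 2940
      * k ^ 2 * y ^ 4 + 8298748 * y ^ 5 + 1627335 * k * y ^ 4 - 12180 * k ^ 2 * y ^ 3 - 64612085 *
      y ^ 4 - 18600405 * k * y ^ 3 - 1435560 * k ^ 2 * y ^ 2 + 176400 * k ^ 3 * y + 297738871 * y
      ^ 3 + 115814688 * k * y ^ 2 + 10433640 * k ^ 2 * y - 352800 * k ^ 3 - 826982040 * y ^ 2 -
      354441708 * k * y - 15074640 * k ^ 2 + 1348402092 * y + 370367280 * k - 965904480) /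
      95135040 + b * (4379 * y ^ 6 - 190743 * y ^ 5 - 19620 * k * y ^ 4 + 3361685 * y ^ 4 + 714000
      * k * y ^ 3 - 6090 * k ^ 2 * y ^ 2 - 31712835 * y ^ 3 - 7932420 * k * y ^ 2 - 722610 * k ^ 2
      * y + 88200 * k ^ 3 + 166919576 * y ^ 2 + 42352800 * k * y + 3771600 * k ^ 2 - 471519342 * y
      - 92467080 * k + 577667280) / 47567520

/-- The structure constant with indices `(7, 8)`, see `solN`. -/
def solN7_8 (k y a b : ℝ) : ℝ :=
  a * (-337 * y ^ 8 + 18905 * y ^ 7 + 1337 * k * y ^ 6 - 433754 * y ^ 6 - 68387 * k * y ^ 5 - 4410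
      * k ^ 2 * y ^ 4 + 5291028 * y ^ 5 + 1371735 * k * y ^ 4 + 168420 * k ^ 2 * y ^ 3 - 36848863
      * y ^ 4 - 14720185 * k * y ^ 3 - 1600410 * k ^ 2 * y ^ 2 - 264600 * k ^ 3 * y + 158028655 *
      y ^ 3 + 74697568 * k * y ^ 2 + 11076240 * k ^ 2 * y + 529200 * k ^ 3 - 416860046 * y ^ 2 -
      197821908 * k * y - 17027640 * k ^ 2 + 647128212 * y + 194770080 * k - 445349880) / 95135040
      + b * (3513 * y ^ 6 - 129801 * y ^ 5 - 23480 * k * y ^ 4 + 1992715 * y ^ 4 + 570640 * k * y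
      ^ 3 + 84210 * k ^ 2 * y ^ 2 - 15991745 * y ^ 3 - 6272380 * k * y ^ 2 - 642810 * k ^ 2 * y -
      132300 * k ^ 3 + 76869272 * y ^ 2 + 25159400 * k * y + 4252500 * k ^ 2 - 199253614 * y -
      48549300 * k + 228590220) / 47567520

/-- The structure constant with indices `(3, 13)`, see `solN`. -/
def solN3_13 (k y a b : ℝ) : ℝ :=
  a * (-161 * y ^ 9 + 11802 * y ^ 8 + 413 * k * y ^ 7 - 403111 * y ^ 7 - 14356 * k * y ^ 6 + 210 *
      k ^ 2 * y ^ 5 + 8538650 * y ^ 6 - 52798 * k * y ^ 5 + 17850 * k ^ 2 * y ^ 4 - 122739427 * y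
      ^ 5 + 8812760 * k * y ^ 4 - 906330 * k ^ 2 * y ^ 3 + 12600 * k ^ 3 * y ^ 2 + 1208102078 * y
      ^ 4 - 153430483 * k * y ^ 3 + 12867630 * k ^ 2 * y ^ 2 - 189000 * k ^ 3 * y - 7868370329 * y
      ^ 3 + 1145460956 * k * y ^ 2 - 66063240 * k ^ 2 * y + 327600 * k ^ 3 + 31784287910 * y ^ 2 -
      3792950892 * k * y + 87614280 * k ^ 2 - 71180196732 * y + 4093053120 * k + 68549331240) /
      1141620480 + b * (90 * y ^ 7 - 7017 * y ^ 6 + 239 * k * y ^ 5 + 306125 * y ^ 5 - 58545 * k *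
      y ^ 4 + 5145 * k ^ 2 * y ^ 3 - 7741590 * y ^ 4 + 2249285 * k * y ^ 3 - 216030 * k ^ 2 * y ^
      2 + 3150 * k ^ 3 * y + 110168210 * y ^ 3 - 33627765 * k * y ^ 2 + 2781435 * k ^ 2 * y -
      40950 * k ^ 3 - 861461943 * y ^ 2 + 218213396 * k * y - 10953150 * k ^ 2 + 3433099895 * y -
      511996290 * k - 5414953050) / 285405120

/-- The structure constant with indices `(4, 12)`, see `solN`. -/
def solN4_12 (k y a b : ℝ) : ℝ :=
  a * (-71 * y ^ 9 + 8562 * y ^ 8 - 937 * k * y ^ 7 - 378259 * y ^ 7 + 49988 * k * y ^ 6 - 840 * k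
      ^ 2 * y ^ 5 + 8573228 * y ^ 6 - 859306 * k * y ^ 5 - 28500 * k ^ 2 * y ^ 4 - 111954745 * y ^
      5 + 2237840 * k * y ^ 4 + 1995120 * k ^ 2 * y ^ 3 - 50400 * k ^ 3 * y ^ 2 + 879193298 * y ^
      4 + 87991727 * k * y ^ 3 - 29891820 * k ^ 2 * y ^ 2 + 756000 * k ^ 3 * y - 4185539081 * y ^
      3 - 971555428 * k * y ^ 2 + 153656760 * k ^ 2 * y - 1310400 * k ^ 3 + 11945898752 * y ^ 2 +
      3668757156 * k * y - 203224320 * k ^ 2 - 19825244004 * y - 4166613360 * k + 14364239760) /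
      570810240 + b * (69 * y ^ 7 - 15690 * y ^ 6 + 3620 * k * y ^ 5 + 627779 * y ^ 5 - 100440 * k
      * y ^ 4 - 9855 * k ^ 2 * y ^ 3 - 10372080 * y ^ 4 - 19600 * k * y ^ 3 + 478020 * k ^ 2 * y ^
      2 - 12600 * k ^ 3 * y + 82160471 * y ^ 3 + 21418080 * k * y ^ 2 - 6503265 * k ^ 2 * y +
      163800 * k ^ 3 - 299578770 * y ^ 2 - 197975380 * k * y + 25408500 * k ^ 2 + 339347681 * y +
      521671800 * k + 260751660) / 142702560

/-- The structure constant with indices `(5, 11)`, see `solN`. -/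
def solN5_11 (k y a b : ℝ) : ℝ :=
  a * (-162 * y ^ 9 + 10551 * y ^ 8 + 857 * k * y ^ 7 - 280369 * y ^ 7 - 61708 * k * y ^ 6 + 1890
      * k ^ 2 * y ^ 5 + 3893540 * y ^ 6 + 1654946 * k * y ^ 5 - 10950 * k ^ 2 * y ^ 4 - 30270532 *
      y ^ 5 - 20996800 * k * y ^ 4 - 1636170 * k ^ 2 * y ^ 3 + 113400 * k ^ 3 * y ^ 2 + 129251339
      * y ^ 4 + 134814113 * k * y ^ 3 + 29493870 * k ^ 2 * y ^ 2 - 1701000 * k ^ 3 * y - 256024141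
      * y ^ 3 - 444238612 * k * y ^ 2 - 152184360 * k ^ 2 * y + 2948400 * k ^ 3 + 76634930 * y ^ 2
      + 654676164 * k * y + 199597320 * k ^ 2 + 665056164 * y - 324080640 * k - 903740760) /
      380540160 + b * (667 * y ^ 7 - 26545 * y ^ 6 - 6715 * k * y ^ 5 + 326127 * y ^ 5 + 292485 *
      k * y ^ 4 + 3405 * k ^ 2 * y ^ 3 - 179170 * y ^ 4 - 4293805 * k * y ^ 3 - 399870 * k ^ 2 * y
      ^ 2 + 28350 * k ^ 3 * y - 28434897 * y ^ 3 + 25659525 * k * y ^ 2 + 6543015 * k ^ 2 * y -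
      368550 * k ^ 3 + 260769005 * y ^ 2 - 61775680 * k * y - 24961950 * k ^ 2 - 976060777 * y +
      39682110 * k + 1393283190) / 95135040

/-- The structure constant with indices `(6, 10)`, see `solN`. -/
def solN6_10 (k y a b : ℝ) : ℝ :=
  a * (73 * y ^ 9 - 6060 * y ^ 8 + 49 * k * y ^ 7 + 208279 * y ^ 7 + 6964 * k * y ^ 6 - 2520 * k ^
      2 * y ^ 5 - 3888752 * y ^ 6 - 404318 * k * y ^ 5 + 86100 * k ^ 2 * y ^ 4 + 43746139 * y ^ 5
      + 7737400 * k * y ^ 4 - 535440 * k ^ 2 * y ^ 3 - 151200 * k ^ 3 * y ^ 2 - 305565740 * y ^ 4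
      - 77248559 * k * y ^ 3 - 3360660 * k ^ 2 * y ^ 2 + 2268000 * k ^ 3 * y + 1307185281 * y ^ 3
      + 463188196 * k * y ^ 2 + 18585480 * k ^ 2 * y - 3931200 * k ^ 3 - 3452126888 * y ^ 2 -
      1343059812 * k * y - 20741760 * k ^ 2 + 5395623108 * y + 1340043120 * k - 3727311120) /
      285405120 + b * (-873 * y ^ 7 + 56010 * y ^ 6 + 1700 * k * y ^ 5 - 1451968 * y ^ 5 - 165060
      * k * y ^ 4 + 26670 * k ^ 2 * y ^ 3 + 20350020 * y ^ 4 + 3465980 * k * y ^ 3 - 220680 * k ^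
      2 * y ^ 2 - 75600 * k ^ 3 * y - 166862197 * y ^ 3 - 31860300 * k * y ^ 2 - 2039790 * k ^ 2 *
      y + 982800 * k ^ 3 + 789616170 * y ^ 2 + 168273920 * k * y + 5218200 * k ^ 2 - 2069211682 *
      y - 334847760 * k + 2369382600) / 142702560

/-- The structure constant with indices `(7, 9)`, see `solN`. -/
def solN7_9 (k y a b : ℝ) : ℝ :=
  a * (337 * y ^ 9 - 23286 * y ^ 8 - 1337 * k * y ^ 7 + 679519 * y ^ 7 + 85768 * k * y ^ 6 + 4410
      * k ^ 2 * y ^ 5 - 10929830 * y ^ 6 - 2260766 * k * y ^ 5 - 225750 * k ^ 2 * y ^ 4 +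
      105632227 * y ^ 5 + 32552740 * k * y ^ 4 + 3789870 * k ^ 2 * y ^ 3 + 264600 * k ^ 3 * y ^ 2
      - 637063874 * y ^ 4 - 266059973 * k * y ^ 3 - 31881570 * k ^ 2 * y ^ 2 - 3969000 * k ^ 3 * y
      + 2471232561 * y ^ 3 + 1168890292 * k * y ^ 2 + 161018760 * k ^ 2 * y + 6879600 * k ^ 3 -
      6066308810 * y ^ 2 - 2766454884 * k * y - 221359320 * k ^ 2 + 8858016636 * y + 2532011040 *
      k - 5789548440) / 570810240 + b * (-3513 * y ^ 7 + 175470 * y ^ 6 + 23480 * k * y ^ 5 -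
      3680128 * y ^ 5 - 875880 * k * y ^ 4 - 84210 * k ^ 2 * y ^ 3 + 41897040 * y ^ 4 + 13690700 *
      k * y ^ 3 + 1737540 * k ^ 2 * y ^ 2 + 132300 * k ^ 3 * y - 284761957 * y ^ 3 - 106700340 * k
      * y ^ 2 - 12609030 * k ^ 2 * y - 1719900 * k ^ 3 + 1198554150 * y ^ 2 + 375621500 * k * y +
      55282500 * k ^ 2 - 2818887202 * y - 631140900 * k + 2971672860) / 285405120

/-- The structure constants, in degrees `i + j ≤ 16`, of the cochain vanishing on `sl(2)` with
`N 3 4 = a` and `N 4 5 = b`. -/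
def solN (k y a b : ℝ) : ℕ → ℕ → ℝ
  | 3, 4 => solN3_4 k y a b
  | 3, 5 => solN3_5 k y a b
  | 3, 6 => solN3_6 k y a b
  | 4, 5 => solN4_5 k y a b
  | 3, 7 => solN3_7 k y a b
  | 4, 6 => solN4_6 k y a b
  | 3, 8 => solN3_8 k y a b
  | 4, 7 => solN4_7 k y a b
  | 5, 6 => solN5_6 k y a b
  | 3, 9 => solN3_9 k y a b
  | 4, 8 => solN4_8 k y a b
  | 5, 7 => solN5_7 k y a b
  | 3, 10 => solN3_10 k y a b
  | 4, 9 => solN4_9 k y a b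
  | 5, 8 => solN5_8 k y a b
  | 6, 7 => solN6_7 k y a b
  | 3, 11 => solN3_11 k y a b
  | 4, 10 => solN4_10 k y a b
  | 5, 9 => solN5_9 k y a b
  | 6, 8 => solN6_8 k y a b
  | 3, 12 => solN3_12 k y a b
  | 4, 11 => solN4_11 k y a b
  | 5, 10 => solN5_10 k y a b
  | 6, 9 => solN6_9 k y a b
  | 7, 8 => solN7_8 k y a b
  | 3, 13 => solN3_13 k y a b
  | 4, 12 => solN4_12 k y a b
  | 5, 11 => solN5_11 k y a b
  | 6, 10 => solN6_10 k y a b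
  | 7, 9 => solN7_9 k y a b
  | _, _ => 0

/-- `N` satisfies the equations for the structure constants, in degrees at most `S`, of a
homogeneous cocycle vanishing on `sl(2)`, in terms of `y = 2 lam + k - 1`. -/
structure IsSol (k y : ℝ) (S : ℕ) (N : ℕ → ℕ → ℝ) : Prop where
  swap : ∀ i j, N j i = -N i j
  step : ∀ i j, 3 ≤ i → 3 ≤ j → i + j + 1 ≤ S →
    ((i : ℝ) - 2) * N (i + 1) j + ((j : ℝ) - 2) * N i (j + 1) + (y + 2 - i - j) * N i j = 0
  triple : ∀ i j m, 3 ≤ i → i < j → j < m → i + j + m ≤ S + 1 →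
    tripleRel ((y + 1 - k) / 2) N i j m (k + 3 - i - j - m) = 0

variable {k y : ℝ} {S : ℕ} {N : ℕ → ℕ → ℝ}

theorem IsSol.self (h : IsSol k y S N) (i : ℕ) : N i i = 0 := by linarith [h.swap i i]

/-- This and the next lemmas solve the system degree by degree. In even degree the step equations
form a triangular system, started at the middle pair because `N i i = 0`. In odd degree there is one
unknown more than step equations: it stays free in degrees 7 and 9, as `N 3 4` and `N 4 5`, and is
fixed by the triple (3, 4, m) with m = 5, 7, 9 in degrees 11, 13, 15. -/
theorem IsSol.eq_solN_8 (h : IsSol k y S N) (hS : 8 ≤ S) :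
      N 3 5 = solN3_5 k y (N 3 4) (N 4 5) := by
  have e3_4 : 2 * N 3 5 + (y - 5) * N 3 4 = 0 := by
    have e := h.step 3 4 (by omega) (by omega) (by omega)
    push_cast at e
    linear_combination e - 1 * h.self 4
  have h3_5 : N 3 5 = solN3_5 k y (N 3 4) (N 4 5) := by
    simp only [solN3_5] at *
    linear_combination (e3_4) / 2
  exact h3_5

theorem IsSol.eq_solN_9 (h : IsSol k y S N) (hS : 9 ≤ S) :
      N 3 6 = solN3_6 k y (N 3 4) (N 4 5) := by
  have h3_5 := h.eq_solN_8 (by omega)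
  have e3_5 : N 4 5 + 3 * N 3 6 + (y - 6) * N 3 5 = 0 := by
    have e := h.step 3 5 (by omega) (by omega) (by omega)
    push_cast at e
    linear_combination e
  have h3_6 : N 3 6 = solN3_6 k y (N 3 4) (N 4 5) := by
    simp only [solN3_6, solN3_5] at *
    linear_combination (e3_5 - (y - 6) * h3_5) / 3
  exact h3_6

theorem IsSol.eq_solN_10 (h : IsSol k y S N) (hS : 10 ≤ S) :
      N 4 6 = solN4_6 k y (N 3 4) (N 4 5) ∧
      N 3 7 = solN3_7 k y (N 3 4) (N 4 5) := by
  have h3_6 := h.eq_solN_9 (by omega)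
  have e4_5 : 3 * N 4 6 + (y - 7) * N 4 5 = 0 := by
    have e := h.step 4 5 (by omega) (by omega) (by omega)
    push_cast at e
    linear_combination e - 2 * h.self 5
  have e3_6 : N 4 6 + 4 * N 3 7 + (y - 7) * N 3 6 = 0 := by
    have e := h.step 3 6 (by omega) (by omega) (by omega)
    push_cast at e
    linear_combination e
  have h4_6 : N 4 6 = solN4_6 k y (N 3 4) (N 4 5) := by
    simp only [solN4_6] at *
    linear_combination (e4_5) / 3
  have h3_7 : N 3 7 = solN3_7 k y (N 3 4) (N 4 5) := by
    simp only [solN3_7, solN4_6, solN3_6] at *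
    linear_combination (e3_6 - 1 * h4_6 - (y - 7) * h3_6) / 4
  exact ⟨h4_6, h3_7⟩

theorem IsSol.eq_solN_11 (h : IsSol k y S N) (hS : 11 ≤ S) :
      N 5 6 = solN5_6 k y (N 3 4) (N 4 5) ∧
      N 4 7 = solN4_7 k y (N 3 4) (N 4 5) ∧
      N 3 8 = solN3_8 k y (N 3 4) (N 4 5) := by
  have h3_5 := h.eq_solN_8 (by omega)
  obtain ⟨h4_6, h3_7⟩ := h.eq_solN_10 (by omega)
  have t3_4_5 : (-3 * y + k + 15) / 2 * N 4 5 + (2 * y - k - 7) * N 3 5 + (-5 * y + 3 * k + 13) /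
      2 * N 3 4 + N 5 6 - 2 * N 4 7 + N 3 8 = 0 := by
    have e := h.triple 3 4 5 (by omega) (by omega) (by omega) (by omega)
    simp only [tripleRel] at e
    norm_num at e
    linear_combination e + h.swap 5 6 - 2 * h.swap 4 7 + h.swap 3 8
  have e4_6 : 2 * N 5 6 + 4 * N 4 7 + (y - 8) * N 4 6 = 0 := by
    have e := h.step 4 6 (by omega) (by omega) (by omega)
    push_cast at e
    linear_combination e
  have e3_7 : N 4 7 + 5 * N 3 8 + (y - 8) * N 3 7 = 0 := by
    have e := h.step 3 7 (by omega) (by omega) (by omega)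
    push_cast at e
    linear_combination e
  have h5_6 : N 5 6 = solN5_6 k y (N 3 4) (N 4 5) := by
    simp only [solN5_6, solN3_5, solN3_7, solN4_6] at *
    -- The multiples of `e3_7` and `e4_6` cancel `N 3 8` and `N 4 7` against `t3_4_5`, which leaves
    -- 21/10 of `N 5 6`. Degrees 13 and 15 use the same elimination.
    linear_combination (t3_4_5 - 1 / 5 * e3_7 + 11 / 20 * e4_6 - (2 * y - k - 7) * h3_5 - (-y + 8)
        / 5 * h3_7 - (11 * y - 88) / 20 * h4_6) * (10 / 21)
  have h4_7 : N 4 7 = solN4_7 k y (N 3 4) (N 4 5) := by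
    simp only [solN4_7, solN5_6, solN4_6] at *
    linear_combination (e4_6 - 2 * h5_6 - (y - 8) * h4_6) / 4
  have h3_8 : N 3 8 = solN3_8 k y (N 3 4) (N 4 5) := by
    simp only [solN3_8, solN4_7, solN3_7] at *
    linear_combination (e3_7 - 1 * h4_7 - (y - 8) * h3_7) / 5
  exact ⟨h5_6, h4_7, h3_8⟩

theorem IsSol.eq_solN_12 (h : IsSol k y S N) (hS : 12 ≤ S) :
      N 5 7 = solN5_7 k y (N 3 4) (N 4 5) ∧
      N 4 8 = solN4_8 k y (N 3 4) (N 4 5) ∧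
      N 3 9 = solN3_9 k y (N 3 4) (N 4 5) := by
  obtain ⟨h5_6, h4_7, h3_8⟩ := h.eq_solN_11 (by omega)
  have e5_6 : 4 * N 5 7 + (y - 9) * N 5 6 = 0 := by
    have e := h.step 5 6 (by omega) (by omega) (by omega)
    push_cast at e
    linear_combination e - 3 * h.self 6
  have e4_7 : 2 * N 5 7 + 5 * N 4 8 + (y - 9) * N 4 7 = 0 := by
    have e := h.step 4 7 (by omega) (by omega) (by omega)
    push_cast at e
    linear_combination e
  have e3_8 : N 4 8 + 6 * N 3 9 + (y - 9) * N 3 8 = 0 := by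
    have e := h.step 3 8 (by omega) (by omega) (by omega)
    push_cast at e
    linear_combination e
  have h5_7 : N 5 7 = solN5_7 k y (N 3 4) (N 4 5) := by
    simp only [solN5_7, solN5_6] at *
    linear_combination (e5_6 - (y - 9) * h5_6) / 4
  have h4_8 : N 4 8 = solN4_8 k y (N 3 4) (N 4 5) := by
    simp only [solN4_8, solN5_7, solN4_7] at *
    linear_combination (e4_7 - 2 * h5_7 - (y - 9) * h4_7) / 5
  have h3_9 : N 3 9 = solN3_9 k y (N 3 4) (N 4 5) := by
    simp only [solN3_9, solN4_8, solN3_8] at *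
    linear_combination (e3_8 - 1 * h4_8 - (y - 9) * h3_8) / 6
  exact ⟨h5_7, h4_8, h3_9⟩

theorem IsSol.eq_solN_13 (h : IsSol k y S N) (hS : 13 ≤ S) :
      N 6 7 = solN6_7 k y (N 3 4) (N 4 5) ∧
      N 5 8 = solN5_8 k y (N 3 4) (N 4 5) ∧
      N 4 9 = solN4_9 k y (N 3 4) (N 4 5) ∧
      N 3 10 = solN3_10 k y (N 3 4) (N 4 5) := by
  obtain ⟨-, h3_7⟩ := h.eq_solN_10 (by omega)
  obtain ⟨-, h4_7, -⟩ := h.eq_solN_11 (by omega)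
  obtain ⟨h5_7, h4_8, h3_9⟩ := h.eq_solN_12 (by omega)
  have t3_4_7 : (-3 * y + k + 19) / 2 * N 4 7 + (2 * y - k - 9) * N 3 7 + (-7 * y + 5 * k + 15) /
      2 * N 3 4 - N 6 7 - 4 * N 4 9 + 3 * N 3 10 = 0 := by
    have e := h.triple 3 4 7 (by omega) (by omega) (by omega) (by omega)
    simp only [tripleRel] at e
    norm_num at e
    linear_combination e - 4 * h.swap 4 9 + 3 * h.swap 3 10
  have e5_7 : 3 * N 6 7 + 5 * N 5 8 + (y - 10) * N 5 7 = 0 := by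
    have e := h.step 5 7 (by omega) (by omega) (by omega)
    push_cast at e
    linear_combination e
  have e4_8 : 2 * N 5 8 + 6 * N 4 9 + (y - 10) * N 4 8 = 0 := by
    have e := h.step 4 8 (by omega) (by omega) (by omega)
    push_cast at e
    linear_combination e
  have e3_9 : N 4 9 + 7 * N 3 10 + (y - 10) * N 3 9 = 0 := by
    have e := h.step 3 9 (by omega) (by omega) (by omega)
    push_cast at e
    linear_combination e
  have h6_7 : N 6 7 = solN6_7 k y (N 3 4) (N 4 5) := by
    simp only [solN6_7, solN4_7, solN3_7, solN3_9, solN4_8, solN5_7] at *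
    linear_combination (t3_4_7 - 3 / 7 * e3_9 + 31 / 42 * e4_8 - 31 / 105 * e5_7 - (-3 * y + k +
        19) / 2 * h4_7 - (2 * y - k - 9) * h3_7 - (-3 * y + 30) / 7 * h3_9 - (31 * y - 310) / 42 *
        h4_8 - (-31 * y + 310) / 105 * h5_7) * (-35 / 66)
  have h5_8 : N 5 8 = solN5_8 k y (N 3 4) (N 4 5) := by
    simp only [solN5_8, solN6_7, solN5_7] at *
    linear_combination (e5_7 - 3 * h6_7 - (y - 10) * h5_7) / 5
  have h4_9 : N 4 9 = solN4_9 k y (N 3 4) (N 4 5) := by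
    simp only [solN4_9, solN5_8, solN4_8] at *
    linear_combination (e4_8 - 2 * h5_8 - (y - 10) * h4_8) / 6
  have h3_10 : N 3 10 = solN3_10 k y (N 3 4) (N 4 5) := by
    simp only [solN3_10, solN4_9, solN3_9] at *
    linear_combination (e3_9 - 1 * h4_9 - (y - 10) * h3_9) / 7
  exact ⟨h6_7, h5_8, h4_9, h3_10⟩

theorem IsSol.eq_solN_14 (h : IsSol k y S N) (hS : 14 ≤ S) :
      N 6 8 = solN6_8 k y (N 3 4) (N 4 5) ∧
      N 5 9 = solN5_9 k y (N 3 4) (N 4 5) ∧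
      N 4 10 = solN4_10 k y (N 3 4) (N 4 5) ∧
      N 3 11 = solN3_11 k y (N 3 4) (N 4 5) := by
  obtain ⟨h6_7, h5_8, h4_9, h3_10⟩ := h.eq_solN_13 (by omega)
  have e6_7 : 5 * N 6 8 + (y - 11) * N 6 7 = 0 := by
    have e := h.step 6 7 (by omega) (by omega) (by omega)
    push_cast at e
    linear_combination e - 4 * h.self 7
  have e5_8 : 3 * N 6 8 + 6 * N 5 9 + (y - 11) * N 5 8 = 0 := by
    have e := h.step 5 8 (by omega) (by omega) (by omega)
    push_cast at e
    linear_combination e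
  have e4_9 : 2 * N 5 9 + 7 * N 4 10 + (y - 11) * N 4 9 = 0 := by
    have e := h.step 4 9 (by omega) (by omega) (by omega)
    push_cast at e
    linear_combination e
  have e3_10 : N 4 10 + 8 * N 3 11 + (y - 11) * N 3 10 = 0 := by
    have e := h.step 3 10 (by omega) (by omega) (by omega)
    push_cast at e
    linear_combination e
  have h6_8 : N 6 8 = solN6_8 k y (N 3 4) (N 4 5) := by
    simp only [solN6_8, solN6_7] at *
    linear_combination (e6_7 - (y - 11) * h6_7) / 5
  have h5_9 : N 5 9 = solN5_9 k y (N 3 4) (N 4 5) := by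
    simp only [solN5_9, solN6_8, solN5_8] at *
    linear_combination (e5_8 - 3 * h6_8 - (y - 11) * h5_8) / 6
  have h4_10 : N 4 10 = solN4_10 k y (N 3 4) (N 4 5) := by
    simp only [solN4_10, solN5_9, solN4_9] at *
    linear_combination (e4_9 - 2 * h5_9 - (y - 11) * h4_9) / 7
  have h3_11 : N 3 11 = solN3_11 k y (N 3 4) (N 4 5) := by
    simp only [solN3_11, solN4_10, solN3_10] at *
    linear_combination (e3_10 - 1 * h4_10 - (y - 11) * h3_10) / 8
  exact ⟨h6_8, h5_9, h4_10, h3_11⟩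

theorem IsSol.eq_solN_15 (h : IsSol k y S N) (hS : 15 ≤ S) :
      N 7 8 = solN7_8 k y (N 3 4) (N 4 5) ∧
      N 6 9 = solN6_9 k y (N 3 4) (N 4 5) ∧
      N 5 10 = solN5_10 k y (N 3 4) (N 4 5) ∧
      N 4 11 = solN4_11 k y (N 3 4) (N 4 5) ∧
      N 3 12 = solN3_12 k y (N 3 4) (N 4 5) := by
  obtain ⟨-, -, h3_9⟩ := h.eq_solN_12 (by omega)
  obtain ⟨-, -, h4_9, -⟩ := h.eq_solN_13 (by omega)
  obtain ⟨h6_8, h5_9, h4_10, h3_11⟩ := h.eq_solN_14 (by omega)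
  have t3_4_9 : (-3 * y + k + 23) / 2 * N 4 9 + (2 * y - k - 11) * N 3 9 + (-9 * y + 7 * k + 17) /
      2 * N 3 4 - N 6 9 - 6 * N 4 11 + 5 * N 3 12 = 0 := by
    have e := h.triple 3 4 9 (by omega) (by omega) (by omega) (by omega)
    simp only [tripleRel] at e
    norm_num at e
    linear_combination e - 6 * h.swap 4 11 + 5 * h.swap 3 12
  have e6_8 : 4 * N 7 8 + 6 * N 6 9 + (y - 12) * N 6 8 = 0 := by
    have e := h.step 6 8 (by omega) (by omega) (by omega)
    push_cast at e
    linear_combination e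
  have e5_9 : 3 * N 6 9 + 7 * N 5 10 + (y - 12) * N 5 9 = 0 := by
    have e := h.step 5 9 (by omega) (by omega) (by omega)
    push_cast at e
    linear_combination e
  have e4_10 : 2 * N 5 10 + 8 * N 4 11 + (y - 12) * N 4 10 = 0 := by
    have e := h.step 4 10 (by omega) (by omega) (by omega)
    push_cast at e
    linear_combination e
  have e3_11 : N 4 11 + 9 * N 3 12 + (y - 12) * N 3 11 = 0 := by
    have e := h.step 3 11 (by omega) (by omega) (by omega)
    push_cast at e
    linear_combination e
  have h7_8 : N 7 8 = solN7_8 k y (N 3 4) (N 4 5) := by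
    simp only [solN7_8, solN4_9, solN3_9, solN3_11, solN4_10, solN5_9, solN6_8] at *
    linear_combination (t3_4_9 - 5 / 9 * e3_11 + 59 / 72 * e4_10 - 59 / 252 * e5_9 + 143 / 504 *
        e6_8 - (-3 * y + k + 23) / 2 * h4_9 - (2 * y - k - 11) * h3_9 - (-5 * y + 60) / 9 * h3_11
        - (59 * y - 708) / 72 * h4_10 - (-59 * y + 708) / 252 * h5_9 - (143 * y - 1716) / 504 *
        h6_8) * (126 / 143)
  have h6_9 : N 6 9 = solN6_9 k y (N 3 4) (N 4 5) := by
    simp only [solN6_9, solN7_8, solN6_8] at *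
    linear_combination (e6_8 - 4 * h7_8 - (y - 12) * h6_8) / 6
  have h5_10 : N 5 10 = solN5_10 k y (N 3 4) (N 4 5) := by
    simp only [solN5_10, solN6_9, solN5_9] at *
    linear_combination (e5_9 - 3 * h6_9 - (y - 12) * h5_9) / 7
  have h4_11 : N 4 11 = solN4_11 k y (N 3 4) (N 4 5) := by
    simp only [solN4_11, solN5_10, solN4_10] at *
    linear_combination (e4_10 - 2 * h5_10 - (y - 12) * h4_10) / 8
  have h3_12 : N 3 12 = solN3_12 k y (N 3 4) (N 4 5) := by
    simp only [solN3_12, solN4_11, solN3_11] at *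
    linear_combination (e3_11 - 1 * h4_11 - (y - 12) * h3_11) / 9
  exact ⟨h7_8, h6_9, h5_10, h4_11, h3_12⟩

theorem IsSol.eq_solN_16 (h : IsSol k y S N) (hS : 16 ≤ S) :
      N 7 9 = solN7_9 k y (N 3 4) (N 4 5) ∧
      N 6 10 = solN6_10 k y (N 3 4) (N 4 5) ∧
      N 5 11 = solN5_11 k y (N 3 4) (N 4 5) ∧
      N 4 12 = solN4_12 k y (N 3 4) (N 4 5) ∧
      N 3 13 = solN3_13 k y (N 3 4) (N 4 5) := by
  obtain ⟨h7_8, h6_9, h5_10, h4_11, h3_12⟩ := h.eq_solN_15 (by omega)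
  have e7_8 : 6 * N 7 9 + (y - 13) * N 7 8 = 0 := by
    have e := h.step 7 8 (by omega) (by omega) (by omega)
    push_cast at e
    linear_combination e - 5 * h.self 8
  have e6_9 : 4 * N 7 9 + 7 * N 6 10 + (y - 13) * N 6 9 = 0 := by
    have e := h.step 6 9 (by omega) (by omega) (by omega)
    push_cast at e
    linear_combination e
  have e5_10 : 3 * N 6 10 + 8 * N 5 11 + (y - 13) * N 5 10 = 0 := by
    have e := h.step 5 10 (by omega) (by omega) (by omega)
    push_cast at e
    linear_combination e
  have e4_11 : 2 * N 5 11 + 9 * N 4 12 + (y - 13) * N 4 11 = 0 := by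
    have e := h.step 4 11 (by omega) (by omega) (by omega)
    push_cast at e
    linear_combination e
  have e3_12 : N 4 12 + 10 * N 3 13 + (y - 13) * N 3 12 = 0 := by
    have e := h.step 3 12 (by omega) (by omega) (by omega)
    push_cast at e
    linear_combination e
  have h7_9 : N 7 9 = solN7_9 k y (N 3 4) (N 4 5) := by
    simp only [solN7_9, solN7_8] at *
    linear_combination (e7_8 - (y - 13) * h7_8) / 6
  have h6_10 : N 6 10 = solN6_10 k y (N 3 4) (N 4 5) := by
    simp only [solN6_10, solN7_9, solN6_9] at *
    linear_combination (e6_9 - 4 * h7_9 - (y - 13) * h6_9) / 7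
  have h5_11 : N 5 11 = solN5_11 k y (N 3 4) (N 4 5) := by
    simp only [solN5_11, solN6_10, solN5_10] at *
    linear_combination (e5_10 - 3 * h6_10 - (y - 13) * h5_10) / 8
  have h4_12 : N 4 12 = solN4_12 k y (N 3 4) (N 4 5) := by
    simp only [solN4_12, solN5_11, solN4_11] at *
    linear_combination (e4_11 - 2 * h5_11 - (y - 13) * h4_11) / 9
  have h3_13 : N 3 13 = solN3_13 k y (N 3 4) (N 4 5) := by
    simp only [solN3_13, solN4_12, solN3_12] at *
    linear_combination (e3_12 - 1 * h4_12 - (y - 13) * h3_12) / 10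
  exact ⟨h7_9, h6_10, h5_11, h4_12, h3_13⟩

end VectCoh
end

/-! ### Obstructions in degrees 14 and 17; the universal solution satisfies the remaining equations
-/

noncomputable section
namespace VectCoh

/-- The polynomial whose vanishing is necessary for the existence of cocycles vanishing on `sl(2)`
that are not coboundaries when `12 ≤ k`. -/
def excPoly (k y : ℝ) : ℝ := y * (y ^ 2 - 12 * k + 23)

variable {k y : ℝ} {S : ℕ} {N : ℕ → ℕ → ℝ}

/-- The step equations already fix degree 14, so the triple (4, 5, 6) is a true condition on `N 3 4`
and `N 4 5`. It factors into `excPoly` and the linear form that vanishes on coboundaries. -/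
theorem IsSol.excPoly_mul (h : IsSol k y S N) (hS : 14 ≤ S) :
    excPoly k y * (20 * qPoly k y * N 4 5 - rPoly k y * N 3 4) = 0 := by
  obtain ⟨h4_6, -⟩ := h.eq_solN_10 (by omega)
  obtain ⟨h5_6, -, -⟩ := h.eq_solN_11 (by omega)
  obtain ⟨h6_8, h5_9, h4_10, -⟩ := h.eq_solN_14 (by omega)
  have t4_5_6 : (-2 * y + k + 10) * N 5 6 + (5 * y - 3 * k - 19) / 2 * N 4 6 + (-3 * y + 2 * k +
      9) * N 4 5 + N 6 8 - 2 * N 5 9 + N 4 10 = 0 := by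
    have e := h.triple 4 5 6 (by omega) (by omega) (by omega) (by omega)
    simp only [tripleRel] at e
    norm_num at e
    linear_combination e + h.swap 6 8 - 2 * h.swap 5 9 + h.swap 4 10
  rw [h5_6, h4_6, h6_8, h5_9, h4_10] at t4_5_6
  simp only [solN5_6, solN4_6, solN6_8, solN5_9, solN4_10] at t4_5_6
  simp only [excPoly, qPoly, rPoly]
  linear_combination -33264 * t4_5_6

/-- In degree 17 there are six unknowns, but five step equations and the triples (4, 5, 9) and (3,
4, 11). Eliminating the unknowns leaves one compatibility condition on lower degrees. -/
theorem IsSol.mul_eq_zero_of_three_four (h : IsSol k y S N) (hS : 17 ≤ S) (ha : N 3 4 = 0)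
    (hexc : excPoly k y = 0) :
    N 4 5 * qPoly k y * (9 * k ^ 2 * y ^ 2 - 117 * k * y ^ 2 + 35 * k ^ 3 + 303 * y ^ 2 - 105 * k
      ^ 2 - 35 * k + 105) = 0 := by
  obtain ⟨-, -, h4_9, -⟩ := h.eq_solN_13 (by omega)
  obtain ⟨-, h5_9, -, h3_11⟩ := h.eq_solN_14 (by omega)
  obtain ⟨-, -, -, h4_11, -⟩ := h.eq_solN_15 (by omega)
  obtain ⟨h7_9, h6_10, h5_11, h4_12, h3_13⟩ := h.eq_solN_16 (by omega)
  have t4_5_9 : (-2 * y + k + 13) * N 5 9 + (5 * y - 3 * k - 25) / 2 * N 4 9 + (-9 * y + 7 * k +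
      21) / 2 * N 4 5 - N 8 9 - 5 * N 5 12 + 4 * N 4 13 = 0 := by
    have e := h.triple 4 5 9 (by omega) (by omega) (by omega) (by omega)
    simp only [tripleRel] at e
    norm_num at e
    linear_combination e - 5 * h.swap 5 12 + 4 * h.swap 4 13
  have t3_4_11 : (-3 * y + k + 27) / 2 * N 4 11 + (2 * y - k - 13) * N 3 11 + (-11 * y + 9 * k +
      19) / 2 * N 3 4 - N 6 11 - 8 * N 4 13 + 7 * N 3 14 = 0 := by
    have e := h.triple 3 4 11 (by omega) (by omega) (by omega) (by omega)
    simp only [tripleRel] at e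
    norm_num at e
    linear_combination e - 8 * h.swap 4 13 + 7 * h.swap 3 14
  have e3_13 : N 4 13 + 11 * N 3 14 + (y - 14) * N 3 13 = 0 := by
    have e := h.step 3 13 (by omega) (by omega) (by omega)
    push_cast at e
    linear_combination e
  have e4_12 : 2 * N 5 12 + 10 * N 4 13 + (y - 14) * N 4 12 = 0 := by
    have e := h.step 4 12 (by omega) (by omega) (by omega)
    push_cast at e
    linear_combination e
  have e5_11 : 3 * N 6 11 + 9 * N 5 12 + (y - 14) * N 5 11 = 0 := by
    have e := h.step 5 11 (by omega) (by omega) (by omega)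
    push_cast at e
    linear_combination e
  have e6_10 : 4 * N 7 10 + 8 * N 6 11 + (y - 14) * N 6 10 = 0 := by
    have e := h.step 6 10 (by omega) (by omega) (by omega)
    push_cast at e
    linear_combination e
  have e7_9 : 5 * N 8 9 + 7 * N 7 10 + (y - 14) * N 7 9 = 0 := by
    have e := h.step 7 9 (by omega) (by omega) (by omega)
    push_cast at e
    linear_combination e
  simp only [solN5_9, solN4_9, solN4_11, solN3_11, solN3_13, solN4_12, solN5_11, solN6_10,
      solN7_9, ha, zero_mul] at *
  rw [h5_9, h4_9] at t4_5_9
  rw [h4_11, h3_11] at t3_4_11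
  rw [h3_13] at e3_13
  rw [h4_12] at e4_12
  rw [h5_11] at e5_11
  rw [h6_10] at e6_10
  rw [h7_9] at e7_9
  rw [excPoly] at hexc
  rw [qPoly]
  -- The first bracket is the combination in which all six entries of degree 17 cancel; the second
  -- product reduces the result modulo `excPoly`.
  linear_combination 1921920 * (t4_5_9 - 11 / 20 * t3_4_11 + 7 / 20 * e3_13 - 7 / 8 * e4_12 + 3 /
      4 * e5_11 - 7 / 20 * e6_10 + 1 / 5 * e7_9) - 1921920 * N 4 5 * (y ^ 2 - 1 - 3 * k) * ((240 *
      y ^ 3 - 11208 * y ^ 2 + 616 * k * y + 159139 * y - 7202 * k - 721274) / 51891840) * hexc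

/-- The antisymmetric extension of `solN`. -/
def solA (k y a b : ℝ) (i j : ℕ) : ℝ := solN k y a b i j - solN k y a b j i

theorem solA_step (k y a b : ℝ) {i j : ℕ} (hi : 3 ≤ i) (hij : i < j) (h : i + j ≤ 15) :
    ((i : ℝ) - 2) * solA k y a b (i + 1) j + ((j : ℝ) - 2) * solA k y a b i (j + 1)
      + (y + 2 - i - j) * solA k y a b i j = 0 := by
  have : i ≤ 7 := by omega
  interval_cases i
  · have : j ≤ 12 := by omega
    interval_cases j
    · simp only [solA, solN, solN3_5, solN3_4]
      push_cast
      ring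
    · simp only [solA, solN, solN4_5, solN3_6, solN3_5]
      push_cast
      ring
    · simp only [solA, solN, solN4_6, solN3_7, solN3_6]
      push_cast
      ring
    · simp only [solA, solN, solN4_7, solN3_8, solN3_7]
      push_cast
      ring
    · simp only [solA, solN, solN4_8, solN3_9, solN3_8]
      push_cast
      ring
    · simp only [solA, solN, solN4_9, solN3_10, solN3_9]
      push_cast
      ring
    · simp only [solA, solN, solN4_10, solN3_11, solN3_10]
      push_cast
      ring
    · simp only [solA, solN, solN4_11, solN3_12, solN3_11]
      push_cast
      ring
    · simp only [solA, solN, solN4_12, solN3_13, solN3_12]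
      push_cast
      ring
  · have : j ≤ 11 := by omega
    interval_cases j
    · simp only [solA, solN, solN4_6, solN4_5]
      push_cast
      ring
    · simp only [solA, solN, solN5_6, solN4_7, solN4_6]
      push_cast
      ring
    · simp only [solA, solN, solN5_7, solN4_8, solN4_7]
      push_cast
      ring
    · simp only [solA, solN, solN5_8, solN4_9, solN4_8]
      push_cast
      ring
    · simp only [solA, solN, solN5_9, solN4_10, solN4_9]
      push_cast
      ring
    · simp only [solA, solN, solN5_10, solN4_11, solN4_10]
      push_cast
      ring
    · simp only [solA, solN, solN5_11, solN4_12, solN4_11]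
      push_cast
      ring
  · have : j ≤ 10 := by omega
    interval_cases j
    · simp only [solA, solN, solN5_7, solN5_6]
      push_cast
      ring
    · simp only [solA, solN, solN6_7, solN5_8, solN5_7]
      push_cast
      ring
    · simp only [solA, solN, solN6_8, solN5_9, solN5_8]
      push_cast
      ring
    · simp only [solA, solN, solN6_9, solN5_10, solN5_9]
      push_cast
      ring
    · simp only [solA, solN, solN6_10, solN5_11, solN5_10]
      push_cast
      ring
  · have : j ≤ 9 := by omega
    interval_cases j
    · simp only [solA, solN, solN6_8, solN6_7]
      push_cast
      ring
    · simp only [solA, solN, solN7_8, solN6_9, solN6_8]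
      push_cast
      ring
    · simp only [solA, solN, solN7_9, solN6_10, solN6_9]
      push_cast
      ring
  · have : j ≤ 8 := by omega
    interval_cases j
    simp only [solA, solN, solN7_9, solN7_8]
    push_cast
    ring

set_option maxHeartbeats 2000000 in
-- Each triple relation in this range is either an identity in k, y, a, b or a multiple of `excPoly
-- k y` times b q - a r / 20, with q = `qPoly k y` and r = `rPoly k y`. A single condition therefore
-- serves for all of them.
theorem solA_triple (k y a b : ℝ) {i j m : ℕ} (hi : 3 ≤ i) (hij : i < j) (hjm : j < m)
    (h : i + j + m ≤ 17) (hexc : 15 ≤ i + j + m → excPoly k y = 0) :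
    tripleRel ((y + 1 - k) / 2) (solA k y a b) i j m (k + 3 - i - j - m) = 0 := by
  have : i ≤ 4 := by omega
  interval_cases i
  · have : j ≤ 6 := by omega
    interval_cases j
    · have : m ≤ 10 := by omega
      interval_cases m
      · simp only [tripleRel, solA, solN, solN4_5, solN3_5, solN3_4, solN5_6, solN4_7, solN3_8]
        push_cast
        ring
      · simp only [tripleRel, solA, solN, solN4_6, solN3_6, solN3_4, solN4_8, solN3_9]
        push_cast
        ring
      · simp only [tripleRel, solA, solN, solN4_7, solN3_7, solN3_4, solN6_7, solN4_9, solN3_10]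
        push_cast
        ring
      · have hx := hexc (by omega)
        rw [excPoly] at hx
        simp only [tripleRel, solA, solN, solN4_8, solN3_8, solN3_4, solN6_8, solN4_10, solN3_11]
        push_cast
        linear_combination (-1) / 16632 * (b * (y ^ 2 - 1 - 3 * k) - a / 20 * (y ^ 4 - 20 * y ^ 3
            + 35 * y ^ 2 + 60 * k * y + 20 * y - 120 * k - 36)) * hx
      · simp only [tripleRel, solA, solN, solN4_9, solN3_9, solN3_4, solN6_9, solN4_11, solN3_12]
        push_cast
        ring
      · have hx := hexc (by omega)
        rw [excPoly] at hx
        simp only [tripleRel, solA, solN, solN4_10, solN3_10, solN3_4, solN6_10, solN4_12,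
            solN3_13]
        push_cast
        linear_combination (6 * y ^ 2 - 135 * y - 5 * k + 811) / 1297296 * (b * (y ^ 2 - 1 - 3 *
            k) - a / 20 * (y ^ 4 - 20 * y ^ 3 + 35 * y ^ 2 + 60 * k * y + 20 * y - 120 * k - 36))
            * hx
    · have : m ≤ 9 := by omega
      interval_cases m
      · simp only [tripleRel, solA, solN, solN5_6, solN3_6, solN3_5, solN6_7, solN5_8, solN3_10]
        push_cast
        ring
      · have hx := hexc (by omega)
        rw [excPoly] at hx
        simp only [tripleRel, solA, solN, solN5_7, solN3_7, solN3_5, solN5_9, solN3_11]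
        push_cast
        linear_combination (5) / 33264 * (b * (y ^ 2 - 1 - 3 * k) - a / 20 * (y ^ 4 - 20 * y ^ 3 +
            35 * y ^ 2 + 60 * k * y + 20 * y - 120 * k - 36)) * hx
      · have hx := hexc (by omega)
        rw [excPoly] at hx
        simp only [tripleRel, solA, solN, solN5_8, solN3_8, solN3_5, solN7_8, solN5_10, solN3_12]
        push_cast
        linear_combination (y - 12) / 33264 * (b * (y ^ 2 - 1 - 3 * k) - a / 20 * (y ^ 4 - 20 * y
            ^ 3 + 35 * y ^ 2 + 60 * k * y + 20 * y - 120 * k - 36)) * hx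
      · have hx := hexc (by omega)
        rw [excPoly] at hx
        simp only [tripleRel, solA, solN, solN5_9, solN3_9, solN3_5, solN7_9, solN5_11, solN3_13]
        push_cast
        linear_combination (-6 * y ^ 2 + 135 * y + 5 * k - 811) / 370656 * (b * (y ^ 2 - 1 - 3 *
            k) - a / 20 * (y ^ 4 - 20 * y ^ 3 + 35 * y ^ 2 + 60 * k * y + 20 * y - 120 * k - 36))
            * hx
    · have : m ≤ 8 := by omega
      interval_cases m
      · have hx := hexc (by omega)
        rw [excPoly] at hx
        simp only [tripleRel, solA, solN, solN6_7, solN3_7, solN3_6, solN7_8, solN6_9, solN3_12]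
        push_cast
        linear_combination (-5 * y + 60) / 33264 * (b * (y ^ 2 - 1 - 3 * k) - a / 20 * (y ^ 4 - 20
            * y ^ 3 + 35 * y ^ 2 + 60 * k * y + 20 * y - 120 * k - 36)) * hx
      · have hx := hexc (by omega)
        rw [excPoly] at hx
        simp only [tripleRel, solA, solN, solN6_8, solN3_8, solN3_6, solN6_10, solN3_13]
        push_cast
        linear_combination (81 * y ^ 2 - 1920 * y - 35 * k + 11761) / 2594592 * (b * (y ^ 2 - 1 -
            3 * k) - a / 20 * (y ^ 4 - 20 * y ^ 3 + 35 * y ^ 2 + 60 * k * y + 20 * y - 120 * k -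
            36)) * hx
  · have : j ≤ 6 := by omega
    interval_cases j
    · have : m ≤ 8 := by omega
      interval_cases m
      · have hx := hexc (by omega)
        rw [excPoly] at hx
        simp only [tripleRel, solA, solN, solN5_6, solN4_6, solN4_5, solN6_8, solN5_9, solN4_10]
        push_cast
        linear_combination (-5) / 8316 * (b * (y ^ 2 - 1 - 3 * k) - a / 20 * (y ^ 4 - 20 * y ^ 3 +
            35 * y ^ 2 + 60 * k * y + 20 * y - 120 * k - 36)) * hx
      · have hx := hexc (by omega)
        rw [excPoly] at hx
        simp only [tripleRel, solA, solN, solN5_7, solN4_7, solN4_5, solN7_8, solN5_10, solN4_11]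
        push_cast
        linear_combination (5 * y - 60) / 33264 * (b * (y ^ 2 - 1 - 3 * k) - a / 20 * (y ^ 4 - 20
            * y ^ 3 + 35 * y ^ 2 + 60 * k * y + 20 * y - 120 * k - 36)) * hx
      · have hx := hexc (by omega)
        rw [excPoly] at hx
        simp only [tripleRel, solA, solN, solN5_8, solN4_8, solN4_5, solN5_11, solN4_12]
        push_cast
        linear_combination (-23 * y ^ 2 + 680 * y - 35 * k - 4463) / 864864 * (b * (y ^ 2 - 1 - 3
            * k) - a / 20 * (y ^ 4 - 20 * y ^ 3 + 35 * y ^ 2 + 60 * k * y + 20 * y - 120 * k -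
            36)) * hx
    · have : m ≤ 7 := by omega
      interval_cases m
      have hx := hexc (by omega)
      rw [excPoly] at hx
      simp only [tripleRel, solA, solN, solN6_7, solN4_7, solN4_6, solN7_9, solN6_10, solN4_12]
      push_cast
      linear_combination (-15 * y ^ 2 - 150 * y + 175 * k + 2035) / 2594592 * (b * (y ^ 2 - 1 - 3
          * k) - a / 20 * (y ^ 4 - 20 * y ^ 3 + 35 * y ^ 2 + 60 * k * y + 20 * y - 120 * k - 36))
          * hx

theorem isSol_solA (k y a b : ℝ) (hS : S ≤ 16) (hexc : 14 ≤ S → excPoly k y = 0) :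
    IsSol k y S (solA k y a b) where
  swap i j := by rw [solA, solA, neg_sub]
  step i j hi hj h := by
    rcases lt_trichotomy i j with hij | rfl | hij
    · exact solA_step k y a b hi hij (by omega)
    · simp only [solA]
      ring
    · have := solA_step k y a b hj hij (by omega)
      simp only [solA] at this ⊢
      linear_combination -this
  triple i j m hi hij hjm h := solA_triple k y a b hi hij hjm (by omega) fun _ => hexc (by omega)

theorem IsSol.congr {N' : ℕ → ℕ → ℝ} (h : IsSol k y S N) (hs : ∀ i j, N' j i = -N' i j)
    (hN : ∀ i j, 3 ≤ i → 3 ≤ j → i + j ≤ S → N' i j = N i j) : IsSol k y S N' where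
  swap := hs
  step i j hi hj hij := by
    rw [hN _ _ (by omega) hj (by omega), hN _ _ hi (by omega) (by omega), hN _ _ hi hj (by omega)]
    exact h.step i j hi hj hij
  triple i j m hi hij hjm hS := by
    rw [tripleRel, hN _ _ (by omega) (by omega) (by omega), hN _ _ (by omega) (by omega) (by omega),
      hN _ _ (by omega) (by omega) (by omega), hN _ _ (by omega) (by omega) (by omega),
      hN _ _ (by omega) (by omega) (by omega), hN _ _ (by omega) (by omega) (by omega)]
    exact h.triple i j m hi hij hjm hS

end VectCoh
end

/-! ### Which normalised cocycles are coboundaries -/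

noncomputable section
namespace VectCoh

variable {lam : ℝ} {k : ℕ}

theorem val_detOp {mu : ℝ} (i j l : ℕ) (X Y : VectP) : (detOp i j l : Cochain2 lam mu).val X Y =
    mulOp l (dcoef i X * dcoef j Y - dcoef i Y * dcoef j X) := rfl

theorem detOp_mem_diffTwoCochain {mu : ℝ} (i j l : ℕ) :
    (detOp i j l : Cochain2 lam mu) ∈ diffTwoCochain lam mu := by
  refine ⟨Finsupp.single (i, j, l) 1 + Finsupp.single (j, i, l) (-1), fun X Y φ => ?_⟩
  rw [Finsupp.sum_add_index' (by simp) (by intros; ring), Finsupp.sum_single_index (by simp),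
    Finsupp.sum_single_index (by simp), eval_detOp]
  ring

theorem detOp_mem_invCochain {mu : ℝ} {i j : ℕ} (hi : 1 ≤ i) (hj : 1 ≤ j) (l : ℕ) :
    (detOp i j l : Cochain2 lam mu) ∈ invCochain lam mu := by
  refine ⟨detOp_mem_diffTwoCochain i j l, fun Y => ?_, fun Y Z => ?_⟩
  · rw [val_detOp, dcoef_field_zero, dcoef_field_zero, if_neg (by omega), if_neg (by omega)]
    simp
  · rw [val_detOp, lie_field_zero_mulOp, val_detOp, val_detOp, ← map_add]
    simp only [dcoef_lie_field_zero, map_sub D, D_mul, D_dcoef]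
    congr 1
    ring

theorem cf_detOp {mu : ℝ} (i j l p q n : ℕ) :
    cf 0 p q n (detOp i j l : Cochain2 lam mu) = if l = n then
      (((if i = p then (p.factorial : ℝ) else 0) * (if j = q then (q.factorial : ℝ) else 0) -
        (if i = q then (q.factorial : ℝ) else 0) * if j = p then (p.factorial : ℝ) else 0)) *
        n.factorial else 0 := by
  rw [cf_apply, val_detOp, coeffAt_mulOp, map_sub, map_mul, map_mul, evalAt_dcoef_field,
    evalAt_dcoef_field, evalAt_dcoef_field, evalAt_dcoef_field]

theorem detOp_mem_homogCochain {i j l : ℕ} (hi : 1 ≤ i) (hj : 1 ≤ j) (h : i + j + l = k + 2) :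
    (detOp i j l : Cochain2 lam (lam + k)) ∈ homogCochain lam (lam + k) := by
  refine ⟨detOp_mem_invCochain hi hj l, fun p q n hw => ?_⟩
  have hk : (i : ℝ) + j + l = k + 2 := by exact_mod_cast h
  rw [cf_detOp]
  split_ifs with h1 h2 h3 h4 h5 <;> subst_vars <;>
    first
    | exact absurd (by linarith) hw
    | simp

theorem nm_detOp {i j l : ℕ} (h : i + j + l = k + 2) (p q : ℕ) :
    nm p q (detOp i j l : Cochain2 lam (lam + k)) = (i.factorial * j.factorial * l.factorial : ℝ) *
      ((if i = p ∧ j = q then 1 else 0) - if i = q ∧ j = p then 1 else 0) := by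
  rw [nm, cf_detOp]
  split_ifs <;> first | omega | (subst_vars; simp_all)

theorem mem_homogCochain_homCochain (c : ℕ → ℕ → ℝ) :
    (homCochain k c : Cochain2 lam (lam + k)) ∈ homogCochain lam (lam + k) := by
  refine Submodule.sum_mem _ fun t ht => Submodule.smul_mem _ _ ?_
  obtain ⟨-, h1, h2, h3⟩ := Finset.mem_filter.1 ht
  exact detOp_mem_homogCochain (by omega) (by omega) (by omega)

theorem nm_homCochain (c : ℕ → ℕ → ℝ) {p q : ℕ} (hpq : p < q) :
    nm p q (homCochain k c : Cochain2 lam (lam + k)) = if 3 ≤ p ∧ p + q ≤ k + 2 then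
      p.factorial * q.factorial * (k + 2 - p - q).factorial * c p q else 0 := by
  have h1 : nm p q (homCochain k c : Cochain2 lam (lam + k)) =
      ∑ t ∈ (Finset.range (k + 3) ×ˢ Finset.range (k + 3)).filter
        (fun t => 3 ≤ t.1 ∧ t.1 < t.2 ∧ t.1 + t.2 ≤ k + 2), if t = (p, q) then
          p.factorial * q.factorial * (k + 2 - p - q).factorial * c p q else 0 := by
    rw [homCochain, map_sum]
    refine Finset.sum_congr rfl fun t ht => ?_
    obtain ⟨-, h1, h2, h3⟩ := Finset.mem_filter.1 ht
    obtain ⟨i, j⟩ := t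
    dsimp only at h1 h2 h3 ⊢
    rw [map_smul, nm_detOp (by omega), if_neg (by omega : ¬(i = q ∧ j = p)), sub_zero, smul_eq_mul]
    simp only [Prod.mk.injEq]
    split_ifs with h
    · obtain ⟨rfl, rfl⟩ := h
      ring
    · ring
  rw [h1, Finset.sum_ite_eq']
  congr 1
  simp only [Finset.mem_filter, Finset.mem_product, Finset.mem_range, eq_iff_iff]
  omega

theorem isSol_of_mem_normalZ2 {c : Cochain2 lam (lam + k)} (hc : c ∈ normalZ2 lam k) :
    IsSol k (2 * lam + k - 1) (k + 2) fun i j => nm i j c where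
  swap i j := nm_swap i j c
  step i j hi hj h := by
    linear_combination nm_rel_two hc hi hj (by omega)
  triple i j m hi hij hjm h := by
    have h1 := tripleRel_of_mem_Z2 hc.1 (by omega : 2 ≤ i) (by omega : 2 ≤ j) (by omega : 2 ≤ m)
      (by omega)
    rwa [show (2 * lam + k - 1 + 1 - k) / 2 = lam by ring]

theorem mem_normalZ2_of_isSol {c : Cochain2 lam (lam + k)} (hc : c ∈ homogCochain lam (lam + k))
    (h1 : ∀ j, 2 ≤ j → nm 1 j c = 0) (h2 : ∀ j, 3 ≤ j → nm 2 j c = 0)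
    (hS : IsSol k (2 * lam + k - 1) (k + 2) fun i j => nm i j c) : c ∈ normalZ2 lam k := by
  refine ⟨mem_Z2_of_rel hc (fun j m hj hjm h => ?_) (fun i j m hi hij hjm h => ?_), hc, h2⟩
  · rw [eulerRel, h1 m (by omega), h1 j hj, h1 (j + m - 1) (by omega)]
    ring
  · rcases hi.lt_or_eq with hi | rfl
    · have := hS.triple i j m hi hij hjm (by omega)
      rwa [show (2 * lam + k - 1 + 1 - k) / 2 = lam by ring] at this
    · have := hS.step j m (by omega) (by omega) (by omega)
      rw [tripleRel, show 2 + j - 1 = j + 1 by omega, show 2 + m - 1 = m + 1 by omega,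
        h2 m (by omega), h2 j (by omega), nm_swap j (m + 1), nm_swap 2 (j + m - 1),
        h2 (j + m - 1) (by omega)]
      push_cast
      linear_combination -this

/-- The determinant of `(nm 3 4, nm 4 5)` with the corresponding vector of the normalised
coboundaries. -/
def defect (lam : ℝ) (k : ℕ) : Cochain2 lam (lam + k) →ₗ[ℝ] ℝ :=
  (20 * qPoly k (2 * lam + k - 1)) • nm 4 5 - rPoly k (2 * lam + k - 1) • nm 3 4

theorem defect_apply (c : Cochain2 lam (lam + k)) :
    defect lam k c = 20 * qPoly k (2 * lam + k - 1) * nm 4 5 c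
      - rPoly k (2 * lam + k - 1) * nm 3 4 c := rfl

theorem excPoly_mul_defect {c : Cochain2 lam (lam + k)} (hc : c ∈ normalZ2 lam k) (hk : 12 ≤ k) :
    excPoly k (2 * lam + k - 1) * defect lam k c = 0 :=
  (isSol_of_mem_normalZ2 hc).excPoly_mul (by omega)

/-- At y = 0 the value of `qPoly` is -1 - 3 k, and at y² = 12 k - 23 it is 9 k - 24. -/
theorem qPoly_ne_zero_of_excPoly_eq_zero {k y : ℝ} (hk : 3 ≤ k) (h : excPoly k y = 0) :
    qPoly k y ≠ 0 := by
  rw [qPoly]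
  rcases mul_eq_zero.1 h with rfl | h
  · linarith
  · linarith

/-- If `excPoly` is non-zero, degree 14 suffices. Otherwise `qPoly` is non-zero, so a coboundary can
be subtracted to make `nm 3 4` vanish, and then the degree 17 condition kills `nm 4 5`. Coboundaries
have zero defect. -/
theorem defect_eq_zero {c : Cochain2 lam (lam + k)} (hc : c ∈ normalZ2 lam k) (hk : 15 ≤ k) :
    defect lam k c = 0 := by
  rcases mul_eq_zero.1 (excPoly_mul_defect hc (by omega)) with he | h
  swap
  · exact h
  have hk' : (15 : ℝ) ≤ k := by exact_mod_cast hk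
  have hq := qPoly_ne_zero_of_excPoly_eq_zero (by linarith) he
  obtain ⟨b, hb, -, -, -, h34, h45⟩ := exists_mem_normalZ2_B2 (lam := lam) (by omega : 1 ≤ k) 0
    (6 * nm 3 4 c / qPoly k (2 * lam + k - 1))
  have e34 := h34 (by omega)
  have e45 := h45 (by omega)
  have hS := isSol_of_mem_normalZ2 (sub_mem hc hb)
  have h0 : nm 3 4 (c - b) = 0 := by
    rw [map_sub, e34]
    field_simp
    ring
  have h1 := hS.mul_eq_zero_of_three_four (by omega) h0 he
  have h2 : nm 4 5 (c - b) = 0 := by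
    refine (mul_eq_zero.1 ((mul_eq_zero.1 h1).resolve_right ?_)).resolve_right hq
    -- The last factor of `h1` equals 35 (k - 3)(k² - 1) at y = 0 and 143 (k - 2)(k - 4)(k - 6) at
    -- y² = 12 k - 23, both non-zero for k ≥ 15.
    rcases mul_eq_zero.1 he with h | h
    · rw [h]
      have : ((k : ℝ) - 3) * (k ^ 2 - 1) ≠ 0 := mul_ne_zero (by linarith) (by nlinarith)
      contrapose! this
      linear_combination this / 35
    · have : ((k : ℝ) - 2) * (k - 4) * (k - 6) ≠ 0 :=
        mul_ne_zero (mul_ne_zero (by linarith) (by linarith)) (by linarith)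
      contrapose! this
      linear_combination this / 143 - (9 * (k : ℝ) ^ 2 - 117 * k + 303) / 143 * h
  rw [map_sub, e45, sub_eq_zero] at h2
  rw [defect_apply, h2]
  field_simp
  ring

/-- The coboundary with parameters s and t has the same four determining entries as c, so rigidity
makes the two equal. Entries of degree above k + 2 agree because both vanish. -/
theorem mem_B2_of_nm {c : Cochain2 lam (lam + k)} (hc : c ∈ normalZ2 lam k) (hk : 1 ≤ k) {s t : ℝ}
    (h12 : nm 1 2 c = (2 * lam + k - 1) * s) (h13 : 2 ≤ k → nm 1 3 c = (k - 2 + 3 * lam) * s)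
    (h34 : 5 ≤ k → nm 3 4 c = qPoly k (2 * lam + k - 1) / 6 * t)
    (h45 : 7 ≤ k → nm 4 5 c = rPoly k (2 * lam + k - 1) / 120 * t) : c ∈ B2 lam (lam + k) := by
  obtain ⟨b, hb, hB, e12, e13, e34, e45⟩ := exists_mem_normalZ2_B2 (lam := lam) hk s t
  have key {i j n : ℕ} (hn : i + j = n + 2) {x : ℝ} (h1 : n ≤ k → nm i j c = x)
      (h2 : n ≤ k → nm i j b = x) : nm i j (c - b) = 0 := by
    rcases le_or_gt n k with h | h
    · rw [map_sub, h1 h, h2 h, sub_self]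
    · exact nm_eq_zero_of_lt (sub_mem hc hb).2.1 (by omega)
  rw [sub_eq_zero.1 (eq_zero_of_mem_normalZ2 (sub_mem hc hb) (key rfl (fun _ => h12) fun _ => e12)
    (key rfl h13 e13) (key rfl h34 e34) (key rfl h45 e45))]
  exact hB

/-- The vector (2 lam + k - 1, k - 2 + 3 lam) is non-zero, so a vanishing determinant means
proportionality. -/
theorem exists_nm_of_gDet_eq_zero {c : Cochain2 lam (lam + k)} (hk : 2 ≤ k)
    (h : gDet lam k c = 0) :
    ∃ s, nm 1 2 c = (2 * lam + k - 1) * s ∧ nm 1 3 c = (k - 2 + 3 * lam) * s := by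
  rw [gDet_apply] at h
  by_cases h0 : 2 * lam + k - 1 = 0
  · have hk' : (2 : ℝ) ≤ k := by exact_mod_cast hk
    have h1 : (k : ℝ) - 2 + 3 * lam ≠ 0 := fun h => by linarith
    refine ⟨nm 1 3 c / (k - 2 + 3 * lam), ?_, by field_simp⟩
    rw [h0] at h ⊢
    have : nm 1 2 c = 0 :=
      (mul_eq_zero.1 (by linarith : ((k : ℝ) - 2 + 3 * lam) * _ = 0)).resolve_left h1
    rw [this, zero_mul]
  · refine ⟨nm 1 2 c / (2 * lam + k - 1), by field_simp, ?_⟩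
    field_simp
    linarith

theorem gDet_eq_zero_of_mem_B2 {c : Cochain2 lam (lam + k)} (hc : c ∈ normalZ2 lam k) (hk : 2 ≤ k)
    (h : c ∈ B2 lam (lam + k)) : gDet lam k c = 0 := by
  obtain ⟨⟨s, h1, h2⟩, -⟩ := nm_of_mem_B2 hc h
  rw [gDet_apply, h1 (by omega), h2 hk]
  ring

theorem mem_B2_iff_of_le_four {c : Cochain2 lam (lam + k)} (hc : c ∈ normalZ2 lam k) (hk : 2 ≤ k)
    (hk' : k ≤ 4) : c ∈ B2 lam (lam + k) ↔ gDet lam k c = 0 := by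
  refine ⟨gDet_eq_zero_of_mem_B2 hc hk, fun h => ?_⟩
  obtain ⟨s, h1, h2⟩ := exists_nm_of_gDet_eq_zero hk h
  exact mem_B2_of_nm hc (by omega) h1 (fun _ => h2) (t := 0) (fun _ => by omega) fun _ => by omega

/-- A non-zero `qPoly` does two things at once: it forces `gDet` = 0, and it lets the parameter t
match `nm 3 4`. -/
theorem mem_B2_of_qPoly_ne_zero {c : Cochain2 lam (lam + k)} (hc : c ∈ normalZ2 lam k) (hk : 5 ≤ k)
    (hk' : k ≤ 6) (hq : qPoly k (2 * lam + k - 1) ≠ 0) : c ∈ B2 lam (lam + k) := by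
  obtain ⟨s, h1, h2⟩ := exists_nm_of_gDet_eq_zero (by omega)
    ((mul_eq_zero.1 (qPoly_mul_gDet hc.1 hk)).resolve_left hq)
  refine mem_B2_of_nm hc (by omega) h1 (fun _ => h2)
    (t := 6 * nm 3 4 c / qPoly k (2 * lam + k - 1)) (fun _ => ?_) fun _ => by omega
  field_simp

theorem mem_B2_iff_of_qPoly_eq_zero {c : Cochain2 lam (lam + k)} (hc : c ∈ normalZ2 lam k)
    (hk : 5 ≤ k) (hk' : k ≤ 6) (hq : qPoly k (2 * lam + k - 1) = 0) :
    c ∈ B2 lam (lam + k) ↔ gDet lam k c = 0 ∧ nm 3 4 c = 0 := by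
  refine ⟨fun h => ⟨gDet_eq_zero_of_mem_B2 hc (by omega) h, ?_⟩, fun h => ?_⟩
  · obtain ⟨-, t, h1, -⟩ := nm_of_mem_B2 hc h
    rw [h1 hk, hq, zero_div, zero_mul]
  · obtain ⟨s, h1, h2⟩ := exists_nm_of_gDet_eq_zero (by omega) h.1
    refine mem_B2_of_nm hc (by omega) h1 (fun _ => h2) (t := 0) (fun _ => ?_) fun _ => by omega
    rw [h.2, mul_zero]

/-- For k ≥ 7 `gDet` vanishes on cocycles. The vector (q / 6, r / 120) of coboundary entries is
non-zero, so `defect` = 0 says exactly that (`nm 3 4`, `nm 4 5`) is a multiple of it. -/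
theorem mem_B2_iff_defect_eq_zero {c : Cochain2 lam (lam + k)} (hc : c ∈ normalZ2 lam k)
    (hk : 7 ≤ k) : c ∈ B2 lam (lam + k) ↔ defect lam k c = 0 := by
  refine ⟨fun h => ?_, fun h => ?_⟩
  · obtain ⟨-, t, h1, h2⟩ := nm_of_mem_B2 hc h
    rw [defect_apply, h1 (by omega), h2 hk]
    ring
  · obtain ⟨s, h1, h2⟩ := exists_nm_of_gDet_eq_zero (by omega) (gDet_eq_zero hc.1 hk)
    rw [defect_apply] at h
    by_cases hq : qPoly k (2 * lam + k - 1) = 0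
    · have hr := (qPoly_ne_zero_or_rPoly_ne_zero (by exact_mod_cast (by omega : 1 < k))
        (2 * lam + k - 1)).resolve_left (not_not.2 hq)
      rw [hq] at h
      have h3 : nm 3 4 c = 0 := (mul_eq_zero.1 (by linarith :
        rPoly k (2 * lam + k - 1) * nm 3 4 c = 0)).resolve_left hr
      refine mem_B2_of_nm hc (by omega) h1 (fun _ => h2)
        (t := 120 * nm 4 5 c / rPoly k (2 * lam + k - 1)) (fun _ => ?_) fun _ => ?_
      · rw [h3, hq]
        ring
      · field_simp
    · refine mem_B2_of_nm hc (by omega) h1 (fun _ => h2)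
        (t := 6 * nm 3 4 c / qPoly k (2 * lam + k - 1)) (fun _ => ?_) fun _ => ?_
      · field_simp
      · field_simp
        linarith

end VectCoh
end

/-! ### From linear forms on normalised cocycles to cohomology; vanishing on sl(2) -/

noncomputable section
namespace VectCoh

variable {lam : ℝ} {k : ℕ}

theorem cls_eq_cls_iff {mu : ℝ} {c d : Z2 lam mu} : cls c = cls d ↔ c.1 - d.1 ∈ B2 lam mu := by
  rw [cls, Submodule.mkQ_apply, Submodule.mkQ_apply, Submodule.Quotient.eq]
  rfl

theorem spans_of_forall_exists {mu : ℝ} {S : Set (Cochain2 lam mu)} (hS : ∀ c ∈ S, c ∈ Z2 lam mu)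
    (h : ∀ c ∈ Z2 lam mu, ∃ d ∈ Submodule.span ℝ S, c - d ∈ B2 lam mu) : Spans S := by
  refine ⟨hS, ?_⟩
  rw [eq_top_iff]
  rintro x -
  obtain ⟨c, rfl⟩ := Submodule.mkQ_surjective _ x
  obtain ⟨d, hd, hcd⟩ := h c.1 c.2
  have hle : Submodule.span ℝ S ≤ Z2 lam mu := Submodule.span_le.2 hS
  have hx : cls c = cls ⟨d, hle hd⟩ := cls_eq_cls_iff.2 hcd
  change cls c ∈ _
  rw [hx]
  clear hx hcd
  induction hd using Submodule.span_induction with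
  | mem d hd => exact Submodule.subset_span ⟨⟨d, hd⟩, rfl⟩
  | zero => exact zero_mem _
  | add d e hd he h1 h2 => exact add_mem h1 h2
  | smul r d hd h1 => exact Submodule.smul_mem _ r h1

theorem normalZ2_le_Z2 : normalZ2 lam k ≤ Z2 lam (lam + k) := fun _ hc => hc.1

theorem subsingleton_H2_of_le {mu : ℝ} (h : Z2 lam mu ≤ B2 lam mu) : Subsingleton (H2 lam mu) := by
  rw [Submodule.Quotient.subsingleton_iff, eq_top_iff]
  rintro c -
  exact h c.2

theorem Z2_le_B2_of_normalZ2_le (h : normalZ2 lam k ≤ B2 lam (lam + k)) :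
    Z2 lam (lam + k) ≤ B2 lam (lam + k) := by
  intro c hc
  obtain ⟨b, hb, hcb⟩ := exists_sub_mem_normalZ2 hc
  rw [← sub_add_cancel c b]
  exact add_mem (h hcb) hb

/-- The map from normalised cocycles to cohomology. -/
def normalCls (lam : ℝ) (k : ℕ) : normalZ2 lam k →ₗ[ℝ] H2 lam (lam + k) :=
  cls ∘ₗ Submodule.inclusion normalZ2_le_Z2

theorem normalCls_surjective : Function.Surjective (normalCls lam k) := by
  intro x
  obtain ⟨c, rfl⟩ := Submodule.mkQ_surjective _ x
  obtain ⟨b, hb, hcb⟩ := exists_sub_mem_normalZ2 c.2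
  refine ⟨⟨_, hcb⟩, cls_eq_cls_iff.2 ?_⟩
  change c.1 - b - c.1 ∈ _
  rw [sub_sub_cancel_left]
  exact neg_mem hb

theorem normalCls_eq_zero_iff (c : normalZ2 lam k) :
    normalCls lam k c = 0 ↔ c.1 ∈ B2 lam (lam + k) := by
  rw [← map_zero cls]
  refine cls_eq_cls_iff.trans ?_
  change c.1 - 0 ∈ _ ↔ _
  rw [sub_zero]

/-- Both the cohomology and V are quotients of `normalZ2`, by the same kernel. -/
theorem nonempty_equiv_of_ker {V : Type*} [AddCommGroup V] [Module ℝ V]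
    (φ : Cochain2 lam (lam + k) →ₗ[ℝ] V)
    (hφ : ∀ c ∈ normalZ2 lam k, c ∈ B2 lam (lam + k) ↔ φ c = 0)
    (hs : ∀ v, ∃ c ∈ normalZ2 lam k, φ c = v) : Nonempty (H2 lam (lam + k) ≃ₗ[ℝ] V) := by
  have h2 : Function.Surjective (φ.domRestrict (normalZ2 lam k)) := fun v => by
    obtain ⟨c, hc, rfl⟩ := hs v
    exact ⟨⟨c, hc⟩, rfl⟩
  have hk : LinearMap.ker (normalCls lam k) = LinearMap.ker (φ.domRestrict (normalZ2 lam k)) := by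
    ext c
    rw [LinearMap.mem_ker, LinearMap.mem_ker, normalCls_eq_zero_iff]
    exact hφ c.1 c.2
  exact ⟨((normalCls lam k).quotKerEquivOfSurjective normalCls_surjective).symm ≪≫ₗ
    Submodule.quotEquivOfEq _ _ hk ≪≫ₗ
    (φ.domRestrict (normalZ2 lam k)).quotKerEquivOfSurjective h2⟩

theorem spans_of_ker {V : Type*} [AddCommGroup V] [Module ℝ V]
    (φ : Cochain2 lam (lam + k) →ₗ[ℝ] V)
    (hφ : ∀ c ∈ normalZ2 lam k, c ∈ B2 lam (lam + k) ↔ φ c = 0) {S : Set (Cochain2 lam (lam + k))}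
    (hS : S ⊆ normalZ2 lam k) (h : ∀ v, v ∈ Submodule.span ℝ (φ '' S)) : Spans S := by
  refine spans_of_forall_exists (fun c hc => (hS hc).1) fun c hc => ?_
  obtain ⟨b, hb, hcb⟩ := exists_sub_mem_normalZ2 hc
  have h1 := h (φ (c - b))
  rw [← Submodule.map_span] at h1
  obtain ⟨d, hd, hd'⟩ := h1
  refine ⟨d, hd, ?_⟩
  have h2 : c - b - d ∈ B2 lam (lam + k) :=
    (hφ _ (sub_mem hcb (Submodule.span_le.2 hS hd))).2 (by rw [map_sub, hd', sub_self])
  rw [show c - d = c - b - d + b by abel]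
  exact add_mem h2 hb

theorem spans_singleton (φ : Cochain2 lam (lam + k) →ₗ[ℝ] ℝ)
    (hφ : ∀ c ∈ normalZ2 lam k, c ∈ B2 lam (lam + k) ↔ φ c = 0) {Ω : Cochain2 lam (lam + k)}
    (hΩ : Ω ∈ normalZ2 lam k) (h : φ Ω ≠ 0) : Spans {Ω} := by
  refine spans_of_ker φ hφ (Set.singleton_subset_iff.2 hΩ) fun v => ?_
  rw [Set.image_singleton, Submodule.mem_span_singleton]
  exact ⟨v / φ Ω, div_mul_cancel₀ v h⟩

theorem nonempty_equiv_real (φ : Cochain2 lam (lam + k) →ₗ[ℝ] ℝ)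
    (hφ : ∀ c ∈ normalZ2 lam k, c ∈ B2 lam (lam + k) ↔ φ c = 0) {Ω : Cochain2 lam (lam + k)}
    (hΩ : Ω ∈ normalZ2 lam k) (h : φ Ω ≠ 0) : Nonempty (H2 lam (lam + k) ≃ₗ[ℝ] ℝ) := by
  refine nonempty_equiv_of_ker φ hφ fun v => ⟨(v / φ Ω) • Ω, Submodule.smul_mem _ _ hΩ, ?_⟩
  rw [map_smul]
  exact div_mul_cancel₀ v h

/-- The pair of functionals `(gDet, nm 3 4)`. -/
def gDetPair (lam : ℝ) (k : ℕ) : Cochain2 lam (lam + k) →ₗ[ℝ] (Fin 2 → ℝ) :=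
  LinearMap.pi ![gDet lam k, nm 3 4]

theorem gDetPair_apply (c : Cochain2 lam (lam + k)) :
    gDetPair lam k c = ![gDet lam k c, nm 3 4 c] := by
  ext i
  fin_cases i <;> rfl

theorem mem_B2_iff_gDetPair_eq_zero {c : Cochain2 lam (lam + k)} (hc : c ∈ normalZ2 lam k)
    (hk : 5 ≤ k) (hk' : k ≤ 6) (hq : qPoly k (2 * lam + k - 1) = 0) :
    c ∈ B2 lam (lam + k) ↔ gDetPair lam k c = 0 := by
  rw [mem_B2_iff_of_qPoly_eq_zero hc hk hk' hq, gDetPair_apply]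
  refine ⟨fun h => by simp [h.1, h.2], fun h => ⟨congrFun h 0, congrFun h 1⟩⟩

theorem exists_eq_gDetPair {Ω Ω' : Cochain2 lam (lam + k)} (h1 : gDet lam k Ω ≠ 0)
    (h2 : nm 3 4 Ω = 0) (h3 : gDet lam k Ω' = 0) (h4 : nm 3 4 Ω' ≠ 0) (v : Fin 2 → ℝ) :
    ∃ r s : ℝ, gDetPair lam k (r • Ω + s • Ω') = v := by
  refine ⟨v 0 / gDet lam k Ω, v 1 / nm 3 4 Ω', ?_⟩
  rw [gDetPair_apply, map_add, map_add, map_smul, map_smul, map_smul, map_smul, h2, h3]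
  ext i
  fin_cases i <;> simp [h1, h4]

theorem nonempty_equiv_fin_two (hk : 5 ≤ k) (hk' : k ≤ 6) (hq : qPoly k (2 * lam + k - 1) = 0)
    {Ω Ω' : Cochain2 lam (lam + k)} (hΩ : Ω ∈ normalZ2 lam k) (hΩ' : Ω' ∈ normalZ2 lam k)
    (h1 : gDet lam k Ω ≠ 0) (h2 : nm 3 4 Ω = 0) (h3 : gDet lam k Ω' = 0) (h4 : nm 3 4 Ω' ≠ 0) :
    Nonempty (H2 lam (lam + k) ≃ₗ[ℝ] (Fin 2 → ℝ)) := by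
  refine nonempty_equiv_of_ker (gDetPair lam k)
    (fun c hc => mem_B2_iff_gDetPair_eq_zero hc hk hk' hq) fun v => ?_
  obtain ⟨r, s, h⟩ := exists_eq_gDetPair h1 h2 h3 h4 v
  exact ⟨_, add_mem (Submodule.smul_mem _ _ hΩ) (Submodule.smul_mem _ _ hΩ'), h⟩

theorem spans_pair (hk : 5 ≤ k) (hk' : k ≤ 6) (hq : qPoly k (2 * lam + k - 1) = 0)
    {Ω Ω' : Cochain2 lam (lam + k)} (hΩ : Ω ∈ normalZ2 lam k) (hΩ' : Ω' ∈ normalZ2 lam k)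
    (h1 : gDet lam k Ω ≠ 0) (h2 : nm 3 4 Ω = 0) (h3 : gDet lam k Ω' = 0) (h4 : nm 3 4 Ω' ≠ 0) :
    Spans {Ω, Ω'} := by
  refine spans_of_ker (gDetPair lam k)
    (fun c hc => mem_B2_iff_gDetPair_eq_zero hc hk hk' hq) (Set.pair_subset hΩ hΩ') fun v => ?_
  obtain ⟨r, s, h⟩ := exists_eq_gDetPair h1 h2 h3 h4 v
  rw [← Submodule.map_span, ← h]
  exact Submodule.mem_map_of_mem (Submodule.mem_span_pair.2 ⟨r, s, rfl⟩)

theorem field_mem_sl2 {i : ℕ} (hi : i ≤ 2) : field 0 i ∈ sl2 := by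
  apply Submodule.subset_span
  rw [field, Polynomial.C_0, sub_zero]
  interval_cases i <;> simp

theorem sl2_le_span_field (x : ℝ) :
    sl2 ≤ Submodule.span ℝ {field x 0, field x 1, field x 2} := by
  have h0 : field x 0 ∈ Submodule.span ℝ {field x 0, field x 1, field x 2} :=
    Submodule.subset_span (by simp)
  have h1 : field x 1 ∈ Submodule.span ℝ {field x 0, field x 1, field x 2} :=
    Submodule.subset_span (by simp)
  have h2 : field x 2 ∈ Submodule.span ℝ {field x 0, field x 1, field x 2} :=
    Submodule.subset_span (by simp)
  rw [sl2, Submodule.span_le]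
  rintro _ (rfl | rfl | rfl)
  · rw [show Polynomial.mkDerivation ℝ 1 = field x 0 by rw [field, pow_zero]]
    exact h0
  · have e : Polynomial.mkDerivation ℝ Polynomial.X = field x 1 + x • field x 0 := by
      apply Polynomial.derivation_ext
      simp [field, Polynomial.smul_eq_C_mul]
    rw [e]
    exact add_mem h1 (Submodule.smul_mem _ x h0)
  · have e : Polynomial.mkDerivation ℝ (Polynomial.X ^ 2) =
        field x 2 + ((2 * x) • field x 1 + x ^ 2 • field x 0) := by
      apply Polynomial.derivation_ext
      simp only [field, Polynomial.mkDerivation_X, Derivation.add_apply, Derivation.smul_apply,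
        Polynomial.smul_eq_C_mul, map_mul, map_pow, pow_zero, pow_one, mul_one, map_ofNat]
      ring
    rw [e]
    exact add_mem h2 (add_mem (Submodule.smul_mem _ _ h1) (Submodule.smul_mem _ _ h0))

/-- Normalisation already covers d/dt and, apart from `nm 1 2`, t² d/dt, so only the row of t d/dt
has to be added. Testing at the origin is enough, since the coefficients are constant and sl(2) lies
in the span of the fields of degree at most two centred at any x. -/
theorem mem_relZ2_iff {c : Cochain2 lam (lam + k)} : c ∈ relZ2 lam (lam + k) ↔
    c ∈ normalZ2 lam k ∧ ∀ j, 2 ≤ j → nm 1 j c = 0 := by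
  constructor
  · rintro ⟨hc, h⟩
    have h0 (i j l : ℕ) (hi : i ≤ 2) : cf 0 i j l c = 0 := by
      rw [cf_apply, h _ (field_mem_sl2 hi), map_zero]
    exact ⟨⟨hc, mem_homogCochain_of_cf_one hc
      (mem_invCochain_of_mem_Z2 hc (h _ (field_mem_sl2 (by omega)))) fun j l _ => h0 1 j l (by
      omega),
      fun j _ => h0 2 j _ le_rfl⟩, fun j _ => h0 1 j _ (by omega)⟩
  · rintro ⟨hc, h1⟩
    refine ⟨hc.1, fun X hX Y => ?_⟩
    have h2 : nm 2 1 c = 0 := by rw [nm_swap, h1 2 le_rfl, neg_zero]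
    have h0 (x : ℝ) (i j l : ℕ) (hi : i ≤ 2) : cf x i j l c = 0 := by
      rw [cf_eq_of_mem_invCochain hc.2.1.1 x 0]
      by_cases hw : i + j + l = k + 2
      · have hj : j = 0 ∨ j = 1 ∨ j = 2 ∨ 3 ≤ j := by omega
        interval_cases i
        · exact cf_zero_left hc.2.1.1 0 _ _
        · rw [cf_eq_nm hw]
          rcases hj with rfl | rfl | rfl | hj
          · rw [nm_swap, nm, cf_zero_left hc.2.1.1, neg_zero]
          · exact nm_self _ _
          · exact h1 _ le_rfl
          · exact h1 _ (by omega)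
        · rw [cf_eq_nm hw]
          rcases hj with rfl | rfl | rfl | hj
          · rw [nm_swap, nm, cf_zero_left hc.2.1.1, neg_zero]
          · exact h2
          · exact nm_self _ _
          · exact hc.2.2 _ hj
      · exact cf_eq_zero_of_ne hc.2.1 hw
    refine DiffOp.ext_coeffAt fun x l => ?_
    rw [map_zero]
    have hz (i : ℕ) (hi : i ≤ 2) : coeffAt x l (c.val (field x i) Y) = 0 := by
      have h : coeffAt x l ∘ₗ c.val (field x i) = 0 := hom_ext_field x fun j => h0 x i j l hi
      exact LinearMap.congr_fun h Y
    replace hX := sl2_le_span_field x hX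
    induction hX using Submodule.span_induction with
    | mem X hX => rcases hX with rfl | rfl | rfl <;> exact hz _ (by omega)
    | zero => simp
    | add X X' _ _ h h' => rw [map_add, LinearMap.add_apply, map_add, h, h', add_zero]
    | smul r X _ h => rw [map_smul, LinearMap.smul_apply, map_smul, h, smul_zero]

end VectCoh
end

/-! ### Cocycles vanishing on sl(2) for k at least seven -/

noncomputable section
namespace VectCoh

variable {lam : ℝ} {k : ℕ}

/-- Since `gDet` vanishes, a normalised coboundary matches `nm 1 2` and `nm 1 3`. After subtracting
it the recursion of the row `nm 1 j` makes the whole row zero. -/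
theorem spans_relZ2 (hk : 7 ≤ k) : Spans (relZ2 lam (lam + k)) := by
  refine spans_of_forall_exists (fun c hc => hc.1) fun c hc => ?_
  obtain ⟨b, hb, hcb⟩ := exists_sub_mem_normalZ2 hc
  obtain ⟨s, h1, h2⟩ := exists_nm_of_gDet_eq_zero (by omega) (gDet_eq_zero hcb.1 hk)
  obtain ⟨d, hd, hdB, e1, e2, -⟩ := exists_mem_normalZ2_B2 (lam := lam) (by omega : 1 ≤ k) s 0
  have hn := sub_mem hcb hd
  refine ⟨c - b - d, Submodule.subset_span (mem_relZ2_iff.2 ⟨hn, fun j hj => ?_⟩), ?_⟩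
  · rcases le_or_gt j (k + 1) with h | h
    · refine nm_one_eq_zero hn.1 ?_ ?_ hj h
      · rw [map_sub, h1, e1, sub_self]
      · rw [map_sub, h2, e2 (by omega), sub_self]
    · exact nm_eq_zero_of_lt hn.2.1 (by omega)
  · rw [show c - (c - b - d) = b + d by abel]
    exact add_mem hb hdB

theorem nm_homCochain_of_le (c : ℕ → ℕ → ℝ) {p q : ℕ} (hp : 3 ≤ p) (hpq : p < q)
    (h : p + q ≤ k + 2) : nm p q (homCochain k c : Cochain2 lam (lam + k)) =
      p.factorial * q.factorial * (k + 2 - p - q).factorial * c p q := by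
  rw [nm_homCochain c hpq, if_pos ⟨hp, h⟩]

theorem exists_eq_homCochain {Ω : Cochain2 lam (lam + k)} (hΩ : Ω ∈ relZ2 lam (lam + k)) :
    ∃ c : ℕ → ℕ → ℝ, Ω = homCochain k c := by
  obtain ⟨hn, h1⟩ := mem_relZ2_iff.1 hΩ
  refine ⟨fun i j => nm i j Ω / (i.factorial * j.factorial * (k + 2 - i - j).factorial),
    ext_nm hn.2.1 (mem_homogCochain_homCochain _) fun i j hi hij hk => ?_⟩
  rw [nm_homCochain _ hij]
  split_ifs with h
  · field_simp
  · obtain rfl | rfl : i = 1 ∨ i = 2 := by omega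
    · exact h1 j hij
    · exact hn.2.2 j hij

theorem isRelCocycle_iff (hk : 7 ≤ k) {a b : ℝ} {Ω : Cochain2 lam (lam + k)} :
    IsRelCocycle k lam a b Ω ↔ Ω ∈ relZ2 lam (lam + k) ∧
      nm 3 4 Ω = (Nat.factorial 3) * (Nat.factorial 4) * (k - 5).factorial * a ∧
      nm 4 5 Ω = (Nat.factorial 4) * (Nat.factorial 5) * (k - 7).factorial * b := by
  have h34 (c : ℕ → ℕ → ℝ) := nm_homCochain_of_le (lam := lam) (k := k) c le_rfl
    (by omega : 3 < 4) (by omega)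
  have h45 (c : ℕ → ℕ → ℝ) := nm_homCochain_of_le (lam := lam) (k := k) c (by omega : 3 ≤ 4)
    (by omega : 4 < 5) (by omega)
  rw [show k + 2 - 3 - 4 = k - 5 by omega] at h34
  rw [show k + 2 - 4 - 5 = k - 7 by omega] at h45
  constructor
  · rintro ⟨h, c, rfl, rfl, rfl⟩
    exact ⟨h, h34 c, h45 c⟩
  · rintro ⟨h, h1, h2⟩
    obtain ⟨c, rfl⟩ := exists_eq_homCochain h
    rw [h34] at h1
    rw [h45] at h2
    exact ⟨h, c, rfl, mul_left_cancel₀ (by positivity) h1, mul_left_cancel₀ (by positivity) h2⟩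

theorem IsRelCocycle.mem_normalZ2 {a b : ℝ} {Ω : Cochain2 lam (lam + k)}
    (h : IsRelCocycle k lam a b Ω) : Ω ∈ normalZ2 lam k := (mem_relZ2_iff.1 h.1).1

theorem IsRelCocycle.eq (hk : 7 ≤ k) {a b : ℝ} {Ω Ω' : Cochain2 lam (lam + k)}
    (h : IsRelCocycle k lam a b Ω) (h' : IsRelCocycle k lam a b Ω') : Ω = Ω' := by
  obtain ⟨h1, h2, h3⟩ := (isRelCocycle_iff hk).1 h
  obtain ⟨h1', h2', h3'⟩ := (isRelCocycle_iff hk).1 h'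
  obtain ⟨hn, hn1⟩ := mem_relZ2_iff.1 h1
  obtain ⟨hn', hn1'⟩ := mem_relZ2_iff.1 h1'
  rw [← sub_eq_zero]
  refine eq_zero_of_mem_normalZ2 (sub_mem hn hn') ?_ ?_ ?_ ?_
  · rw [map_sub, hn1 _ le_rfl, hn1' _ le_rfl, sub_zero]
  · rw [map_sub, hn1 _ (by omega), hn1' _ (by omega), sub_zero]
  · rw [map_sub, h2, h2', sub_self]
  · rw [map_sub, h3, h3', sub_self]

/-- The degrees involved are at most k + 2 ≤ 16, where the universal solution is available. The
factorials convert between the coefficients c i j and the structure constants `nm i j`. -/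
theorem exists_isRelCocycle (hk : 7 ≤ k) (hk' : k ≤ 14)
    (he : 12 ≤ k → excPoly k (2 * lam + k - 1) = 0) (a b : ℝ) :
    ∃ Ω, IsRelCocycle k lam a b Ω := by
  set N := solA k (2 * lam + k - 1) ((Nat.factorial 3) * (Nat.factorial 4) * (k - 5).factorial * a)
    ((Nat.factorial 4) * (Nat.factorial 5) * (k - 7).factorial * b) with hN
  set Ω : Cochain2 lam (lam + k) := homCochain k fun i j =>
    N i j / (i.factorial * j.factorial * (k + 2 - i - j).factorial) with hΩ
  have hS : IsSol k (2 * lam + k - 1) (k + 2) N := isSol_solA _ _ _ _ (by omega)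
    fun h => he (by omega)
  have hlt (i j : ℕ) (hi : 3 ≤ i) (hij : i < j) (h : i + j ≤ k + 2) : nm i j Ω = N i j := by
    rw [hΩ, nm_homCochain_of_le _ hi hij h]
    field_simp
  have hn (i j : ℕ) (hi : 3 ≤ i) (hj : 3 ≤ j) (h : i + j ≤ k + 2) : nm i j Ω = N i j := by
    rcases lt_trichotomy i j with hij | rfl | hij
    · exact hlt i j hi hij h
    · rw [nm_self, hS.self]
    · rw [nm_swap, hS.swap j i, hlt j i hj hij (by omega)]
  have h1 (j : ℕ) (hj : 2 ≤ j) : nm 1 j Ω = 0 := by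
    rw [hΩ, nm_homCochain _ (by omega), if_neg (by omega)]
  refine ⟨Ω, (isRelCocycle_iff hk).2 ⟨mem_relZ2_iff.2 ⟨mem_normalZ2_of_isSol
    (mem_homogCochain_homCochain _) h1 (fun j hj => ?_)
    (hS.congr (fun i j => nm_swap i j Ω) hn), h1⟩, ?_, ?_⟩⟩
  · rw [hΩ, nm_homCochain _ (by omega), if_neg (by omega)]
  · rw [hlt 3 4 le_rfl (by omega) (by omega)]
    exact sub_zero _
  · rw [hlt 4 5 (by omega) (by omega) (by omega)]
    exact sub_zero _

theorem Exceptional.excPoly_eq_zero (hk : 12 ≤ k) (h : Exceptional k lam) :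
    excPoly k (2 * lam + k - 1) = 0 := by
  have hk' : (12 : ℝ) ≤ k := by exact_mod_cast hk
  have hs := Real.sq_sqrt (by linarith : (0 : ℝ) ≤ 12 * k - 23)
  rw [excPoly]
  rcases h with rfl | rfl | rfl
  · ring
  · linear_combination √(12 * k - 23) * hs
  · linear_combination (-√(12 * k - 23)) * hs

theorem exceptional_of_excPoly_eq_zero (hk : 12 ≤ k) (h : excPoly k (2 * lam + k - 1) = 0) :
    Exceptional k lam := by
  have hk' : (12 : ℝ) ≤ k := by exact_mod_cast hk
  have hs := Real.sq_sqrt (by linarith : (0 : ℝ) ≤ 12 * k - 23)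
  rcases mul_eq_zero.1 h with h | h
  · left
    linarith
  · have h1 : (2 * lam + k - 1 - √(12 * k - 23)) * (2 * lam + k - 1 + √(12 * k - 23)) = 0 := by
      linear_combination h - hs
    rcases mul_eq_zero.1 h1 with h | h
    · right; left
      linarith
    · right; right
      linarith

theorem defect_ne_zero_of_qPoly_ne_zero (hk : 7 ≤ k) (hq : qPoly k (2 * lam + k - 1) ≠ 0)
    {Ω : Cochain2 lam (lam + k)} (h : IsRelCocycle k lam 0 1 Ω) : defect lam k Ω ≠ 0 := by
  obtain ⟨-, h1, h2⟩ := (isRelCocycle_iff hk).1 h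
  rw [defect_apply, h1, h2, mul_zero, mul_zero, sub_zero]
  exact mul_ne_zero (mul_ne_zero (by norm_num) hq) (by positivity)

theorem defect_ne_zero_of_qPoly_eq_zero (hk : 7 ≤ k) (hq : qPoly k (2 * lam + k - 1) = 0)
    {Ω : Cochain2 lam (lam + k)} (h : IsRelCocycle k lam 1 0 Ω) : defect lam k Ω ≠ 0 := by
  obtain ⟨-, h1, -⟩ := (isRelCocycle_iff hk).1 h
  have hr := (qPoly_ne_zero_or_rPoly_ne_zero (by exact_mod_cast (by omega : 1 < k))
    (2 * lam + k - 1)).resolve_left (not_not.2 hq)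
  rw [defect_apply, h1, hq, mul_zero, zero_mul, zero_sub]
  exact neg_ne_zero.2 (mul_ne_zero hr (by positivity))

theorem nonempty_equiv_real_of_exists (hk : 7 ≤ k)
    (h : ∀ a b, ∃ Ω, IsRelCocycle k lam a b Ω) : Nonempty (H2 lam (lam + k) ≃ₗ[ℝ] ℝ) := by
  obtain ⟨Ω, hΩ, h0⟩ : ∃ Ω ∈ normalZ2 lam k, defect lam k Ω ≠ 0 := by
    by_cases hq : qPoly k (2 * lam + k - 1) = 0
    · obtain ⟨Ω, hΩ⟩ := h 1 0
      exact ⟨Ω, hΩ.mem_normalZ2, defect_ne_zero_of_qPoly_eq_zero hk hq hΩ⟩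
    · obtain ⟨Ω, hΩ⟩ := h 0 1
      exact ⟨Ω, hΩ.mem_normalZ2, defect_ne_zero_of_qPoly_ne_zero hk hq hΩ⟩
  exact nonempty_equiv_real (defect lam k) (fun c hc => mem_B2_iff_defect_eq_zero hc hk) hΩ h0

/-- `defect` vanishes by the degree 17 obstruction for k ≥ 15, and by the degree 14 obstruction for
k = 12, 13, 14. -/
theorem Z2_le_B2_of_not_exceptional (hk : 12 ≤ k) (h : k ≤ 14 → ¬Exceptional k lam) :
    Z2 lam (lam + k) ≤ B2 lam (lam + k) := by
  refine Z2_le_B2_of_normalZ2_le fun c hc => (mem_B2_iff_defect_eq_zero hc (by omega)).2 ?_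
  rcases le_or_gt 15 k with h15 | h15
  · exact defect_eq_zero hc h15
  · exact (mul_eq_zero.1 (excPoly_mul_defect hc hk)).resolve_left fun he =>
      h (by omega) (exceptional_of_excPoly_eq_zero hk he)

end VectCoh
end

/-! ### The explicit cocycles for k at most six -/

noncomputable section
namespace VectCoh

variable {lam mu : ℝ} {k : ℕ}

theorem mem_normalZ2_of_rel {c : Cochain2 lam (lam + k)} (hc : c ∈ homogCochain lam (lam + k))
    (h : ∀ j, 3 ≤ j → j ≤ k → nm 2 j c = 0)
    (h1 : ∀ j m, 2 ≤ j → j < m → j + m ≤ k + 2 →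
      eulerRel lam (fun i j => nm i j c) j m (k + 2 - j - m) = 0)
    (h2 : ∀ i j m, 2 ≤ i → i < j → j < m → i + j + m ≤ k + 3 →
      tripleRel lam (fun i j => nm i j c) i j m (k + 3 - i - j - m) = 0) : c ∈ normalZ2 lam k := by
  refine ⟨mem_Z2_of_rel hc h1 h2, hc, fun j hj => ?_⟩
  rcases le_or_gt j k with hjk | hjk
  · exact h j hj hjk
  · exact nm_eq_zero_of_lt hc (by omega)

/-- `Ω₁` with values in an arbitrary `D_{lam,mu}`. -/
def omega1 : Cochain2 lam mu := detOp 1 2 0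

/-- `Ω₂` with values in an arbitrary `D_{lam,mu}`. -/
def omega2 (c12 c13 : ℝ) : Cochain2 lam mu := c12 • detOp 1 2 1 + c13 • detOp 1 3 0

/-- `Ω₃` with values in an arbitrary `D_{lam,mu}`. -/
def omega3 (c12 c13 : ℝ) : Cochain2 lam mu :=
  c12 • detOp 1 2 2 + c13 • detOp 1 3 1 + (lam / 2 * (c12 - c13)) • detOp 1 4 0

/-- `Ω₄` with values in an arbitrary `D_{lam,mu}`. -/
def omega4 (c12 c13 : ℝ) : Cochain2 lam mu :=
  c12 • detOp 1 2 3 + (1 / 2 * ((1 + 3 * lam) * c12 - (1 + 2 * lam) * c13)) • detOp 1 4 1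
    + c13 • detOp 1 3 2
    + (lam / 10 * ((1 - 3 * lam) * c12 + (1 + 2 * lam) * c13)) • detOp 1 5 0

/-- `Ω₅` with values in an arbitrary `D_{lam,mu}`. -/
def omega5 (α β : ℝ) : Cochain2 lam mu :=
  (3 * α * (1 + lam) * (1 + 2 * lam)) • detOp 1 2 4
    + (2 * α * (1 + 3 * lam + 6 * lam ^ 2)) • detOp 1 3 3
    + (3 * α * (1 + lam) * (1 + 4 * lam)) • detOp 1 4 2
    + (-(1 / 5 * α * lam * (1 + 9 * lam))) • detOp 1 6 0
    + β • detOp 3 4 0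

/-- `Ω₆` with values in an arbitrary `D_{lam,mu}`. -/
def omega6 (α β : ℝ) : Cochain2 lam mu :=
  (α * (4 + 3 * lam * (5 + 2 * lam))) • detOp 1 2 5
    + (5 * α * (2 + lam * (4 + 3 * lam))) • detOp 1 3 4
    + (5 * α * (lam * (3 + 4 * lam) - 2)) • detOp 1 4 3
    + (5 * α * (2 + lam * (4 + 3 * lam))) • detOp 1 5 2
    + β • detOp 3 4 1
    + (α * (4 + 15 * lam + 6 * lam ^ 2)) • detOp 1 6 1
    + (-(lam / 5 * β)) • detOp 3 5 0

theorem smul_detOp_mem {i j l : ℕ} (r : ℝ) (hi : 1 ≤ i) (hj : 1 ≤ j) (h : i + j + l = k + 2) :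
    (r • detOp i j l : Cochain2 lam (lam + k)) ∈ homogCochain lam (lam + k) :=
  Submodule.smul_mem _ r (detOp_mem_homogCochain hi hj h)

theorem omega1_mem : (omega1 : Cochain2 lam (lam + (1 : ℕ))) ∈ normalZ2 lam 1 := by
  refine mem_normalZ2_of_rel (detOp_mem_homogCochain (by omega) (by omega) (by omega))
    (fun j hj hj' => ?_) (fun j m hj hjm h => ?_) fun i j m hi hij hjm h => ?_
  -- For k = 1 the index range of every relation is empty.
  all_goals omega

theorem omega2_mem (c12 c13 : ℝ) :
    (omega2 c12 c13 : Cochain2 lam (lam + (2 : ℕ))) ∈ normalZ2 lam 2 := by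
  refine mem_normalZ2_of_rel ?_ (fun j hj hj' => ?_) (fun j m hj hjm h => ?_)
    fun i j m hi hij hjm h => ?_
  · exact add_mem (smul_detOp_mem _ (by omega) (by omega) (by omega))
      (smul_detOp_mem _ (by omega) (by omega) (by omega))
  all_goals omega

theorem omega3_mem (c12 c13 : ℝ) :
    (omega3 c12 c13 : Cochain2 lam (lam + (3 : ℕ))) ∈ normalZ2 lam 3 := by
  refine mem_normalZ2_of_rel ?_ (fun j hj hj' => ?_) (fun j m hj hjm h => ?_)
    fun i j m hi hij hjm h => ?_
  · exact add_mem (add_mem (smul_detOp_mem _ (by omega) (by omega) (by omega))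
      (smul_detOp_mem _ (by omega) (by omega) (by omega)))
      (smul_detOp_mem _ (by omega) (by omega) (by omega))
  · obtain rfl : j = 3 := by omega
    simp only [omega3, map_add, map_smul, smul_eq_mul, nm_detOp]
    norm_num
  · obtain ⟨rfl, rfl⟩ : j = 2 ∧ m = 3 := by omega
    simp only [eulerRel, omega3, map_add, map_smul, smul_eq_mul, nm_detOp]
    norm_num [Nat.factorial]
    ring
  · omega

theorem omega4_mem (c12 c13 : ℝ) :
    (omega4 c12 c13 : Cochain2 lam (lam + (4 : ℕ))) ∈ normalZ2 lam 4 := by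
  refine mem_normalZ2_of_rel ?_ (fun j hj hj' => ?_) (fun j m hj hjm h => ?_)
    fun i j m hi hij hjm h => ?_
  · exact add_mem (add_mem (add_mem (smul_detOp_mem _ (by omega) (by omega) (by omega))
      (smul_detOp_mem _ (by omega) (by omega) (by omega)))
      (smul_detOp_mem _ (by omega) (by omega) (by omega)))
      (smul_detOp_mem _ (by omega) (by omega) (by omega))
  · interval_cases j <;> simp only [omega4, map_add, map_smul, smul_eq_mul, nm_detOp] <;> norm_num
  · obtain rfl : j = 2 := by omega
    obtain rfl | rfl : m = 3 ∨ m = 4 := by omega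
    all_goals
      simp only [eulerRel, omega4, map_add, map_smul, smul_eq_mul, nm_detOp]
      norm_num [Nat.factorial]
      ring
  · omega

theorem omega5_mem (hlam : lam = 0 ∨ lam = -4) (α β : ℝ) :
    (omega5 α β : Cochain2 lam (lam + (5 : ℕ))) ∈ normalZ2 lam 5 := by
  refine mem_normalZ2_of_rel ?_ (fun j hj hj' => ?_) (fun j m hj hjm h => ?_)
    fun i j m hi hij hjm h => ?_
  · exact add_mem (add_mem (add_mem (add_mem (smul_detOp_mem _ (by omega) (by omega) (by omega))
      (smul_detOp_mem _ (by omega) (by omega) (by omega)))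
      (smul_detOp_mem _ (by omega) (by omega) (by omega)))
      (smul_detOp_mem _ (by omega) (by omega) (by omega)))
      (smul_detOp_mem _ (by omega) (by omega) (by omega))
  · interval_cases j <;> simp only [omega5, map_add, map_smul, smul_eq_mul, nm_detOp] <;> norm_num
  · obtain ⟨rfl, rfl⟩ | ⟨rfl, rfl⟩ | ⟨rfl, rfl⟩ | ⟨rfl, rfl⟩ :
        j = 2 ∧ m = 3 ∨ j = 2 ∧ m = 4 ∨ j = 2 ∧ m = 5 ∨ j = 3 ∧ m = 4 := by omega
    all_goals
      simp only [eulerRel, omega5, map_add, map_smul, smul_eq_mul, nm_detOp]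
      norm_num [Nat.factorial]
      rcases hlam with rfl | rfl <;> ring
  · omega

theorem omega6_mem (hlam : 2 * lam ^ 2 + 10 * lam + 3 = 0) (α β : ℝ) :
    (omega6 α β : Cochain2 lam (lam + (6 : ℕ))) ∈ normalZ2 lam 6 := by
  refine mem_normalZ2_of_rel ?_ (fun j hj hj' => ?_) (fun j m hj hjm h => ?_)
    fun i j m hi hij hjm h => ?_
  · exact add_mem (add_mem (add_mem (add_mem (add_mem (add_mem
      (smul_detOp_mem _ (by omega) (by omega) (by omega))
      (smul_detOp_mem _ (by omega) (by omega) (by omega)))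
      (smul_detOp_mem _ (by omega) (by omega) (by omega)))
      (smul_detOp_mem _ (by omega) (by omega) (by omega)))
      (smul_detOp_mem _ (by omega) (by omega) (by omega)))
      (smul_detOp_mem _ (by omega) (by omega) (by omega)))
      (smul_detOp_mem _ (by omega) (by omega) (by omega))
  · interval_cases j <;> simp only [omega6, map_add, map_smul, smul_eq_mul, nm_detOp] <;> norm_num
  -- The pair (2, 5) is listed first because it alone needs the quadratic equation for lam; the
  -- other relations are identities.
  · obtain ⟨rfl, rfl⟩ | ⟨rfl, rfl⟩ | ⟨rfl, rfl⟩ | ⟨rfl, rfl⟩ | ⟨rfl, rfl⟩ | ⟨rfl, rfl⟩ :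
        j = 2 ∧ m = 5 ∨ j = 2 ∧ m = 3 ∨ j = 2 ∧ m = 4 ∨ j = 2 ∧ m = 6 ∨ j = 3 ∧ m = 4 ∨
          j = 3 ∧ m = 5 := by omega
    all_goals
      simp only [eulerRel, omega6, map_add, map_smul, smul_eq_mul, nm_detOp]
      norm_num [Nat.factorial]
    · linear_combination 3360 * α * hlam
    all_goals ring
  · obtain ⟨rfl, rfl, rfl⟩ : i = 2 ∧ j = 3 ∧ m = 4 := by omega
    simp only [tripleRel, omega6, map_add, map_smul, smul_eq_mul, nm_detOp]
    norm_num [Nat.factorial]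
    ring

theorem gDet_omega2 (c12 c13 : ℝ) : gDet lam 2 (omega2 c12 c13) =
    6 * ((2 * lam + 1) * c13 - lam * c12) := by
  rw [gDet_apply]
  simp only [omega2, map_add, map_smul, smul_eq_mul, nm_detOp]
  norm_num [Nat.factorial]
  ring

theorem gDet_omega3 (c12 c13 : ℝ) : gDet lam 3 (omega3 c12 c13) =
    4 * (3 * (lam + 1) * c13 - (1 + 3 * lam) * c12) := by
  rw [gDet_apply]
  simp only [omega3, map_add, map_smul, smul_eq_mul, nm_detOp]
  norm_num [Nat.factorial]
  ring

theorem gDet_omega4 (c12 c13 : ℝ) : gDet lam 4 (omega4 c12 c13) =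
    12 * ((2 * lam + 3) * c13 - (2 + 3 * lam) * c12) := by
  rw [gDet_apply]
  simp only [omega4, map_add, map_smul, smul_eq_mul, nm_detOp]
  norm_num [Nat.factorial]
  ring

theorem gDet_omega5 (α β : ℝ) : gDet lam 5 (omega5 α β) =
    α * (36 * ((2 * lam + 4) * (2 * (1 + 3 * lam + 6 * lam ^ 2)))
      - 48 * (3 + 3 * lam) * (3 * (1 + lam) * (1 + 2 * lam))) := by
  rw [gDet_apply]
  simp only [omega5, map_add, map_smul, smul_eq_mul, nm_detOp]
  norm_num [Nat.factorial]
  ring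

theorem nm_omega5 (α β : ℝ) : nm 3 4 (omega5 α β : Cochain2 lam (lam + (5 : ℕ))) = 144 * β := by
  simp only [omega5, map_add, map_smul, smul_eq_mul, nm_detOp]
  norm_num [Nat.factorial]
  ring

theorem gDet_omega6 (α β : ℝ) : gDet lam 6 (omega6 α β) = 3360 * α := by
  rw [gDet_apply]
  simp only [omega6, map_add, map_smul, smul_eq_mul, nm_detOp]
  norm_num [Nat.factorial]
  ring

theorem nm_omega6 (α β : ℝ) : nm 3 4 (omega6 α β : Cochain2 lam (lam + (6 : ℕ))) = 144 * β := by
  simp only [omega6, map_add, map_smul, smul_eq_mul, nm_detOp]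
  norm_num [Nat.factorial]
  ring

end VectCoh
end

/-! ### Bases for small k and the dimension table -/

noncomputable section
namespace VectCoh

variable {lam mu : ℝ} {k : ℕ}

theorem mem_B2_iff_nm_one_two {c : Cochain2 0 (0 + (1 : ℕ))} (hc : c ∈ normalZ2 0 1) :
    c ∈ B2 0 (0 + (1 : ℕ)) ↔ nm 1 2 c = 0 := by
  refine ⟨fun h => ?_, fun h => ?_⟩
  · obtain ⟨⟨s, h1, -⟩, -⟩ := nm_of_mem_B2 hc h
    rw [h1 le_rfl]
    simp
  · refine mem_B2_of_nm hc le_rfl (s := 0) (t := 0) ?_ (fun _ => by omega) (fun _ => by omega)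
      fun _ => by omega
    rw [h, mul_zero]

/-- For k = 1 the only entry is `nm 1 2`, and coboundaries realise every multiple of 2 lam there. -/
theorem Z2_le_B2_of_ne_zero (h0 : lam ≠ 0) : Z2 lam (lam + (1 : ℕ)) ≤ B2 lam (lam + (1 : ℕ)) := by
  refine Z2_le_B2_of_normalZ2_le fun c hc => ?_
  refine mem_B2_of_nm hc le_rfl (s := nm 1 2 c / (2 * lam)) (t := 0) ?_ (fun _ => by omega)
    (fun _ => by omega) fun _ => by omega
  rw [Nat.cast_one, add_sub_cancel_right]
  field_simp

theorem nm_omega1 : nm 1 2 (omega1 : Cochain2 lam (lam + (1 : ℕ))) ≠ 0 := by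
  simp only [omega1, nm_detOp]
  norm_num [Nat.factorial]

/-- On the cocycle with constants (0, 1) the value of `gDet` is a non-zero multiple of 2 lam + k -
1. It degenerates exactly at lam = (1 - k) / 2, where the constants (1, 0) work instead. -/
theorem exists_gDet_ne_zero (hk : 2 ≤ k) (hk' : k ≤ 4) :
    ∃ Ω ∈ normalZ2 lam k, gDet lam k Ω ≠ 0 := by
  interval_cases k
  · by_cases h : lam = -1 / 2
    · exact ⟨_, omega2_mem 1 0, by rw [gDet_omega2, h]; norm_num⟩
    · refine ⟨_, omega2_mem 0 1, fun h0 => h ?_⟩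
      rw [gDet_omega2] at h0
      linarith
  · by_cases h : lam = -1
    · exact ⟨_, omega3_mem 1 0, by rw [gDet_omega3, h]; norm_num⟩
    · refine ⟨_, omega3_mem 0 1, fun h0 => h ?_⟩
      rw [gDet_omega3] at h0
      linarith
  · by_cases h : lam = -3 / 2
    · exact ⟨_, omega4_mem 1 0, by rw [gDet_omega4, h]; norm_num⟩
    · refine ⟨_, omega4_mem 0 1, fun h0 => h ?_⟩
      rw [gDet_omega4] at h0
      linarith

theorem spans_of_gDet_ne_zero (hk : 2 ≤ k) (hk' : k ≤ 4) {Ω : Cochain2 lam (lam + k)}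
    (hΩ : Ω ∈ normalZ2 lam k) (h : gDet lam k Ω ≠ 0) : Spans {Ω} :=
  spans_singleton _ (fun _ hc => mem_B2_iff_of_le_four hc hk hk') hΩ h

/-- Keeping mu as a variable, here and in the following statements, bridges the numeral weights such
as lam + 2 and the cast weights lam + (2 : ℕ) of the general theory. -/
theorem spans_omega1 (h : mu = 0 + (1 : ℕ)) : Spans {(omega1 : Cochain2 0 mu)} := by
  subst h
  exact spans_singleton _ (fun _ hc => mem_B2_iff_nm_one_two hc) omega1_mem nm_omega1

theorem spans_omega2 (h : mu = lam + (2 : ℕ)) {c12 c13 : ℝ}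
    (h0 : 6 * ((2 * lam + 1) * c13 - lam * c12) ≠ 0) :
    Spans {(omega2 c12 c13 : Cochain2 lam mu)} := by
  subst h
  exact spans_of_gDet_ne_zero le_rfl (by omega) (omega2_mem c12 c13) (by rwa [gDet_omega2])

theorem spans_omega3 (h : mu = lam + (3 : ℕ)) {c12 c13 : ℝ}
    (h0 : 4 * (3 * (lam + 1) * c13 - (1 + 3 * lam) * c12) ≠ 0) :
    Spans {(omega3 c12 c13 : Cochain2 lam mu)} := by
  subst h
  exact spans_of_gDet_ne_zero (by omega) (by omega) (omega3_mem c12 c13) (by rwa [gDet_omega3])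

theorem spans_omega4 (h : mu = lam + (4 : ℕ)) {c12 c13 : ℝ}
    (h0 : 12 * ((2 * lam + 3) * c13 - (2 + 3 * lam) * c12) ≠ 0) :
    Spans {(omega4 c12 c13 : Cochain2 lam mu)} := by
  subst h
  exact spans_of_gDet_ne_zero (by omega) le_rfl (omega4_mem c12 c13) (by rwa [gDet_omega4])

theorem qPoly_five : qPoly (5 : ℕ) (2 * lam + (5 : ℕ) - 1) = 4 * (lam * (lam + 4)) := by
  rw [qPoly]
  push_cast
  ring

theorem qPoly_six : qPoly (6 : ℕ) (2 * lam + (6 : ℕ) - 1) = 2 * (2 * lam ^ 2 + 10 * lam + 3) := by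
  rw [qPoly]
  push_cast
  ring

theorem gDet_omega5_ne_zero (hlam : lam = 0 ∨ lam = -4) (β : ℝ) :
    gDet lam 5 (omega5 1 β) ≠ 0 := by
  rw [gDet_omega5]
  rcases hlam with rfl | rfl <;> norm_num

/-- `gDet` sees only α and `nm 3 4` sees only β, so the two cocycles are, up to scalars, dual to
this pair of forms. -/
theorem omega5_spec (hlam : lam = 0 ∨ lam = -4) :
    qPoly (5 : ℕ) (2 * lam + (5 : ℕ) - 1) = 0 ∧ gDet lam 5 (omega5 1 0) ≠ 0 ∧
      nm 3 4 (omega5 1 0 : Cochain2 lam (lam + (5 : ℕ))) = 0 ∧ gDet lam 5 (omega5 0 1) = 0 ∧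
      nm 3 4 (omega5 0 1 : Cochain2 lam (lam + (5 : ℕ))) ≠ 0 := by
  refine ⟨?_, gDet_omega5_ne_zero hlam 0, ?_, ?_, ?_⟩
  · rw [qPoly_five]
    rcases hlam with rfl | rfl <;> norm_num
  · rw [nm_omega5, mul_zero]
  · rw [gDet_omega5, zero_mul]
  · rw [nm_omega5]
    norm_num

theorem omega6_spec (hlam : 2 * lam ^ 2 + 10 * lam + 3 = 0) :
    qPoly (6 : ℕ) (2 * lam + (6 : ℕ) - 1) = 0 ∧ gDet lam 6 (omega6 1 0) ≠ 0 ∧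
      nm 3 4 (omega6 1 0 : Cochain2 lam (lam + (6 : ℕ))) = 0 ∧ gDet lam 6 (omega6 0 1) = 0 ∧
      nm 3 4 (omega6 0 1 : Cochain2 lam (lam + (6 : ℕ))) ≠ 0 := by
  refine ⟨?_, ?_, ?_, ?_, ?_⟩
  · rw [qPoly_six, hlam, mul_zero]
  · rw [gDet_omega6]
    norm_num
  · rw [nm_omega6, mul_zero]
  · rw [gDet_omega6, mul_zero]
  · rw [nm_omega6]
    norm_num

theorem spans_omega5 (h : mu = lam + (5 : ℕ)) (hlam : lam = 0 ∨ lam = -4) :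
    (∀ α β, (omega5 α β : Cochain2 lam mu) ∈ Z2 lam mu) ∧
      Spans {(omega5 1 0 : Cochain2 lam mu), omega5 0 1} := by
  subst h
  obtain ⟨h1, h2, h3, h4, h5⟩ := omega5_spec hlam
  exact ⟨fun α β => (omega5_mem hlam α β).1, spans_pair le_rfl (by omega) h1 (omega5_mem hlam 1 0)
    (omega5_mem hlam 0 1) h2 h3 h4 h5⟩

theorem spans_omega6 (h : mu = lam + (6 : ℕ)) (hlam : 2 * lam ^ 2 + 10 * lam + 3 = 0) :
    (∀ α β, (omega6 α β : Cochain2 lam mu) ∈ Z2 lam mu) ∧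
      Spans {(omega6 1 0 : Cochain2 lam mu), omega6 0 1} := by
  subst h
  obtain ⟨h1, h2, h3, h4, h5⟩ := omega6_spec hlam
  exact ⟨fun α β => (omega6_mem hlam α β).1, spans_pair (by omega) le_rfl h1 (omega6_mem hlam 1 0)
    (omega6_mem hlam 0 1) h2 h3 h4 h5⟩

theorem two_mul_sq_add_eq_zero_iff : 2 * lam ^ 2 + 10 * lam + 3 = 0 ↔
    lam = -5 / 2 + √19 / 2 ∨ lam = -5 / 2 - √19 / 2 := by
  have hs := Real.sq_sqrt (by norm_num : (0 : ℝ) ≤ 19)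
  constructor
  · intro h
    have h1 : (lam - (-5 / 2 + √19 / 2)) * (lam - (-5 / 2 - √19 / 2)) = 0 := by
      linear_combination h / 2 - hs / 4
    rcases mul_eq_zero.1 h1 with h | h
    · exact Or.inl (sub_eq_zero.1 h)
    · exact Or.inr (sub_eq_zero.1 h)
  · rintro (rfl | rfl) <;> linear_combination hs / 2

theorem nonempty_equiv_real_of_dimOne (h : DimOne lam mu) : Nonempty (H2 lam mu ≃ₗ[ℝ] ℝ) := by
  rcases h with ⟨rfl, h⟩ | ⟨k, hk, hk', h⟩ | ⟨k, hk, hk', h⟩ | ⟨k, hk, hk', h, he⟩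
  · obtain rfl : mu = 0 + (1 : ℕ) := by simpa using h
    exact nonempty_equiv_real _ (fun _ hc => mem_B2_iff_nm_one_two hc) omega1_mem nm_omega1
  all_goals obtain rfl : mu = lam + k := by linarith
  · obtain ⟨Ω, hΩ, h0⟩ := exists_gDet_ne_zero (lam := lam) hk hk'
    exact nonempty_equiv_real _ (fun _ hc => mem_B2_iff_of_le_four hc hk hk') hΩ h0
  · exact nonempty_equiv_real_of_exists hk
      (exists_isRelCocycle hk (by omega) fun _ => by omega)
  · exact nonempty_equiv_real_of_exists (by omega)
      (exists_isRelCocycle (by omega) hk' fun _ => he.excPoly_eq_zero hk)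

theorem nonempty_equiv_fin_two_of_dimTwo (h : DimTwo lam mu) :
    Nonempty (H2 lam mu ≃ₗ[ℝ] (Fin 2 → ℝ)) := by
  have h' : mu = lam + (5 : ℕ) ∧ (lam = 0 ∨ lam = -4) ∨
      mu = lam + (6 : ℕ) ∧ 2 * lam ^ 2 + 10 * lam + 3 = 0 := by
    rw [two_mul_sq_add_eq_zero_iff]
    push_cast
    rcases h with ⟨h, rfl⟩ | ⟨h, rfl⟩ | ⟨h, rfl⟩ | ⟨h, rfl⟩
    · exact Or.inl ⟨by rw [h]; norm_num, Or.inl h⟩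
    · exact Or.inl ⟨by rw [h]; norm_num, Or.inr h⟩
    · exact Or.inr ⟨by rw [h]; ring, Or.inl h⟩
    · exact Or.inr ⟨by rw [h]; ring, Or.inr h⟩
  rcases h' with ⟨rfl, hlam⟩ | ⟨rfl, hlam⟩
  · obtain ⟨h1, h2, h3, h4, h5⟩ := omega5_spec hlam
    exact nonempty_equiv_fin_two le_rfl (by omega) h1 (omega5_mem hlam 1 0) (omega5_mem hlam 0 1)
      h2 h3 h4 h5
  · obtain ⟨h1, h2, h3, h4, h5⟩ := omega6_spec hlam
    exact nonempty_equiv_fin_two (by omega) le_rfl h1 (omega6_mem hlam 1 0) (omega6_mem hlam 0 1)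
      h2 h3 h4 h5

theorem Z2_le_B2_of_not_dim (h1 : ¬DimOne lam mu) (h2 : ¬DimTwo lam mu) :
    Z2 lam mu ≤ B2 lam mu := by
  by_cases h : ∃ k : ℕ, 1 ≤ k ∧ mu - lam = k
  swap
  · push Not at h
    exact Z2_le_B2_of_forall_ne h
  obtain ⟨k, hk, h⟩ := h
  have hd : k = 1 ∨ (2 ≤ k ∧ k ≤ 4) ∨ k = 5 ∨ k = 6 ∨ (7 ≤ k ∧ k ≤ 11) ∨ 12 ≤ k := by omega
  rcases hd with rfl | hd | rfl | rfl | hd | hd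
  · obtain rfl : mu = lam + (1 : ℕ) := by linarith
    refine Z2_le_B2_of_ne_zero fun h0 => h1 (Or.inl ⟨h0, ?_⟩)
    rw [h0, zero_add, Nat.cast_one]
  · exact absurd (Or.inr (Or.inl ⟨k, hd.1, hd.2, h⟩)) h1
  · obtain rfl : mu = lam + (5 : ℕ) := by linarith
    refine Z2_le_B2_of_normalZ2_le fun c hc => mem_B2_of_qPoly_ne_zero hc le_rfl (by omega)
      fun hq => h2 ?_
    rw [qPoly_five] at hq
    have hq' : lam * (lam + 4) = 0 := by linarith
    rcases mul_eq_zero.1 hq' with h0 | h0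
    · exact Or.inl ⟨h0, by rw [h0]; norm_num⟩
    · have h0 : lam = -4 := by linarith
      exact Or.inr (Or.inl ⟨h0, by rw [h0]; norm_num⟩)
  · obtain rfl : mu = lam + (6 : ℕ) := by linarith
    refine Z2_le_B2_of_normalZ2_le fun c hc => mem_B2_of_qPoly_ne_zero hc (by omega) le_rfl
      fun hq => h2 ?_
    rw [qPoly_six] at hq
    rcases two_mul_sq_add_eq_zero_iff.1 (by linarith) with h0 | h0
    · exact Or.inr (Or.inr (Or.inl ⟨h0, by rw [h0]; push_cast; ring⟩))
    · exact Or.inr (Or.inr (Or.inr ⟨h0, by rw [h0]; push_cast; ring⟩))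
  · exact absurd (Or.inr (Or.inr (Or.inl ⟨k, hd.1, hd.2, h⟩))) h1
  · obtain rfl : mu = lam + k := by linarith
    exact Z2_le_B2_of_not_exceptional hd fun h14 he =>
      h1 (Or.inr (Or.inr (Or.inr ⟨k, hd, h14, h, he⟩)))

theorem qPoly_eq : qPoly k (2 * lam + k - 1) =
    (k : ℝ) ^ 2 + 4 * (lam - 1) * lam + k * (4 * lam - 5) := by
  rw [qPoly]
  ring

theorem spans_of_defect_ne_zero (hk : 7 ≤ k) {Ω : Cochain2 lam (lam + k)}
    (hΩ : Ω ∈ normalZ2 lam k) (h : defect lam k Ω ≠ 0) : Spans {Ω} :=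
  spans_singleton _ (fun _ hc => mem_B2_iff_defect_eq_zero hc hk) hΩ h

end VectCoh
end

open VectCoh in
theorem mainTheorem3 :
    -- the dimension table
    (∀ lam mu : ℝ,
      (DimOne lam mu → Nonempty (H2 lam mu ≃ₗ[ℝ] ℝ)) ∧
      (DimTwo lam mu → Nonempty (H2 lam mu ≃ₗ[ℝ] (Fin 2 → ℝ))) ∧
      (¬ DimOne lam mu → ¬ DimTwo lam mu → Subsingleton (H2 lam mu))) ∧
    -- the cocycles for `mu - lam = 1, …, 6`
    Spans {Omega1} ∧
    (∀ lam : ℝ,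
      (lam = -1 / 2 → Spans {Omega2 lam 1 0}) ∧ (lam ≠ -1 / 2 → Spans {Omega2 lam 0 1}) ∧
      (lam = -1 → Spans {Omega3 lam 1 0}) ∧ (lam ≠ -1 → Spans {Omega3 lam 0 1}) ∧
      (lam = -3 / 2 → Spans {Omega4 lam 1 0}) ∧ (lam ≠ -3 / 2 → Spans {Omega4 lam 0 1})) ∧
    (∀ lam : ℝ, lam = 0 ∨ lam = -4 →
      (∀ α β : ℝ, Omega5 lam α β ∈ Z2 lam (lam + 5)) ∧
      Spans {Omega5 lam 1 0, Omega5 lam 0 1}) ∧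
    (∀ lam : ℝ, lam = -5 / 2 + √19 / 2 ∨ lam = -5 / 2 - √19 / 2 →
      (∀ α β : ℝ, Omega6 lam α β ∈ Z2 lam (lam + 6)) ∧
      Spans {Omega6 lam 1 0, Omega6 lam 0 1}) ∧
    -- the cocycles for `mu - lam = k ≥ 7`
    (∀ (k : ℕ) (lam : ℝ), 7 ≤ k →
      Spans (relZ2 lam (lam + k)) ∧
      (∀ Ω ∈ relZ2 lam (lam + k), ∃ c : ℕ → ℕ → ℝ, Ω = homCochain k c)) ∧
    (∀ (k : ℕ) (lam : ℝ), (7 ≤ k ∧ k ≤ 11) ∨ (12 ≤ k ∧ k ≤ 14 ∧ Exceptional k lam) →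
      (∀ a b : ℝ, ∃! Ω, IsRelCocycle k lam a b Ω) ∧
      ((k : ℝ) ^ 2 + 4 * (lam - 1) * lam + k * (4 * lam - 5) ≠ 0 →
        ∀ Ω, IsRelCocycle k lam 0 1 Ω → Spans {Ω}) ∧
      ((k : ℝ) ^ 2 + 4 * (lam - 1) * lam + k * (4 * lam - 5) = 0 →
        ∀ Ω, IsRelCocycle k lam 1 0 Ω → Spans {Ω})) := by
  refine ⟨fun lam mu => ⟨nonempty_equiv_real_of_dimOne, nonempty_equiv_fin_two_of_dimTwo,
    fun h1 h2 => subsingleton_H2_of_le (Z2_le_B2_of_not_dim h1 h2)⟩, spans_omega1 (by norm_num),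
    fun lam => ⟨fun h => spans_omega2 (by norm_num) (by rw [h]; norm_num), fun h => ?_,
      fun h => spans_omega3 (by norm_num) (by rw [h]; norm_num), fun h => ?_,
      fun h => spans_omega4 (by norm_num) (by rw [h]; norm_num), fun h => ?_⟩,
    fun lam hlam => spans_omega5 (by norm_num) hlam,
    fun lam hlam => spans_omega6 (by norm_num) (two_mul_sq_add_eq_zero_iff.2 hlam),
    fun k lam hk => ⟨spans_relZ2 hk, fun Ω => exists_eq_homCochain⟩, fun k lam h => ?_⟩
  · exact spans_omega2 (by norm_num) fun h0 => h (by linarith)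
  · exact spans_omega3 (by norm_num) fun h0 => h (by linarith)
  · exact spans_omega4 (by norm_num) fun h0 => h (by linarith)
  · have hk : 7 ≤ k := by omega
    have he : 12 ≤ k → excPoly k (2 * lam + k - 1) = 0 := fun h12 =>
      (h.resolve_left (by omega)).2.2.excPoly_eq_zero h12
    refine ⟨fun a b => ?_, fun hq Ω hΩ => ?_, fun hq Ω hΩ => ?_⟩
    · obtain ⟨Ω, hΩ⟩ := exists_isRelCocycle hk (by omega) he a b
      exact ⟨Ω, hΩ, fun Ω' hΩ' => hΩ'.eq hk hΩ⟩
    · exact spans_of_defect_ne_zero hk hΩ.mem_normalZ2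
        (defect_ne_zero_of_qPoly_ne_zero hk (by rwa [qPoly_eq]) hΩ)
    · exact spans_of_defect_ne_zero hk hΩ.mem_normalZ2
        (defect_ne_zero_of_qPoly_eq_zero hk (by rwa [qPoly_eq]) hΩ)
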